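/- Let $2\le k\le\infty$. Let $M$ be a 4-dimensional $C^{k+1}$ manifold with boundary (Hausdorff, second countable), with interior $\tilde M$ and boundary $\mathscr I=\partial M$, let $g$ be a $C^k$ Lorentzian metric of signature $(+,-,-,-)$ on $M$, $\tilde g$ a Lorentzian metric on $\tilde M$, and $\Omega:M\to\mathbb R$ a $C^k$ function. Suppose that $(\tilde M,\tilde g)$ is $k$-asymptotically empty and simple with unphysical space-time $(M,g)$ and conformal factor $\Omega$, that is: 1. $\Omega>0$ and $g=\Omega^2\tilde g$ on $\tilde M$; 2. $\Omega=0$ and $d\Omega\neq0$ on $\mathscr I$; 3. every inextendible null geodesic of $(\tilde M,\tilde g)$ has two endpoints on $\mathscr I$, i.e. it converges to a point of $\mathscr I$ in both directions; 4. the Ricci tensor of $\tilde g$ vanishes on $U\cap\tilde M$ for some open neighbourhood $U$ of $\mathscr I$ in $M$. Let $\nabla$ be the Levi-Civita connection of $g$ and $N^a=g^{ab}\nabla_b\Omega$, and suppose that $\mathscr I$ is a null hypersurface, i.e. $g(N,N)=0$ on $\mathscr I$. Then: (a) $\mathscr I$ is shear-free: at every point of $\mathscr I$ and for all $u,w$ tangent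 to $\mathscr I$ with $g(u,u)=g(w,w)=-1$, $g(u,w)=0$, the complex shear $\sigma=m^am^b\nabla_aN_b$, $m=(u+iw)/\sqrt2$, vanishes. (b) Let $\mathscr C$ be a connected component of $\mathscr I$ (such as $\mathscr I^+$ or $\mathscr I^-$). Its generators are the integral curves of $N$ in $\mathscr C$. A cross-section of $\mathscr C$ is a $C^1$ embedded spacelike surface in $\mathscr C$ that meets each generator of $\mathscr C$ exactly once. If $S_1,S_2$ are cross-sections of $\mathscr C$, then the correspondence along the generators is a conformal map: there is a $C^1$ diffeomorphism $h:S_1\to S_2$ such that $p$ and $h(p)$ lie on the same generator for all $p\in S_1$, and $h^*(g|_{S_2})=K\,g|_{S_1}$ for a positive function $K$ on $S_1$. -/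

import Mathlib

open Set Filter Topology
open scoped Manifold ContDiff

noncomputable section

namespace ConformalInfinity

/-- The coordinate space `ℝ⁴`. -/
abbrev E4 : Type := EuclideanSpace ℝ (Fin 4)

section Coordinates

variable {M : Type*} [TopologicalSpace M] [ChartedSpace (EuclideanHalfSpace 4) M]

variable (M) in
/-- A (not necessarily continuous) covariant 2-tensor field on a 4-manifold with boundary. -/
abbrev Tensor2 : Type _ :=
  ∀ p : M, TangentSpace (𝓡∂ 4) p →L[ℝ] TangentSpace (𝓡∂ 4) p →L[ℝ] ℝ

variable (M) in
/-- The charts of the maximal `C^(k+1)` atlas of `M`. -/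
abbrev Charts (k : ℕ∞) : Set (OpenPartialHomeomorph M (EuclideanHalfSpace 4)) :=
  IsManifold.maximalAtlas (𝓡∂ 4) ((k : ℕ∞ω) + 1) M

/-- The set of coordinate points of a chart: a relatively open subset of a closed half-space. -/
abbrev chartTarget (e : OpenPartialHomeomorph M (EuclideanHalfSpace 4)) : Set E4 :=
  (e.extend (𝓡∂ 4)).target

/-- The point of `M` with coordinates `x` in the chart `e`. -/
abbrev chartPoint (e : OpenPartialHomeomorph M (EuclideanHalfSpace 4)) (x : E4) : M :=
  (e.extend (𝓡∂ 4)).symm x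

/-- The partial derivative `∂f/∂xᵃ` of a function on the coordinate half-space
(one-sided at the boundary). -/
def pd (a : Fin 4) (f : E4 → ℝ) (x : E4) : ℝ :=
  fderivWithin ℝ f (range (𝓡∂ 4)) x (EuclideanSpace.single a 1)

/-- The coordinate vector `∂/∂xᵃ` of the chart `e` at the point with coordinates `x`. -/
def coordVec (e : OpenPartialHomeomorph M (EuclideanHalfSpace 4)) (x : E4) (a : Fin 4) :
    TangentSpace (𝓡∂ 4) (chartPoint e x) :=
  mfderivWithin 𝓘(ℝ, E4) (𝓡∂ 4) (e.extend (𝓡∂ 4)).symm (range (𝓡∂ 4)) x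
    (EuclideanSpace.single a (1 : ℝ) : E4)

/-- The components `g_ab` of `g` in the chart `e`. -/
def comp (g : Tensor2 M) (e : OpenPartialHomeomorph M (EuclideanHalfSpace 4)) (x : E4) :
    Matrix (Fin 4) (Fin 4) ℝ :=
  Matrix.of fun a b => g (chartPoint e x) (coordVec e x a) (coordVec e x b)

/-- The Christoffel symbols `Γᶜ_ab = ½ gᶜᵈ (∂_a g_db + ∂_b g_da - ∂_d g_ab)`. -/
def christoffel (g : Tensor2 M) (e : OpenPartialHomeomorph M (EuclideanHalfSpace 4))
    (c a b : Fin 4) (x : E4) : ℝ :=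
  (1 / 2 : ℝ) * ∑ d, (comp g e x)⁻¹ c d *
    (pd a (fun y => comp g e y d b) x + pd b (fun y => comp g e y d a) x
      - pd d (fun y => comp g e y a b) x)

/-- The Ricci tensor
`R_ab = ∂_c Γᶜ_ab - ∂_b Γᶜ_ac + Γᶜ_cd Γᵈ_ab - Γᶜ_bd Γᵈ_ac` in the chart `e`. -/
def ricci (g : Tensor2 M) (e : OpenPartialHomeomorph M (EuclideanHalfSpace 4))
    (a b : Fin 4) (x : E4) : ℝ :=
  ∑ c, (pd c (christoffel g e c a b) x - pd b (christoffel g e c a c) x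
    + ∑ d, (christoffel g e c c d x * christoffel g e d a b x
      - christoffel g e c b d x * christoffel g e d a c x))

/-- The covariant Hessian `∇_a ∇_b Ω = ∂_a ∂_b Ω - Γᶜ_ab ∂_c Ω` in the chart `e`. -/
def hessian (g : Tensor2 M) (Ω : M → ℝ) (e : OpenPartialHomeomorph M (EuclideanHalfSpace 4))
    (a b : Fin 4) (x : E4) : ℝ :=
  pd a (pd b (Ω ∘ chartPoint e)) x
    - ∑ c, christoffel g e c a b x * pd c (Ω ∘ chartPoint e) x

/-- `g` is a `C^k` Lorentzian metric, of signature `(+,-,-,-)`, on the set `U`. -/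
structure IsLorentzMetricOn (k : ℕ∞) (g : Tensor2 M) (U : Set M) : Prop where
  signature : ∀ p ∈ U, ∃ b : Module.Basis (Fin 4) ℝ (TangentSpace (𝓡∂ 4) p),
    ∀ i j, g p (b i) (b j) = if i = j then (if i = 0 then 1 else -1) else 0
  contDiff : ∀ e ∈ Charts M k, ∀ a b : Fin 4,
    ContDiffOn ℝ (k : ℕ∞ω) (fun x => comp g e x a b) (chartTarget e ∩ chartPoint e ⁻¹' U)

/-- `γ`, restricted to the open interval `J`, is an affinely parametrised null geodesic of `g`
in the set `U`: `γ̈ᶜ + Γᶜ_ab γ̇ᵃ γ̇ᵇ = 0` in all charts, with `γ̇ ≠ 0` null. -/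
structure IsNullGeodesicOn (k : ℕ∞) (g : Tensor2 M) (U : Set M) (γ : ℝ → M) (J : Set ℝ) :
    Prop where
  isOpen : IsOpen J
  ordConnected : J.OrdConnected
  nonempty : J.Nonempty
  mapsTo : MapsTo γ J U
  continuousOn : ContinuousOn γ J
  geodesic : ∀ t ∈ J, ∀ e ∈ Charts M k, γ t ∈ e.source → ∃ v : ℝ → E4,
    (∀ᶠ s in 𝓝 t, HasDerivAt (e.extend (𝓡∂ 4) ∘ γ) (v s) s) ∧
    v t ≠ 0 ∧
    ∑ a, ∑ b, comp g e (e.extend (𝓡∂ 4) (γ t)) a b * v t a * v t b = 0 ∧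
    ∀ c, HasDerivAt (fun s => v s c)
      (-∑ a, ∑ b, christoffel g e c a b (e.extend (𝓡∂ 4) (γ t)) * v t a * v t b) t

/-- A null geodesic in `U` that cannot be extended to a larger interval within `U`. -/
structure IsMaximalNullGeodesicOn (k : ℕ∞) (g : Tensor2 M) (U : Set M) (γ : ℝ → M)
    (J : Set ℝ) : Prop where
  isNullGeodesicOn : IsNullGeodesicOn k g U γ J
  maximal : ∀ (γ' : ℝ → M) (J' : Set ℝ), IsNullGeodesicOn k g U γ' J' → J ⊆ J' →
    EqOn γ γ' J → J' = J

/-- `γ`, restricted to the open interval `J`, has two endpoints in the set `B`: it converges to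
points of `B` as the parameter tends to the lower and to the upper end of `J`. -/
def HasTwoEndpointsIn (γ : ℝ → M) (J : Set ℝ) (B : Set M) : Prop :=
  (∃ p ∈ B, Tendsto (fun t : J => γ t) atBot (𝓝 p)) ∧
  (∃ q ∈ B, Tendsto (fun t : J => γ t) atTop (𝓝 q))

variable (M) in
/-- Null infinity `𝓘`: the boundary of `M`. -/
abbrev scri : Set M := (𝓡∂ 4).boundary M

variable (M) in
/-- The point set of the physical space-time: the interior of `M`. -/
abbrev physical : Set M := (𝓡∂ 4).interior M

/-- The physical space-time, i.e. the interior of `M` with the metric `gt`, is `k`-asymptotically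
simple, with unphysical space-time `(M, g)` and conformal factor `Ω`. (The values of `gt` on the
boundary of `M` play no role.) -/
structure IsAsymptoticallySimple (k : ℕ∞) (gt g : Tensor2 M) (Ω : M → ℝ) : Prop where
  physicalMetric : IsLorentzMetricOn k gt (physical M)
  unphysicalMetric : IsLorentzMetricOn k g univ
  contMDiff : ContMDiff (𝓡∂ 4) 𝓘(ℝ, ℝ) (k : ℕ∞ω) Ω
  pos : ∀ p ∈ physical M, 0 < Ω p
  conformal : ∀ p ∈ physical M, g p = (Ω p) ^ 2 • gt p
  zero : ∀ p ∈ scri M, Ω p = 0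
  gradient_ne_zero : ∀ p ∈ scri M, mfderiv (𝓡∂ 4) 𝓘(ℝ, ℝ) Ω p ≠ 0
  endpoints : ∀ (γ : ℝ → M) (J : Set ℝ), IsMaximalNullGeodesicOn k gt (physical M) γ J →
    HasTwoEndpointsIn γ J (scri M)

/-- `k`-asymptotically empty and simple: in addition the physical Ricci tensor vanishes near
null infinity. -/
structure IsAsymptoticallyEmptyAndSimple (k : ℕ∞) (gt g : Tensor2 M) (Ω : M → ℝ) : Prop
    extends IsAsymptoticallySimple k gt g Ω where
  empty : ∃ U : Set M, IsOpen U ∧ scri M ⊆ U ∧ ∀ e ∈ Charts M k, ∀ x ∈ chartTarget e,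
    chartPoint e x ∈ U ∩ physical M → ∀ a b, ricci gt e a b x = 0

/-- The normal vector `Nᵃ = gᵃᵇ ∇_b Ω`, i.e. the vector with `g(N, ·) = dΩ`
(unique, and existing, where `g` is nondegenerate). -/
def normal (g : Tensor2 M) (Ω : M → ℝ) (p : M) : TangentSpace (𝓡∂ 4) p :=
  Classical.epsilon fun v : TangentSpace (𝓡∂ 4) p =>
    ∀ w : TangentSpace (𝓡∂ 4) p, g p v w = mfderiv (𝓡∂ 4) 𝓘(ℝ, ℝ) Ω p w

/-- `𝓘` is a null hypersurface: its normal is null. -/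
def IsNullHypersurface (g : Tensor2 M) (Ω : M → ℝ) : Prop :=
  ∀ p ∈ scri M, g p (normal g Ω p) (normal g Ω p) = 0

/-- `u, w` are (the components in the chart `e` of) two orthonormal spacelike vectors tangent to
the hypersurface `Ω = 0` at the point with coordinates `x`. -/
structure IsScreen (g : Tensor2 M) (Ω : M → ℝ)
    (e : OpenPartialHomeomorph M (EuclideanHalfSpace 4)) (x : E4) (u w : Fin 4 → ℝ) : Prop where
  tangent_left : ∑ a, u a * pd a (Ω ∘ chartPoint e) x = 0
  tangent_right : ∑ a, w a * pd a (Ω ∘ chartPoint e) x = 0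
  unit_left : ∑ a, ∑ b, comp g e x a b * u a * u b = -1
  unit_right : ∑ a, ∑ b, comp g e x a b * w a * w b = -1
  orthogonal : ∑ a, ∑ b, comp g e x a b * u a * w b = 0

/-- The complex shear `σ = mᵃ mᵇ ∇_a N_b` of the normal `N_b = ∇_b Ω`, where
`m = (u + i w)/√2`. -/
def shear (g : Tensor2 M) (Ω : M → ℝ) (e : OpenPartialHomeomorph M (EuclideanHalfSpace 4))
    (x : E4) (u w : Fin 4 → ℝ) : ℂ :=
  let m : Fin 4 → ℂ := fun a => ((u a : ℂ) + Complex.I * (w a : ℂ)) / (Real.sqrt 2 : ℂ)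
  ∑ a, ∑ b, m a * m b * (hessian g Ω e a b x : ℂ)

/-- `𝓘` is shear-free: its complex shear vanishes at all points, for all screens. -/
def IsShearFree (k : ℕ∞) (g : Tensor2 M) (Ω : M → ℝ) : Prop :=
  ∀ e ∈ Charts M k, ∀ x ∈ chartTarget e, chartPoint e x ∈ scri M →
    ∀ u w : Fin 4 → ℝ, IsScreen g Ω e x u w → shear g Ω e x u w = 0

/-- `p` and `q` lie on the same generator of `𝓘`: a segment of an integral curve of the normal,
lying in `𝓘`, joins them (in one direction or the other). -/
def SameGenerator (g : Tensor2 M) (Ω : M → ℝ) (p q : M) : Prop :=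
  ∃ (γ : ℝ → M) (a b : ℝ), a ≤ b ∧ MapsTo γ (Icc a b) (scri M) ∧
    IsMIntegralCurveOn (I := 𝓡∂ 4) γ (normal g Ω) (Icc a b) ∧
    ((γ a = p ∧ γ b = q) ∨ (γ a = q ∧ γ b = p))

/-- The embedded surface `ι : S → M` is a cross-section of the part `C` of `𝓘`: it lies in `C`,
is spacelike (equivalently, for a surface in a null hypersurface: immersed and transversal to the
generators), and meets each generator of `C` exactly once. -/
structure IsCrossSection {S : Type*} [TopologicalSpace S]
    [ChartedSpace (EuclideanSpace ℝ (Fin 2)) S]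
    (g : Tensor2 M) (Ω : M → ℝ) (C : Set M) (ι : S → M) : Prop where
  contMDiff : ContMDiff (𝓡 2) (𝓡∂ 4) 1 ι
  isEmbedding : IsEmbedding ι
  mem : ∀ s, ι s ∈ C
  spacelike : ∀ (s : S) (v : TangentSpace (𝓡 2) s), v ≠ 0 →
    g (ι s) (mfderiv (𝓡 2) (𝓡∂ 4) ι s v) (mfderiv (𝓡 2) (𝓡∂ 4) ι s v) < 0
  existsUnique : ∀ p ∈ C, ∃! s : S, SameGenerator g Ω p (ι s)

/-- The `C¹` diffeomorphism `h` between two surfaces in `M` is conformal: it multiplies the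
induced metrics by a positive function. -/
def IsConformalMap {S₁ S₂ : Type*}
    [TopologicalSpace S₁] [ChartedSpace (EuclideanSpace ℝ (Fin 2)) S₁]
    [TopologicalSpace S₂] [ChartedSpace (EuclideanSpace ℝ (Fin 2)) S₂]
    (g : Tensor2 M) (ι₁ : S₁ → M) (ι₂ : S₂ → M) (h : Diffeomorph (𝓡 2) (𝓡 2) S₁ S₂ 1) : Prop :=
  ∃ K : S₁ → ℝ, (∀ s, 0 < K s) ∧ ∀ (s : S₁) (v w : TangentSpace (𝓡 2) s),
    g (ι₂ (h s)) (mfderiv (𝓡 2) (𝓡∂ 4) ι₂ (h s) (mfderiv (𝓡 2) (𝓡 2) h s v))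
        (mfderiv (𝓡 2) (𝓡∂ 4) ι₂ (h s) (mfderiv (𝓡 2) (𝓡 2) h s w)) =
      K s * g (ι₁ s) (mfderiv (𝓡 2) (𝓡∂ 4) ι₁ s v) (mfderiv (𝓡 2) (𝓡∂ 4) ι₁ s w)

end Coordinates

end ConformalInfinity

end

/-! Under `g = Ω² g̃` in dimension four the Ricci tensors satisfy `Ω R̃_ab = Ω R_ab + 2 ∇_a∇_b Ω + μ
g_ab` for some function `μ` (`ricci_conformal`). Near null infinity the left side vanishes, so in
the interior `Ω R_ab + 2 ∇_a∇_b Ω` is a multiple of `g_ab`. Being proportional to `g_ab` is a closed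
condition, and since `k ≥ 2` all the tensors extend continuously to the boundary. There `Ω = 0`, so
`∇_a∇_b Ω = λ g_ab` on null infinity (`hessian_eq_trace_mul_comp`). A complex screen vector `m`
satisfies `g(m, m) = 0`, whence the shear vanishes: this is (a).

For (b), the Lie derivative of `g` along `N` is `2 ∇_a∇_b Ω = 2λ g_ab` on null infinity. As the
hypersurface is null, `N` is tangent to it and its flow preserves it. Along a flow line the products
`g(V, W)` of transported tangent vectors solve the linear equation `φ' = 2λφ`, hence are all
multiplied by the same factor `exp ∫ 2λ > 0` (`IsFlowAt.conformal`). Moreover `N` is orthogonal to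
every tangent vector of null infinity, so letting the flow time vary from point to point adds only
multiples of `N` to the transported vectors and leaves their products unchanged
(`metric_add_smul_normalField`). Any correspondence along generators that is differentiable is
therefore conformal.

The remaining work is regularity. A `C¹` field has a `C¹` local flow (`exists_flow`, by the implicit
function theorem in a space of curves). A piece of `S₁` is carried along a compact segment of a
generator through finitely many flow boxes (`exists_transport_right`, `exists_transport_left`). Near
`S₂`, flow time and the points of `S₂` are `C¹` coordinates of null infinity because `S₂` is
spacelike, hence transversal to `N` (`exists_flow_coordinates`), and so the carried piece projects
to `S₂` along the generators (`exists_hit`). Each generator meets `S₂` only once, so these local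
maps agree with the correspondence, which is thus `C¹`; exchanging `S₁` and `S₂` gives the inverse.
-/

noncomputable section

namespace ConformalInfinity

/-! ### Integral equation of a flow in the Banach space of curves -/

section Flow

variable {E : Type*} [NormedAddCommGroup E] [NormedSpace ℝ E]

/-- The Volterra operator `η ↦ ∫₀ʳ η` on continuous curves parametrised by `[0, 1]`. -/
def volterra : C(Icc (0 : ℝ) 1, E) →L[ℝ] C(Icc (0 : ℝ) 1, E) :=
  LinearMap.mkContinuous
    { toFun := fun η =>
        ⟨fun r => ∫ s in (0 : ℝ)..r, IccExtend zero_le_one η s,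
          (intervalIntegral.continuous_primitive
            (fun a b => (η.continuous.Icc_extend').intervalIntegrable a b) 0).comp
              continuous_subtype_val⟩
      map_add' := fun η ζ => by
        ext r
        exact intervalIntegral.integral_add
          ((η.continuous.Icc_extend').intervalIntegrable _ _)
          ((ζ.continuous.Icc_extend').intervalIntegrable _ _)
      map_smul' := fun c η => by
        ext r
        exact intervalIntegral.integral_smul c _ } 1
    (fun η => by
      rw [ContinuousMap.norm_le _ (by positivity)]
      intro r
      refine (intervalIntegral.norm_integral_le_of_norm_le_const (C := ‖η‖) ?_).trans ?_
      · intro s _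
        exact η.norm_coe_le_norm _
      · rw [sub_zero, abs_of_nonneg r.2.1, one_mul]
        exact mul_le_of_le_one_right (norm_nonneg _) r.2.2)

lemma volterra_apply (η : C(Icc (0 : ℝ) 1, E)) (r : Icc (0 : ℝ) 1) :
    volterra η r = ∫ s in (0 : ℝ)..r, IccExtend zero_le_one η s := rfl

lemma hasDerivWithinAt_volterra [CompleteSpace E] (η : C(Icc (0 : ℝ) 1, E)) {r : ℝ}
    (hr : r ∈ Icc (0 : ℝ) 1) :
    HasDerivWithinAt (IccExtend zero_le_one (volterra η)) (IccExtend zero_le_one η r)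
      (Icc 0 1) r := by
  have h := (intervalIntegral.integral_hasDerivAt_right
    ((η.continuous.Icc_extend' (h := zero_le_one)).intervalIntegrable 0 r)
    (η.continuous.Icc_extend'.stronglyMeasurableAtFilter _ _)
    (η.continuous.Icc_extend'.continuousAt)).hasDerivWithinAt (s := Icc 0 1)
  refine h.congr (fun y hy => ?_) ?_
  · rw [IccExtend_of_mem _ _ hy]; rfl
  · rw [IccExtend_of_mem _ _ hr]; rfl

lemma volterra_eq_sub [CompleteSpace E] (y : ℝ → E) (η : C(Icc (0 : ℝ) 1, E))
    (hy : ∀ r ∈ Icc (0 : ℝ) 1, HasDerivWithinAt y (IccExtend zero_le_one η r) (Icc 0 1) r)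
    (r : Icc (0 : ℝ) 1) : volterra η r = y r - y 0 := by
  rw [volterra_apply]
  refine intervalIntegral.integral_eq_sub_of_hasDeriv_right_of_le r.2.1 ?_ ?_
    ((η.continuous.Icc_extend').intervalIntegrable _ _)
  · exact fun s hs => ((hy s ⟨hs.1, hs.2.trans r.2.2⟩).continuousWithinAt).mono
      (Icc_subset_Icc_right r.2.2)
  · intro s hs
    have hs1 : s < 1 := hs.2.trans_le r.2.2
    exact ((hy s ⟨hs.1.le, hs1.le⟩).hasDerivAt (Icc_mem_nhds hs.1 hs1)).hasDerivWithinAt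

/-- Pointwise application of a curve of operators to a curve of vectors. -/
def pointwiseApply :
    C(Icc (0 : ℝ) 1, E →L[ℝ] E) →L[ℝ] C(Icc (0 : ℝ) 1, E) →L[ℝ] C(Icc (0 : ℝ) 1, E) :=
  LinearMap.mkContinuous₂
    (LinearMap.mk₂ ℝ
      (fun (A : C(Icc (0 : ℝ) 1, E →L[ℝ] E)) (η : C(Icc (0 : ℝ) 1, E)) =>
        (⟨fun r => A r (η r), A.continuous.clm_apply η.continuous⟩ :
          C(Icc (0 : ℝ) 1, E)))
      (fun _ _ _ => by ext; simp) (fun _ _ _ => by ext; simp)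
      (fun _ _ _ => by ext; simp) (fun _ _ _ => by ext; simp)) 1
    (fun A η => by
      rw [one_mul, ContinuousMap.norm_le _ (by positivity)]
      intro r
      exact (A r).le_of_opNorm_le_of_le (A.norm_coe_le_norm r) (η.norm_coe_le_norm r))

/-- The superposition operator `γ ↦ f ∘ γ`. -/
def superposition {F : Type*} [TopologicalSpace F] (f : C(E, F)) (γ : C(Icc (0 : ℝ) 1, E)) :
    C(Icc (0 : ℝ) 1, F) :=
  f.comp γ

/-- The mean value inequality is applied on each segment from `γ r` to `γ r + η r`. Continuity of `γ
↦ f' ∘ γ` in the sup norm makes the variation of `f'` small on all these segments at once, without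
any uniform continuity of `f'` on `E`. -/
lemma hasFDerivAt_superposition (f : C(E, E)) (f' : C(E, E →L[ℝ] E))
    (hf : ∀ x, HasFDerivAt f (f' x) x) (γ : C(Icc (0 : ℝ) 1, E)) :
    HasFDerivAt (superposition f) (pointwiseApply (superposition f' γ)) γ := by
  rw [hasFDerivAt_iff_isLittleO_nhds_zero, Asymptotics.isLittleO_iff]
  intro ε hε
  have hc : ContinuousAt (superposition f') γ :=
    (ContinuousMap.continuous_postcomp f').continuousAt
  obtain ⟨δ, hδ, H⟩ :=
    (Metric.continuousAt_iff (α := C(Icc (0 : ℝ) 1, E)) (β := C(Icc (0 : ℝ) 1, E →L[ℝ] E))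
      (f := superposition f')).1 hc ε hε
  filter_upwards [Metric.ball_mem_nhds (0 : C(Icc (0 : ℝ) 1, E)) hδ] with η hη
  rw [ContinuousMap.norm_le _ (by positivity)]
  intro r
  have hη' : ‖η‖ < δ := by simpa using hη
  have key : ∀ x ∈ segment ℝ (γ r) (γ r + η r), ‖f' x - f' (γ r)‖ ≤ ε := by
    intro x hx
    rw [segment_eq_image'] at hx
    obtain ⟨θ, hθ, rfl⟩ := hx
    have h1 : dist (γ + θ • η) γ < δ := by
      rw [dist_eq_norm, add_sub_cancel_left, norm_smul, Real.norm_of_nonneg hθ.1]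
      exact (mul_le_of_le_one_left (norm_nonneg _) hθ.2).trans_lt hη'
    have h2 := (ContinuousMap.dist_lt_iff hε).1 (H h1) r
    rw [dist_eq_norm] at h2
    simpa [superposition] using h2.le
  have := (convex_segment (𝕜 := ℝ) (γ r) (γ r + η r)).norm_image_sub_le_of_norm_hasFDerivWithin_le'
    (fun x _ => (hf x).hasFDerivWithinAt) key (left_mem_segment ℝ _ _) (right_mem_segment ℝ _ _)
  rw [add_sub_cancel_left] at this
  exact this.trans (by gcongr; exact η.norm_coe_le_norm r)

lemma contDiff_superposition (f : C(E, E)) (hf : ContDiff ℝ 1 f) :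
    ContDiff ℝ 1 (superposition f) := by
  have hf' : Continuous (fderiv ℝ f) := hf.continuous_fderiv one_ne_zero
  rw [contDiff_one_iff_hasFDerivAt]
  refine ⟨fun γ => pointwiseApply (superposition ⟨fderiv ℝ f, hf'⟩ γ), ?_, ?_⟩
  · exact pointwiseApply.continuous.comp (ContinuousMap.continuous_postcomp _)
  · intro γ
    exact hasFDerivAt_superposition f _
      (fun x => (hf.differentiable one_ne_zero x).hasFDerivAt) γ

/-- The constant curves. -/
def constCurve : E →L[ℝ] C(Icc (0 : ℝ) 1, E) :=
  LinearMap.mkContinuous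
    { toFun := fun x => ContinuousMap.const _ x
      map_add' := fun _ _ => rfl
      map_smul' := fun _ _ => rfl } 1
    (fun x => by
      rw [one_mul, ContinuousMap.norm_le _ (norm_nonneg _)]
      exact fun _ => le_rfl)

lemma constCurve_apply (x : E) (r : Icc (0 : ℝ) 1) : constCurve x r = x := rfl

variable [CompleteSpace E]

/-- The curves `γ` with `γ(r) = x + T ∫₀ʳ f(γ)` depend `C¹` on `(x, T)` near `T = 0`. -/
lemma exists_solution_curves (f : C(E, E)) (hf : ContDiff ℝ 1 f) (x₀ : E) :
    ∃ Γ : E × ℝ → C(Icc (0 : ℝ) 1, E), Γ (x₀, 0) = constCurve x₀ ∧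
      ContDiffAt ℝ 1 Γ (x₀, 0) ∧
      (∀ᶠ p in 𝓝 (x₀, (0 : ℝ)),
        Γ p = constCurve p.1 + p.2 • volterra (superposition f (Γ p))) ∧
      ∀ᶠ q in 𝓝 ((x₀, (0 : ℝ)), constCurve x₀),
        q.2 = constCurve q.1.1 + q.1.2 • volterra (superposition f q.2) → Γ q.1 = q.2 := by
  -- The time `T` is a parameter and the curves live on the fixed interval `[0, 1]`. At `T = 0` the
  -- integral drops out, so the partial derivative of `G` in the curve is the identity and the
  -- implicit function theorem applies.
  let G : (E × ℝ) × C(Icc (0 : ℝ) 1, E) → C(Icc (0 : ℝ) 1, E) := fun q =>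
    q.2 - (constCurve q.1.1 + q.1.2 • volterra (superposition f q.2))
  let u : (E × ℝ) × C(Icc (0 : ℝ) 1, E) := ((x₀, 0), constCurve x₀)
  have hN := contDiff_superposition f hf
  have hG : ContDiff ℝ 1 G := by
    have h1 : ContDiff ℝ 1 (fun q : (E × ℝ) × C(Icc (0 : ℝ) 1, E) =>
        volterra (superposition f q.2)) :=
      volterra.contDiff.comp (hN.comp contDiff_snd)
    have h2 : ContDiff ℝ 1 (fun q : (E × ℝ) × C(Icc (0 : ℝ) 1, E) => constCurve q.1.1) :=
      (ContinuousLinearMap.contDiff (constCurve (E := E))).comp (contDiff_fst.comp contDiff_fst)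
    exact contDiff_snd.sub (h2.add ((contDiff_snd.comp contDiff_fst).smul h1))
  have hGu : G u = 0 := by simp [G, u]
  have hinr : fderiv ℝ G u ∘L .inr ℝ (E × ℝ) C(Icc (0 : ℝ) 1, E) =
      ContinuousLinearMap.id ℝ _ := by
    have h1 : HasFDerivAt (fun γ : C(Icc (0 : ℝ) 1, E) => G ((x₀, 0), γ))
        (fderiv ℝ G u ∘L .inr ℝ (E × ℝ) C(Icc (0 : ℝ) 1, E)) (constCurve x₀) :=
      HasFDerivAt.comp (constCurve x₀)
        (hG.differentiable one_ne_zero u).hasFDerivAt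
        (hasFDerivAt_prodMk_right (x₀, (0 : ℝ)) (constCurve x₀))
    have h2 : HasFDerivAt (fun γ : C(Icc (0 : ℝ) 1, E) => G ((x₀, 0), γ))
        (ContinuousLinearMap.id ℝ _) (constCurve x₀) := by
      have : (fun γ : C(Icc (0 : ℝ) 1, E) => G ((x₀, 0), γ)) = fun γ => γ - constCurve x₀ := by
        funext γ; simp [G]
      rw [this]
      exact (hasFDerivAt_id _).sub_const _
    exact h1.unique h2
  have hinv : (fderiv ℝ G u ∘L .inr ℝ (E × ℝ) C(Icc (0 : ℝ) 1, E)).IsInvertible := by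
    rw [hinr]
    exact ⟨ContinuousLinearEquiv.refl ℝ _, rfl⟩
  have cdf : ContDiffAt ℝ 1 G u := hG.contDiffAt
  refine ⟨cdf.implicitFunction one_ne_zero hinv, cdf.implicitFunction_apply_self one_ne_zero hinv,
    cdf.contDiffAt_implicitFunction one_ne_zero hinv, ?_, ?_⟩
  · filter_upwards [cdf.eventually_apply_implicitFunction one_ne_zero hinv] with p hp
    rw [hGu] at hp
    exact sub_eq_zero.1 hp
  · filter_upwards [cdf.eventually_apply_eq_iff_implicitFunction one_ne_zero hinv] with q hq hq'
    rw [hGu] at hq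
    exact hq.1 (sub_eq_zero.2 hq')

end Flow

/-! ### Local `C¹` flows and the variational equation -/

section Flow

variable {E : Type*} [NormedAddCommGroup E] [NormedSpace ℝ E]

/-- `c (x, T)`, for `(x, T)` near `p`, is the curve `r ↦ Φ_{rT}(x)` on `[0, 1]`, in the set `V`,
where `Φ` is the flow of the vector field `f`; it is `C¹` in `(x, T)` and satisfies the
variational equation. -/
structure IsFlowAt (f : E → E) (V : Set E) (c : E × ℝ → ℝ → E) (p : E × ℝ) : Prop where
  mem : ∀ r ∈ Icc (0 : ℝ) 1, c p r ∈ V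
  zero : c p 0 = p.1
  hasDeriv : ∀ r ∈ Icc (0 : ℝ) 1, HasDerivWithinAt (c p) (p.2 • f (c p r)) (Icc 0 1) r
  contDiffAt : ∀ r, ContDiffAt ℝ 1 (fun q => c q r) p
  variation_zero : ∀ v, fderiv ℝ (fun q => c q 0) p v = v.1
  variation : ∀ v, ∀ r ∈ Icc (0 : ℝ) 1,
    HasDerivWithinAt (fun s => fderiv ℝ (fun q => c q s) p v)
      (v.2 • f (c p r) + p.2 • fderiv ℝ f (c p r) (fderiv ℝ (fun q => c q r) p v)) (Icc 0 1) r

lemma IsFlowAt.congr {f f' : E → E} {U V : Set E} {c : E × ℝ → ℝ → E} {p : E × ℝ}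
    (h : IsFlowAt f' U c p) (hU : IsOpen U) (hUV : U ⊆ V) (hff : EqOn f' f U) :
    IsFlowAt f V c p where
  mem r hr := hUV (h.mem r hr)
  zero := h.zero
  hasDeriv r hr := by rw [← hff (h.mem r hr)]; exact h.hasDeriv r hr
  contDiffAt := h.contDiffAt
  variation_zero := h.variation_zero
  variation v r hr := by
    have h1 : f' =ᶠ[𝓝 (c p r)] f := hff.eventuallyEq_of_mem (hU.mem_nhds (h.mem r hr))
    rw [← hff (h.mem r hr), ← h1.fderiv_eq]
    exact h.variation v r hr

/-- The derivative of the time-one map in the direction of time is the vector field. -/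
lemma IsFlowAt.fderiv_time {f : E → E} {V : Set E} {c : E × ℝ → ℝ → E} {p : E × ℝ}
    (h : IsFlowAt f V c p) (hV : IsOpen V) (hf : ContDiffOn ℝ 1 f V) :
    fderiv ℝ (fun q => c q 1) p (0, 1) = f (c p 1) := by
  set η : ℝ → E := fun s => fderiv ℝ (fun q => c q s) p (0, 1) with hη
  -- The expected derivative of `Φ_{sT}(x)` in `T` is `s f`. The difference `ζ` solves the
  -- homogeneous linear equation `ζ' = T Df ζ` with `ζ 0 = 0`, so it vanishes by Grönwall.
  set ζ : ℝ → E := fun s => η s - s • f (c p s) with hζ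
  have hfd : ∀ r ∈ Icc (0 : ℝ) 1, HasFDerivAt f (fderiv ℝ f (c p r)) (c p r) := fun r hr =>
    ((hf.contDiffAt (hV.mem_nhds (h.mem r hr))).differentiableAt one_ne_zero).hasFDerivAt
  have hder : ∀ r ∈ Icc (0 : ℝ) 1,
      HasDerivWithinAt ζ (p.2 • fderiv ℝ f (c p r) (ζ r)) (Icc 0 1) r := by
    intro r hr
    have h1 := h.variation (0, 1) r hr
    have h2 := (hfd r hr).comp_hasDerivWithinAt r (h.hasDeriv r hr)
    have h3 := h1.sub ((hasDerivWithinAt_id r (Icc 0 1)).smul h2)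
    refine h3.congr_deriv ?_
    simp only [hζ, hη, map_sub, map_smul, smul_sub, id, Function.comp, one_smul]
    rw [smul_comm r p.2]
    abel
  have hcont : ContinuousOn (fun r => p.2 • fderiv ℝ f (c p r)) (Icc 0 1) := by
    refine ContinuousOn.const_smul (M := ℝ) ?_ p.2
    have h1 : ContinuousOn (c p) (Icc 0 1) := fun r hr => (h.hasDeriv r hr).continuousWithinAt
    exact ContinuousOn.comp (hf.continuousOn_fderiv_of_isOpen hV le_rfl) h1 h.mem
  obtain ⟨C, hC⟩ := isCompact_Icc.exists_bound_of_continuousOn hcont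
  have hz : ζ 1 = 0 := by
    refine eq_zero_of_abs_deriv_le_mul_abs_self_of_eq_zero_right (a := 0) (b := 1) (K := C)
      (f' := fun r => p.2 • fderiv ℝ f (c p r) (ζ r))
      (fun r hr => (hder r hr).continuousWithinAt) ?_ ?_ ?_ 1 (right_mem_Icc.2 zero_le_one)
    · intro r hr
      exact (hder r (Ico_subset_Icc_self hr)).mono_of_mem_nhdsWithin
        (mem_of_superset (Ico_mem_nhdsGE_of_mem hr) Ico_subset_Icc_self)
    · simp [hζ, hη, h.variation_zero]
    · intro r hr
      exact (p.2 • fderiv ℝ f (c p r)).le_of_opNorm_le (hC r (Ico_subset_Icc_self hr)) _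
  simpa [hζ, hη, sub_eq_zero] using hz

variable [CompleteSpace E]

lemma exists_flow_of_contDiff {f : E → E} (hf : ContDiff ℝ 1 f) (x₀ : E) {U : Set E}
    (hU : U ∈ 𝓝 x₀) :
    ∃ c : E × ℝ → ℝ → E, (∀ᶠ p in 𝓝 (x₀, (0 : ℝ)), IsFlowAt f U c p) ∧
      ∃ δ > 0, ∀ (y : ℝ → E) (T : ℝ), |T| < δ →
        (∀ r ∈ Icc (0 : ℝ) 1, y r ∈ Metric.ball x₀ δ ∧
          HasDerivWithinAt y (T • f (y r)) (Icc 0 1) r) → c (y 0, T) 1 = y 1 := by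
  let F : C(E, E) := ⟨f, hf.continuous⟩
  obtain ⟨Γ, h0, hd, heq, huniq⟩ := exists_solution_curves F hf x₀
  refine ⟨fun p => IccExtend zero_le_one (Γ p), ?_, ?_⟩
  · obtain ⟨ε, hε, hεU⟩ := Metric.mem_nhds_iff.1 hU
    have hnear : ∀ᶠ p in 𝓝 (x₀, (0 : ℝ)), dist (Γ p) (constCurve x₀) < ε := by
      have := hd.continuousAt.tendsto.eventually (Metric.ball_mem_nhds _ hε)
      rw [h0] at this
      exact this
    filter_upwards [hnear, hd.eventually (by simp), heq.eventually_nhds, heq] with p hp1 hp2 hp3 hp4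
    have hproj : ∀ r ∈ Icc (0 : ℝ) 1, ∀ γ : C(Icc (0 : ℝ) 1, E),
        IccExtend zero_le_one γ r = γ (projIcc 0 1 zero_le_one r) := fun _ _ _ => rfl
    have hderΓ : HasFDerivAt Γ (fderiv ℝ Γ p) p :=
      (hp2.differentiableAt one_ne_zero).hasFDerivAt
    have hev : ∀ r, HasFDerivAt (fun q => IccExtend zero_le_one (Γ q) r)
        ((ContinuousMap.evalCLM ℝ (projIcc 0 1 zero_le_one r)).comp (fderiv ℝ Γ p)) p := fun r =>
      (ContinuousLinearMap.hasFDerivAt (ContinuousMap.evalCLM ℝ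
        (projIcc (0 : ℝ) 1 zero_le_one r) : C(Icc (0 : ℝ) 1, E) →L[ℝ] E)).comp p hderΓ
    let Df : C(E, E →L[ℝ] E) := ⟨fderiv ℝ f, hf.continuous_fderiv one_ne_zero⟩
    have hDf : ∀ x, HasFDerivAt F (Df x) x := fun x =>
      (hf.differentiable one_ne_zero x).hasFDerivAt
    -- The integrated variational equation: the identity `Γ p = x + T ∫ f(Γ p)` holds near `p`, so
    -- both sides may be differentiated in `p`.
    have hvar : ∀ v, fderiv ℝ Γ p v = constCurve v.1 + volterra (v.2 • superposition F (Γ p)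
        + p.2 • pointwiseApply (superposition Df (Γ p)) (fderiv ℝ Γ p v)) := by
      intro v
      have h1 : HasFDerivAt (fun q : E × ℝ =>
          constCurve q.1 + q.2 • volterra (superposition F (Γ q))) _ p :=
        ((constCurve (E := E)).hasFDerivAt.comp p hasFDerivAt_fst).add
          ((hasFDerivAt_snd (𝕜 := ℝ) (E := E) (F := ℝ)).smul (volterra.hasFDerivAt.comp p
            ((hasFDerivAt_superposition F Df hDf (Γ p)).comp p hderΓ)))
      have h2 := (hderΓ.congr_of_eventuallyEq (EventuallyEq.symm hp3)).unique h1
      conv_lhs => rw [h2]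
      simp only [map_add, map_smul]
      simp [add_comm]
    refine ⟨fun r hr => ?_, ?_, fun r hr => ?_, fun r => ?_, fun v => ?_, fun v r hr => ?_⟩
    · refine hεU ?_
      exact (ContinuousMap.dist_lt_iff hε).1 hp1 _
    · rw [hp4, IccExtend_of_mem _ _ (left_mem_Icc.2 zero_le_one)]
      simp [constCurve_apply, volterra_apply]
    · have h1 := ((hasDerivWithinAt_volterra (superposition F (Γ p)) hr).const_smul p.2).const_add
        p.1
      refine (h1.congr (fun y hy => ?_) ?_).congr_deriv rfl
      · conv_lhs => rw [hp4]
        rfl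
      · conv_lhs => rw [hp4]
        rfl
    · exact (ContinuousMap.evalCLM ℝ (projIcc (0 : ℝ) 1 zero_le_one r)).contDiff.contDiffAt.comp p
        hp2
    · rw [(hev 0).fderiv]
      change (fderiv ℝ Γ p v) _ = _
      rw [hvar]
      simp [constCurve_apply, volterra_apply]
    · have hfun : (fun s => fderiv ℝ (fun q => IccExtend zero_le_one (Γ q) s) p v) =
          IccExtend zero_le_one (fderiv ℝ Γ p v) := by
        funext s
        rw [(hev s).fderiv]
        rfl
      have h1 := (hasDerivWithinAt_volterra (v.2 • superposition F (Γ p)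
        + p.2 • pointwiseApply (superposition Df (Γ p)) (fderiv ℝ Γ p v)) hr).const_add v.1
      rw [hfun]
      refine (h1.congr (fun y hy => ?_) ?_).congr_deriv ?_
      · conv_lhs => rw [hvar]
        rfl
      · conv_lhs => rw [hvar]
        rfl
      · rw [(hev r).fderiv]
        rfl
  · obtain ⟨ε, hε, H⟩ := Metric.eventually_nhds_iff_ball.1 huniq
    refine ⟨ε / 2, by positivity, fun y T hT hy => ?_⟩
    let γ : C(Icc (0 : ℝ) 1, E) := ⟨fun r => y r, continuousOn_iff_continuous_domRestrict.1
      (fun r hr => (hy r hr).2.continuousWithinAt)⟩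
    have hγ : ∀ r ∈ Icc (0 : ℝ) 1, IccExtend zero_le_one γ r = y r := fun r hr => by
      rw [IccExtend_of_mem _ _ hr]; rfl
    have hmem : ((y 0, T), γ) ∈ Metric.ball ((x₀, (0 : ℝ)), constCurve x₀) ε := by
      rw [Metric.mem_ball, Prod.dist_eq, Prod.dist_eq, max_lt_iff, max_lt_iff]
      refine ⟨⟨?_, ?_⟩, ?_⟩
      · exact (Metric.mem_ball.1 (hy 0 (left_mem_Icc.2 zero_le_one)).1).trans (half_lt_self hε)
      · simpa using hT.trans (half_lt_self hε)
      · rw [ContinuousMap.dist_lt_iff hε]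
        intro r
        exact (Metric.mem_ball.1 (hy r r.2).1).trans (half_lt_self hε)
    have h1 : Γ (y 0, T) = γ := by
      refine H _ hmem ?_
      ext r
      change y r = y 0 + T • volterra (superposition F γ) r
      have h2 := volterra_eq_sub y (T • superposition F γ) (fun r hr => by
        refine (hy r hr).2.congr_deriv ?_
        rw [← hγ r hr]
        rfl) r
      rw [map_smul, ContinuousMap.smul_apply] at h2
      rw [h2]
      abel
    change IccExtend zero_le_one (Γ (y 0, T)) 1 = y 1
    rw [h1]
    exact hγ 1 (right_mem_Icc.2 zero_le_one)

/-- A `C¹` vector field on an open set has a local `C¹` flow. -/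
theorem exists_flow [FiniteDimensional ℝ E] {V : Set E} (hV : IsOpen V) {f : E → E}
    (hf : ContDiffOn ℝ 1 f V) {x₀ : E} (hx₀ : x₀ ∈ V) :
    ∃ c : E × ℝ → ℝ → E, (∀ᶠ p in 𝓝 (x₀, (0 : ℝ)), IsFlowAt f V c p) ∧
      ∃ δ > 0, ∀ (y : ℝ → E) (T : ℝ), |T| < δ →
        (∀ r ∈ Icc (0 : ℝ) 1, y r ∈ Metric.ball x₀ δ ∧
          HasDerivWithinAt y (T • f (y r)) (Icc 0 1) r) → c (y 0, T) 1 = y 1 := by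
  obtain ⟨ε, hε, hεV⟩ := Metric.isOpen_iff.1 hV x₀ hx₀
  -- The cut-off `χ f` is `C¹` on all of `E`, since the support of `χ` is a closed ball inside `V`;
  -- it equals `f` on the inner ball. Both the flow and the competing curves are kept in that inner
  -- ball, so they belong to `f` itself.
  let χ : ContDiffBump x₀ := ⟨ε / 3, ε / 2, by positivity, by linarith⟩
  have hχV : Metric.closedBall x₀ χ.rOut ⊆ V :=
    (Metric.closedBall_subset_ball (half_lt_self hε)).trans hεV
  have hball : Metric.ball x₀ χ.rIn ⊆ V :=
    (Metric.ball_subset_closedBall.trans (Metric.closedBall_subset_closedBall χ.rIn_lt_rOut.le)).trans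
      hχV
  have heq : EqOn (fun x => χ x • f x) f (Metric.ball x₀ χ.rIn) := fun x hx => by
    simp [χ.one_of_mem_closedBall (Metric.ball_subset_closedBall hx)]
  have hcd : ContDiff ℝ 1 (fun x => χ x • f x) := by
    refine contDiff_of_contDiffOn_union_of_isOpen (s := V) (t := (Metric.closedBall x₀ χ.rOut)ᶜ)
      (χ.contDiff.contDiffOn.smul hf) ?_ ?_ hV Metric.isClosed_closedBall.isOpen_compl
    · refine contDiffOn_const (c := (0 : E)) |>.congr fun x hx => ?_
      have : χ x = 0 := by
        by_contra h
        have h1 : x ∈ tsupport χ := subset_tsupport _ h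
        rw [χ.tsupport_eq] at h1
        exact hx h1
      simp [this]
    · rw [eq_univ_iff_forall]
      intro x
      by_cases hx : x ∈ Metric.closedBall x₀ χ.rOut
      · exact Or.inl (hχV hx)
      · exact Or.inr hx
  obtain ⟨c, hc, δ, hδ, H⟩ := exists_flow_of_contDiff hcd x₀ (Metric.ball_mem_nhds x₀ χ.rIn_pos)
  refine ⟨c, ?_, min δ χ.rIn, lt_min hδ χ.rIn_pos, fun y T hT hy => ?_⟩
  · filter_upwards [hc] with p hp
    exact hp.congr Metric.isOpen_ball hball heq
  · refine H y T (hT.trans_le (min_le_left _ _)) fun r hr => ⟨?_, ?_⟩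
    · exact Metric.ball_subset_ball (min_le_left _ _) (hy r hr).1
    · refine (hy r hr).2.congr_deriv ?_
      exact congrArg (T • ·)
        (heq (Metric.ball_subset_ball (min_le_right _ _) (hy r hr).1)).symm

end Flow

/-- The closed coordinate half-space `x₀ ≥ 0` in `ℝ⁴`. -/
abbrev halfSpace : Set E4 := range (𝓡∂ 4)

lemma mem_halfSpace {x : E4} : x ∈ halfSpace ↔ 0 ≤ x 0 := by
  rw [halfSpace, range_modelWithCornersEuclideanHalfSpace]; rfl

lemma uniqueDiffOn_halfSpace : UniqueDiffOn ℝ halfSpace := (𝓡∂ 4).uniqueDiffOn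

/-! ### Partial derivatives on the half-space, one-sided at the boundary -/

section PartialDerivatives

variable {f f' : E4 → ℝ} {x : E4}

lemma pd_congr (a : Fin 4) (h : f =ᶠ[𝓝[halfSpace] x] f') (hx : x ∈ halfSpace) :
    pd a f x = pd a f' x := by
  rw [pd, pd, h.fderivWithin_eq (h.self_of_nhdsWithin hx)]

lemma pd_add (a : Fin 4) (hx : x ∈ halfSpace) (hf : DifferentiableWithinAt ℝ f halfSpace x)
    (hf' : DifferentiableWithinAt ℝ f' halfSpace x) :
    pd a (fun y => f y + f' y) x = pd a f x + pd a f' x := by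
  simp only [pd]
  rw [fderivWithin_fun_add (uniqueDiffOn_halfSpace x hx) hf hf']; rfl

lemma pd_mul (a : Fin 4) (hx : x ∈ halfSpace) (hf : DifferentiableWithinAt ℝ f halfSpace x)
    (hf' : DifferentiableWithinAt ℝ f' halfSpace x) :
    pd a (fun y => f y * f' y) x = pd a f x * f' x + f x * pd a f' x := by
  simp only [pd]
  rw [fderivWithin_fun_mul (uniqueDiffOn_halfSpace x hx) hf hf']
  simp only [add_apply, smul_apply, smul_eq_mul]
  ring

lemma pd_sum {ι : Type*} (s : Finset ι) (a : Fin 4) {F : ι → E4 → ℝ} (hx : x ∈ halfSpace)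
    (hF : ∀ i ∈ s, DifferentiableWithinAt ℝ (F i) halfSpace x) :
    pd a (fun y => ∑ i ∈ s, F i y) x = ∑ i ∈ s, pd a (F i) x := by
  simp only [pd]
  rw [fderivWithin_fun_sum (uniqueDiffOn_halfSpace x hx) hF, sum_apply]

lemma pd_const_mul (a : Fin 4) (c : ℝ) (hx : x ∈ halfSpace)
    (hf : DifferentiableWithinAt ℝ f halfSpace x) :
    pd a (fun y => c * f y) x = c * pd a f x := by
  simp only [pd]
  rw [fderivWithin_const_mul (uniqueDiffOn_halfSpace x hx) hf]
  rfl

lemma contDiffWithinAt_pd (a : Fin 4) {m n : ℕ∞ω} (hmn : m + 1 ≤ n) (hx : x ∈ halfSpace)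
    (hf : ContDiffWithinAt ℝ n f halfSpace x) : ContDiffWithinAt ℝ m (pd a f) halfSpace x :=
  hf.fderivWithin_right_apply contDiffWithinAt_const uniqueDiffOn_halfSpace hmn hx

/-- Symmetry of second derivatives persists at boundary points because the half-space lies in the
closure of its interior. -/
lemma pd_comm (a b : Fin 4) (hx : x ∈ halfSpace) (hf : ContDiffWithinAt ℝ 2 f halfSpace x) :
    pd a (pd b f) x = pd b (pd a f) x := by
  have hd : DifferentiableWithinAt ℝ (fderivWithin ℝ f halfSpace) halfSpace x :=
    (hf.fderivWithin_right (m := 1) uniqueDiffOn_halfSpace (by norm_num) hx).differentiableWithinAt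
      one_ne_zero
  have key : ∀ a b : Fin 4, pd a (pd b f) x =
      fderivWithin ℝ (fderivWithin ℝ f halfSpace) halfSpace x (EuclideanSpace.single a 1)
        (EuclideanSpace.single b 1) := by
    intro a b
    have h := hd.hasFDerivWithinAt.clm_apply
      (hasFDerivWithinAt_const (EuclideanSpace.single b (1 : ℝ) : E4) x halfSpace)
    change fderivWithin ℝ (fun y => fderivWithin ℝ f halfSpace y (EuclideanSpace.single b 1))
      halfSpace x (EuclideanSpace.single a 1) = _
    rw [h.fderivWithin (uniqueDiffOn_halfSpace x hx)]
    simp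
  rw [key, key]
  exact (hf.isSymmSndFDerivWithinAt (by simp) uniqueDiffOn_halfSpace
    ((𝓡∂ 4).range_subset_closure_interior hx) hx) _ _

lemma fderivWithin_eq_sum_pd (v : E4) :
    fderivWithin ℝ f halfSpace x v = ∑ a, v a * pd a f x := by
  have hv : v = ∑ a, v a • EuclideanSpace.single a (1 : ℝ) := by
    ext i
    simp [Finset.sum_apply, Pi.single_apply]
  conv_lhs => rw [hv]
  rw [map_sum]
  simp only [map_smul, smul_eq_mul]
  rfl

end PartialDerivatives

/-! ### Coordinates and coordinate components of tangent vectors -/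

section Charts

variable {M : Type*} [TopologicalSpace M]
  {e : OpenPartialHomeomorph M (EuclideanHalfSpace 4)} {x : E4}

lemma chartTarget_subset_halfSpace : chartTarget e ⊆ halfSpace := e.extend_target_subset_range

lemma chartPoint_mem_source (hx : x ∈ chartTarget e) : chartPoint e x ∈ e.source := by
  rw [← e.extend_source (I := 𝓡∂ 4)]
  exact (e.extend (𝓡∂ 4)).map_target hx

lemma extend_chartPoint (hx : x ∈ chartTarget e) : e.extend (𝓡∂ 4) (chartPoint e x) = x :=
  (e.extend (𝓡∂ 4)).right_inv hx

lemma chartPoint_extend {p : M} (hp : p ∈ e.source) :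
    chartPoint e (e.extend (𝓡∂ 4) p) = p :=
  e.extend_left_inv hp

lemma extend_mem_chartTarget {p : M} (hp : p ∈ e.source) :
    e.extend (𝓡∂ 4) p ∈ chartTarget e :=
  (e.extend (𝓡∂ 4)).map_source (by rwa [e.extend_source])

lemma chartTarget_mem_nhdsWithin (hx : x ∈ chartTarget e) : chartTarget e ∈ 𝓝[halfSpace] x := by
  have := e.extend_target_mem_nhdsWithin (I := 𝓡∂ 4) (chartPoint_mem_source hx)
  rwa [extend_chartPoint hx] at this

lemma continuousWithinAt_chartPoint (hx : x ∈ chartTarget e) :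
    ContinuousWithinAt (chartPoint e) halfSpace x := by
  have := (e.continuousOn_extend_symm (I := 𝓡∂ 4)) x hx
  exact this.mono_of_mem_nhdsWithin (chartTarget_mem_nhdsWithin hx)

lemma eventually_mem {U : Set M} (hU : IsOpen U) (hx : x ∈ chartTarget e) (hp : chartPoint e x ∈ U) :
    ∀ᶠ y in 𝓝[halfSpace] x, y ∈ chartTarget e ∧ chartPoint e y ∈ U :=
  (eventually_mem_set.2 (chartTarget_mem_nhdsWithin hx)).and
    ((continuousWithinAt_chartPoint hx).eventually (hU.mem_nhds hp))

variable [ChartedSpace (EuclideanHalfSpace 4) M] {k : ℕ∞}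

lemma contMDiffWithinAt_chartPoint (he : e ∈ Charts M k) (hx : x ∈ chartTarget e) :
    ContMDiffWithinAt 𝓘(ℝ, E4) (𝓡∂ 4) ((k : ℕ∞ω) + 1) (chartPoint e) halfSpace x := by
  have h := contMDiffOn_extend_symm he
  rw [← e.extend_target'] at h
  exact (h x hx).mono_of_mem_nhdsWithin (chartTarget_mem_nhdsWithin hx)

lemma mdifferentiableWithinAt_chartPoint (he : e ∈ Charts M k) (hx : x ∈ chartTarget e) :
    MDifferentiableWithinAt 𝓘(ℝ, E4) (𝓡∂ 4) (chartPoint e) halfSpace x :=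
  (contMDiffWithinAt_chartPoint he hx).mdifferentiableWithinAt (by simp)

lemma mdifferentiableAt_extend (he : e ∈ Charts M k) {p : M} (hp : p ∈ e.source) :
    MDifferentiableAt (𝓡∂ 4) 𝓘(ℝ, E4) (e.extend (𝓡∂ 4)) p :=
  (e.contMDiffAt_extend he hp).mdifferentiableAt (by simp)

/-- The linear map sending the components of a vector in the chart `e` to the vector. -/
def coordMap (e : OpenPartialHomeomorph M (EuclideanHalfSpace 4)) (x : E4) :
    E4 →L[ℝ] TangentSpace (𝓡∂ 4) (chartPoint e x) :=
  mfderivWithin 𝓘(ℝ, E4) (𝓡∂ 4) (chartPoint e) halfSpace x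

lemma coordMap_apply (v : E4) : coordMap e x v = ∑ a, v a • coordVec e x a := by
  have hv : v = ∑ a, v a • EuclideanSpace.single a (1 : ℝ) := by
    ext i
    simp [Finset.sum_apply, Pi.single_apply]
  conv_lhs => rw [hv]
  rw [map_sum]
  simp only [map_smul]
  rfl

lemma mfderiv_extend_coordMap (he : e ∈ Charts M k) (hx : x ∈ chartTarget e) (v : E4) :
    mfderiv (𝓡∂ 4) 𝓘(ℝ, E4) (e.extend (𝓡∂ 4)) (chartPoint e x) (coordMap e x v) = v := by
  have h1 := (mdifferentiableAt_extend he (chartPoint_mem_source hx)).hasMFDerivAt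
  have h2 := (mdifferentiableWithinAt_chartPoint he hx).hasMFDerivWithinAt
  have h3 := h1.comp_hasMFDerivWithinAt x h2
  have h4 : HasMFDerivWithinAt 𝓘(ℝ, E4) 𝓘(ℝ, E4) (e.extend (𝓡∂ 4) ∘ chartPoint e) halfSpace x
      (ContinuousLinearMap.id ℝ E4) := by
    refine (hasMFDerivWithinAt_id (I := 𝓘(ℝ, E4)) halfSpace x).congr_of_eventuallyEq ?_ (extend_chartPoint hx)
    filter_upwards [chartTarget_mem_nhdsWithin hx] with y hy
    exact extend_chartPoint hy
  have h5 := (uniqueDiffOn_halfSpace x (chartTarget_subset_halfSpace hx)).uniqueMDiffWithinAt.eq h3 h4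
  exact congrArg (fun L : E4 →L[ℝ] E4 => L v) h5

lemma coordMap_injective (he : e ∈ Charts M k) (hx : x ∈ chartTarget e) :
    Function.Injective (coordMap e x) :=
  Function.LeftInverse.injective (mfderiv_extend_coordMap he hx)

lemma coordMap_surjective (he : e ∈ Charts M k) (hx : x ∈ chartTarget e) :
    Function.Surjective (coordMap e x) := by
  let L : E4 →L[ℝ] E4 := coordMap e x
  have h : Function.Injective (L : E4 →ₗ[ℝ] E4) := coordMap_injective he hx
  exact LinearMap.surjective_of_injective h

lemma coordMap_mfderiv_extend (he : e ∈ Charts M k) (hx : x ∈ chartTarget e)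
    (v : TangentSpace (𝓡∂ 4) (chartPoint e x)) :
    coordMap e x (mfderiv (𝓡∂ 4) 𝓘(ℝ, E4) (e.extend (𝓡∂ 4)) (chartPoint e x) v) = v := by
  obtain ⟨w, rfl⟩ := coordMap_surjective he hx v
  rw [mfderiv_extend_coordMap he hx]

lemma apply_coordMap (g : Tensor2 M) (v w : E4) :
    g (chartPoint e x) (coordMap e x v) (coordMap e x w) =
      ∑ a, ∑ b, comp g e x a b * v a * w b := by
  simp only [coordMap_apply, map_sum, map_smul, sum_apply,
    smul_apply, smul_eq_mul, comp, Matrix.of_apply, Finset.mul_sum]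
  rw [Finset.sum_comm]
  refine Finset.sum_congr rfl fun a _ => Finset.sum_congr rfl fun b _ => by ring

end Charts

/-! ### Components of the metric -/

section Metric

variable {M : Type*} [TopologicalSpace M] [ChartedSpace (EuclideanHalfSpace 4) M]
  {k : ℕ∞} {e : OpenPartialHomeomorph M (EuclideanHalfSpace 4)} {x : E4}
  {g : Tensor2 M} {U : Set M}

lemma IsLorentzMetricOn.symm (hg : IsLorentzMetricOn k g U) {p : M} (hp : p ∈ U)
    (v w : TangentSpace (𝓡∂ 4) p) : g p v w = g p w v := by
  obtain ⟨b, hb⟩ := hg.signature p hp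
  rw [← b.sum_repr v, ← b.sum_repr w]
  simp only [map_sum, map_smul, sum_apply, smul_apply, smul_eq_mul, hb]
  simp only [mul_ite, mul_zero, Finset.sum_ite_eq', Finset.mem_univ, if_true]
  refine Finset.sum_congr rfl fun i _ => ?_
  split_ifs <;> ring

lemma IsLorentzMetricOn.nondegenerate (hg : IsLorentzMetricOn k g U) {p : M} (hp : p ∈ U)
    (v : TangentSpace (𝓡∂ 4) p) (hv : ∀ w, g p w v = 0) : v = 0 := by
  obtain ⟨b, hb⟩ := hg.signature p hp
  refine b.ext_elem fun i => ?_
  have h := hv (b i)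
  rw [← b.sum_repr v] at h
  simp only [map_sum, map_smul, smul_eq_mul, hb, mul_ite, mul_zero, Finset.sum_ite_eq,
    Finset.mem_univ, if_true] at h
  rw [map_zero]
  split_ifs at h with h0 <;> simpa using h

lemma comp_symm (hg : IsLorentzMetricOn k g U) (hp : chartPoint e x ∈ U) (a b : Fin 4) :
    comp g e x a b = comp g e x b a :=
  hg.symm hp _ _

lemma det_comp_ne_zero (hg : IsLorentzMetricOn k g U) (he : e ∈ Charts M k)
    (hx : x ∈ chartTarget e) (hp : chartPoint e x ∈ U) : (comp g e x).det ≠ 0 := by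
  intro h
  obtain ⟨v, hv, h0⟩ := Matrix.exists_mulVec_eq_zero_iff.2 h
  refine hv ?_
  have h1 : coordMap e x (WithLp.toLp 2 v) = 0 := by
    refine hg.nondegenerate hp _ fun w => ?_
    obtain ⟨w, rfl⟩ := coordMap_surjective he hx w
    rw [apply_coordMap]
    refine Finset.sum_eq_zero fun a _ => ?_
    have h2 := congrFun h0 a
    simp only [Matrix.mulVec, dotProduct, Pi.zero_apply] at h2
    calc ∑ b, comp g e x a b * w a * v b = w a * ∑ b, comp g e x a b * v b := by
          rw [Finset.mul_sum]; exact Finset.sum_congr rfl fun b _ => by ring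
      _ = 0 := by rw [h2, mul_zero]
  have h2 := coordMap_injective he hx (h1.trans (map_zero _).symm)
  funext a
  exact congrFun (congrArg WithLp.ofLp h2) a

lemma sum_inv_mul_comp (hdet : (comp g e x).det ≠ 0) (c b : Fin 4) :
    ∑ d, (comp g e x)⁻¹ c d * comp g e x d b = if c = b then 1 else 0 := by
  rw [← Matrix.mul_apply, Matrix.nonsing_inv_mul _ hdet.isUnit, Matrix.one_apply]

lemma sum_comp_mul_inv (hdet : (comp g e x).det ≠ 0) (c b : Fin 4) :
    ∑ d, comp g e x c d * (comp g e x)⁻¹ d b = if c = b then 1 else 0 := by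
  rw [← Matrix.mul_apply, Matrix.mul_nonsing_inv _ hdet.isUnit, Matrix.one_apply]

lemma contDiffWithinAt_comp (hg : IsLorentzMetricOn k g U) (he : e ∈ Charts M k) (hU : IsOpen U)
    (hx : x ∈ chartTarget e) (hp : chartPoint e x ∈ U) (a b : Fin 4) :
    ContDiffWithinAt ℝ k (fun y => comp g e y a b) halfSpace x :=
  (hg.contDiff e he a b x ⟨hx, hp⟩).mono_of_mem_nhdsWithin (eventually_mem hU hx hp)

end Metric

section MatrixCalculus

variable {E : Type*} [NormedAddCommGroup E] [NormedSpace ℝ E] {n : ℕ∞ω} {s : Set E} {x : E}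

lemma contDiffWithinAt_det {ι : Type*} [Fintype ι] [DecidableEq ι] {A : E → Matrix ι ι ℝ}
    (hA : ∀ a b, ContDiffWithinAt ℝ n (fun y => A y a b) s x) :
    ContDiffWithinAt ℝ n (fun y => (A y).det) s x := by
  simp only [Matrix.det_apply']
  exact ContDiffWithinAt.sum fun σ _ => contDiffWithinAt_const.mul
    (contDiffWithinAt_prod fun i _ => hA _ _)

/-- By Cramer's rule the entries of the inverse are quotients of determinants, hence rational
functions of the entries of `A`. -/
lemma contDiffWithinAt_matrix_inv {ι : Type*} [Fintype ι] [DecidableEq ι] {A : E → Matrix ι ι ℝ}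
    (hA : ∀ a b, ContDiffWithinAt ℝ n (fun y => A y a b) s x) (hdet : (A x).det ≠ 0) (a b : ι) :
    ContDiffWithinAt ℝ n (fun y => (A y)⁻¹ a b) s x := by
  simp only [Matrix.inv_def, Ring.inverse_eq_inv', Matrix.smul_apply, Matrix.adjugate_apply,
    smul_eq_mul]
  refine ((contDiffWithinAt_det hA).inv hdet).mul (contDiffWithinAt_det fun i j => ?_)
  by_cases h : i = b
  · subst h
    simp only [Matrix.updateRow_self]
    exact contDiffWithinAt_const
  · simp only [Matrix.updateRow_ne h]
    exact hA i j

end MatrixCalculus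

/-! ### Regularity up to the boundary, and metric compatibility -/

section Christoffel

variable {M : Type*} [TopologicalSpace M] [ChartedSpace (EuclideanHalfSpace 4) M]
  {k : ℕ∞} {e : OpenPartialHomeomorph M (EuclideanHalfSpace 4)} {x : E4}
  {g : Tensor2 M} {Ω : M → ℝ}

lemma two_le_cast (hk : 2 ≤ k) : (1 : ℕ∞ω) + 1 ≤ (k : ℕ∞ω) := by
  rw [one_add_one_eq_two]
  exact WithTop.coe_le_coe.2 hk

lemma contDiffWithinAt_comp_inv (hg : IsLorentzMetricOn k g univ) (he : e ∈ Charts M k)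
    (hx : x ∈ chartTarget e) (a b : Fin 4) :
    ContDiffWithinAt ℝ k (fun y => (comp g e y)⁻¹ a b) halfSpace x :=
  contDiffWithinAt_matrix_inv (fun _ _ => contDiffWithinAt_comp hg he isOpen_univ hx trivial _ _)
    (det_comp_ne_zero hg he hx trivial) a b

lemma contDiffWithinAt_christoffel (hk : 2 ≤ k) (hg : IsLorentzMetricOn k g univ)
    (he : e ∈ Charts M k) (hx : x ∈ chartTarget e) (c a b : Fin 4) :
    ContDiffWithinAt ℝ 1 (christoffel g e c a b) halfSpace x := by
  have h : ∀ a b c, ContDiffWithinAt ℝ 1 (pd c fun y => comp g e y a b) halfSpace x :=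
    fun a b c => contDiffWithinAt_pd c (two_le_cast hk) (chartTarget_subset_halfSpace hx)
      (contDiffWithinAt_comp hg he isOpen_univ hx trivial a b)
  exact contDiffWithinAt_const.mul (ContDiffWithinAt.sum fun d _ =>
    ((contDiffWithinAt_comp_inv hg he hx c d).of_le (le_add_self.trans (two_le_cast hk))).mul
      (((h _ _ _).add (h _ _ _)).sub (h _ _ _)))

/-- The Ricci tensor involves two derivatives of the metric, so `k ≥ 2` is what lets the vacuum
equation be taken to the limit at null infinity. -/
lemma continuousWithinAt_ricci (hk : 2 ≤ k) (hg : IsLorentzMetricOn k g univ)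
    (he : e ∈ Charts M k) (hx : x ∈ chartTarget e) (a b : Fin 4) :
    ContinuousWithinAt (ricci g e a b) halfSpace x := by
  have h : ∀ c a b d, ContinuousWithinAt (pd d (christoffel g e c a b)) halfSpace x :=
    fun c a b d => (contDiffWithinAt_pd (m := 0) d (by simp) (chartTarget_subset_halfSpace hx)
      (contDiffWithinAt_christoffel hk hg he hx c a b)).continuousWithinAt
  have h' : ∀ c a b, ContinuousWithinAt (christoffel g e c a b) halfSpace x :=
    fun c a b => (contDiffWithinAt_christoffel hk hg he hx c a b).continuousWithinAt
  exact tendsto_finsetSum _ fun c _ => ((h _ _ _ _).sub (h _ _ _ _)).add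
    (tendsto_finsetSum _ fun d _ => ((h' _ _ _).mul (h' _ _ _)).sub ((h' _ _ _).mul (h' _ _ _)))

lemma contDiffWithinAt_factor (hΩ : ContMDiff (𝓡∂ 4) 𝓘(ℝ, ℝ) k Ω) (he : e ∈ Charts M k)
    (hx : x ∈ chartTarget e) : ContDiffWithinAt ℝ k (Ω ∘ chartPoint e) halfSpace x := by
  rw [← contMDiffWithinAt_iff_contDiffWithinAt]
  exact (hΩ _).comp_contMDiffWithinAt x ((contMDiffWithinAt_chartPoint he hx).of_le le_self_add)

lemma continuousWithinAt_hessian (hk : 2 ≤ k) (hg : IsLorentzMetricOn k g univ)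
    (hΩ : ContMDiff (𝓡∂ 4) 𝓘(ℝ, ℝ) k Ω) (he : e ∈ Charts M k) (hx : x ∈ chartTarget e)
    (a b : Fin 4) : ContinuousWithinAt (hessian g Ω e a b) halfSpace x := by
  have hx' := chartTarget_subset_halfSpace hx
  have h : ∀ c, ContDiffWithinAt ℝ 1 (pd c (Ω ∘ chartPoint e)) halfSpace x := fun c =>
    contDiffWithinAt_pd c (two_le_cast hk) hx' (contDiffWithinAt_factor hΩ he hx)
  exact (contDiffWithinAt_pd (m := 0) a (by simp) hx' (h b)).continuousWithinAt.sub
    (tendsto_finsetSum _ fun c _ =>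
      (contDiffWithinAt_christoffel hk hg he hx c a b).continuousWithinAt.mul
        (h c).continuousWithinAt)

/-- Metric compatibility of the Levi-Civita connection. -/
lemma pd_comp_eq (hg : IsLorentzMetricOn k g univ) (he : e ∈ Charts M k)
    (hx : x ∈ chartTarget e) (a b c : Fin 4) :
    pd c (fun y => comp g e y a b) x =
      ∑ d, (comp g e x d b * christoffel g e d c a x + comp g e x d a * christoffel g e d c b x) := by
  have hdet := det_comp_ne_zero hg he hx trivial
  have hs := chartTarget_mem_nhdsWithin hx
  have hsymm : ∀ a b c, pd c (fun y => comp g e y a b) x = pd c (fun y => comp g e y b a) x := by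
    intro a b c
    congr 1
    funext y
    exact comp_symm hg trivial a b
  have key : ∀ b c a, ∑ d, comp g e x d b * christoffel g e d c a x = (1 / 2 : ℝ) *
      (pd c (fun y => comp g e y b a) x + pd a (fun y => comp g e y b c) x
        - pd b (fun y => comp g e y c a) x) := by
    intro b c a
    simp only [christoffel, Finset.mul_sum]
    rw [Finset.sum_comm]
    have : ∀ i, ∑ d, comp g e x d b * (1 / 2 * ((comp g e x)⁻¹ d i *
        (pd c (fun y => comp g e y i a) x + pd a (fun y => comp g e y i c) x
        - pd i (fun y => comp g e y c a) x))) = (if b = i then 1 else 0) * (1 / 2 *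
        (pd c (fun y => comp g e y i a) x + pd a (fun y => comp g e y i c) x
        - pd i (fun y => comp g e y c a) x)) := by
      intro i
      rw [← sum_comp_mul_inv hdet b i, Finset.sum_mul]
      refine Finset.sum_congr rfl fun d _ => ?_
      rw [comp_symm hg trivial d b]
      ring
    rw [Finset.sum_congr rfl fun i _ => this i]
    simp
  rw [Finset.sum_add_distrib, key, key, hsymm b a c, hsymm b c a, hsymm a c b]
  ring

lemma christoffel_symm (hg : IsLorentzMetricOn k g univ) (c a b : Fin 4) :
    christoffel g e c a b x = christoffel g e c b a x := by
  have hsymm : ∀ a b, (fun y => comp g e y a b) = (fun y => comp g e y b a) := fun a b =>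
    funext fun y => comp_symm hg trivial a b
  simp only [christoffel]
  congr 1
  refine Finset.sum_congr rfl fun d _ => ?_
  rw [hsymm a b]
  ring

end Christoffel

/-! ### Algebra of the difference of two conformally related connections -/

section Algebra

variable (Γ : Fin 4 → Fin 4 → Fin 4 → ℝ) (G : Fin 4 → Fin 4 → ℝ) (θ u : Fin 4 → ℝ)

/-- The difference tensor `Pᶜ_ab = δᶜ_a θ_b + δᶜ_b θ_a - g_ab uᶜ` of two conformally related
connections. -/
def conformalDiff (c a b : Fin 4) : ℝ :=
  (if c = a then θ b else 0) + (if c = b then θ a else 0) - G a b * u c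

lemma sum_conformalDiff_trace (hθ : ∀ a, ∑ b, G a b * u b = θ a)
    (a : Fin 4) : ∑ c, conformalDiff G θ u c a c = 4 * θ a := by
  simp only [conformalDiff, Finset.sum_sub_distrib, Finset.sum_add_distrib, hθ]
  simp

lemma sum_conformalDiff_trace' (hs : ∀ a b, G a b = G b a) (hθ : ∀ a, ∑ b, G a b * u b = θ a)
    (a : Fin 4) : ∑ c, conformalDiff G θ u c c a = 4 * θ a := by
  rw [← sum_conformalDiff_trace G θ u hθ a]
  refine Finset.sum_congr rfl fun c _ => ?_
  simp only [conformalDiff]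
  rw [hs c a]
  ring

lemma sum_mul_conformalDiff_up (X : Fin 4 → ℝ) (a b : Fin 4) :
    ∑ d, X d * conformalDiff G θ u d a b = X a * θ b + X b * θ a - G a b * ∑ d, X d * u d := by
  simp only [conformalDiff, mul_sub, mul_add, mul_ite, mul_zero, Finset.sum_sub_distrib,
    Finset.sum_add_distrib, Finset.sum_ite_eq', Finset.mem_univ, if_true, Finset.mul_sum]
  congr 1
  exact Finset.sum_congr rfl fun d _ => by ring

lemma sum_conformalDiff_down_mul (Y : Fin 4 → ℝ) (c b : Fin 4) :
    ∑ d, conformalDiff G θ u c b d * Y d =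
      (if c = b then ∑ d, θ d * Y d else 0) + θ b * Y c - (∑ d, G b d * Y d) * u c := by
  simp only [conformalDiff, sub_mul, add_mul, ite_mul, zero_mul, Finset.sum_sub_distrib,
    Finset.sum_add_distrib, Finset.sum_ite_eq, Finset.mem_univ, if_true, Finset.sum_mul]
  congr 1
  · congr 1
    split_ifs with h
    · rfl
    · simp
  · exact Finset.sum_congr rfl fun d _ => by ring

/-- The change of the quadratic part of the Ricci tensor under a conformal change. -/
lemma quadratic_conformal (hΓ : ∀ c a b, Γ c a b = Γ c b a) (hs : ∀ a b, G a b = G b a)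
    (hθ : ∀ a, ∑ b, G a b * u b = θ a) (a b : Fin 4) :
    ∑ c, ∑ d, ((Γ c c d + conformalDiff G θ u c c d) * (Γ d a b + conformalDiff G θ u d a b)
      - (Γ c b d + conformalDiff G θ u c b d) * (Γ d a c + conformalDiff G θ u d a c)) =
    ∑ c, ∑ d, (Γ c c d * Γ d a b - Γ c b d * Γ d a c) + 2 * ∑ d, Γ d a b * θ d
      + ∑ c, u c * ∑ d, (G d b * Γ d c a + G d a * Γ d c b) + 2 * θ a * θ b
      - G a b * (∑ c, ∑ d, Γ c c d * u d + 2 * ∑ d, θ d * u d) := by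
  set Q := conformalDiff G θ u with hQ
  -- The two products `ΓΓ` are expanded separately, each into a pure `Γ` part, mixed parts and a
  -- pure `Q` part. The pure `Q` parts contribute `8 - 6 = 2` to `θ_a θ_b` and `-(4 - 2) = -2` to
  -- `g_ab θ·u`.
  have e1 : ∑ c, ∑ d, (Γ c c d + Q c c d) * (Γ d a b + Q d a b) =
      ∑ c, ∑ d, Γ c c d * Γ d a b + ∑ c, (Γ c c a * θ b + Γ c c b * θ a) -
        G a b * ∑ c, ∑ d, Γ c c d * u d + 4 * ∑ d, θ d * Γ d a b
        + (8 * θ a * θ b - 4 * G a b * ∑ d, θ d * u d) := by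
    have h1 : ∀ c, ∑ d, Γ c c d * Q d a b =
        Γ c c a * θ b + Γ c c b * θ a - G a b * ∑ d, Γ c c d * u d := fun c =>
      sum_mul_conformalDiff_up G θ u (fun d => Γ c c d) a b
    have h2 : ∀ Y : Fin 4 → ℝ, ∑ c, ∑ d, Q c c d * Y d = 4 * ∑ d, θ d * Y d := by
      intro Y
      rw [Finset.sum_comm, Finset.mul_sum]
      refine Finset.sum_congr rfl fun d _ => ?_
      rw [← Finset.sum_mul, hQ, sum_conformalDiff_trace' G θ u hs hθ]
      ring
    have h3 := sum_mul_conformalDiff_up G θ u θ a b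
    rw [← hQ] at h3
    have h4 : ∀ c, ∑ d, (Γ c c d + Q c c d) * (Γ d a b + Q d a b) =
        ∑ d, Γ c c d * Γ d a b + ∑ d, Γ c c d * Q d a b + ∑ d, Q c c d * Γ d a b
          + ∑ d, Q c c d * Q d a b := by
      intro c
      rw [← Finset.sum_add_distrib, ← Finset.sum_add_distrib, ← Finset.sum_add_distrib]
      exact Finset.sum_congr rfl fun d _ => by ring
    simp only [h4, h1, Finset.sum_add_distrib, Finset.sum_sub_distrib, h2, h3, ← Finset.mul_sum]
    ring
  have e2 : ∑ c, ∑ d, (Γ c b d + Q c b d) * (Γ d a c + Q d a c) =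
      ∑ c, ∑ d, Γ c b d * Γ d a c
        + (∑ c, Γ c b a * θ c + ∑ c, Γ c b c * θ a - ∑ c, ∑ d, G a c * (Γ c b d * u d))
        + (∑ d, θ d * Γ d a b + ∑ c, θ b * Γ c a c - ∑ c, (∑ d, G b d * Γ d a c) * u c)
        + (6 * θ a * θ b - 2 * G a b * ∑ d, θ d * u d) := by
    have h1 : ∀ c, ∑ d, Γ c b d * Q d a c =
        Γ c b a * θ c + Γ c b c * θ a - G a c * ∑ d, Γ c b d * u d := fun c =>
      sum_mul_conformalDiff_up G θ u (fun d => Γ c b d) a c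
    have h2 : ∀ c, ∑ d, Q c b d * Γ d a c = (if c = b then ∑ d, θ d * Γ d a c else 0)
        + θ b * Γ c a c - (∑ d, G b d * Γ d a c) * u c := fun c =>
      sum_conformalDiff_down_mul G θ u (fun d => Γ d a c) c b
    have h3 : ∀ c, ∑ d, Q c b d * Q d a c = (if c = b then ∑ d, θ d * Q d a c else 0)
        + θ b * Q c a c - (∑ d, G b d * Q d a c) * u c := fun c =>
      sum_conformalDiff_down_mul G θ u (fun d => Q d a c) c b
    have h4 : ∑ d, θ d * Q d a b = 2 * θ a * θ b - G a b * ∑ d, θ d * u d := by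
      have := sum_mul_conformalDiff_up G θ u θ a b
      rw [← hQ] at this
      rw [this]; ring
    have h5 : ∀ c, ∑ d, G b d * Q d a c = G b a * θ c + G b c * θ a - G a c * θ b := by
      intro c
      rw [hQ, sum_mul_conformalDiff_up G θ u (fun d => G b d) a c, hθ]
    have h6 : ∑ c, (∑ d, G b d * Q d a c) * u c = G a b * ∑ d, θ d * u d := by
      have : ∀ c, (∑ d, G b d * Q d a c) * u c =
          G b a * (θ c * u c) + θ a * (G b c * u c) - θ b * (G a c * u c) := by
        intro c
        rw [h5]; ring
      simp only [this, Finset.sum_add_distrib, Finset.sum_sub_distrib, ← Finset.mul_sum, hθ]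
      rw [hs b a]
      ring
    have h7 : ∑ c, ∑ d, Q c b d * Q d a c = 6 * θ a * θ b - 2 * G a b * ∑ d, θ d * u d := by
      simp only [h3, Finset.sum_add_distrib, Finset.sum_sub_distrib, h6, ← Finset.mul_sum]
      rw [hQ, sum_conformalDiff_trace G θ u hθ, ← hQ]
      simp only [Finset.sum_ite_eq', Finset.mem_univ, if_true, h4]
      ring
    have h8 : ∀ c, ∑ d, (Γ c b d + Q c b d) * (Γ d a c + Q d a c) =
        ∑ d, Γ c b d * Γ d a c + ∑ d, Γ c b d * Q d a c + ∑ d, Q c b d * Γ d a c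
          + ∑ d, Q c b d * Q d a c := by
      intro c
      rw [← Finset.sum_add_distrib, ← Finset.sum_add_distrib, ← Finset.sum_add_distrib]
      exact Finset.sum_congr rfl fun d _ => by ring
    simp only [h8, Finset.sum_add_distrib, h7]
    simp only [h1, h2, Finset.sum_add_distrib, Finset.sum_sub_distrib, Finset.sum_ite_eq',
      Finset.mem_univ, if_true, Finset.mul_sum]
  have r1 : ∑ c, Γ c c a * θ b = ∑ c, θ b * Γ c a c :=
    Finset.sum_congr rfl fun c _ => by rw [hΓ c c a]; ring
  -- By symmetry of `Γ`, the mixed terms with a traced `Γ` cancel between the two products.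
  have r2 : ∑ c, Γ c c b * θ a = ∑ c, Γ c b c * θ a :=
    Finset.sum_congr rfl fun c _ => by rw [hΓ c c b]
  have r3 : ∑ c, Γ c b a * θ c = ∑ d, Γ d a b * θ d :=
    Finset.sum_congr rfl fun c _ => by rw [hΓ c b a]
  have r4 : ∑ d, θ d * Γ d a b = ∑ d, Γ d a b * θ d :=
    Finset.sum_congr rfl fun c _ => by ring
  have r5 : ∑ c, u c * ∑ d, (G d b * Γ d c a + G d a * Γ d c b) =
      ∑ c, ∑ d, G a c * (Γ c b d * u d) + ∑ c, (∑ d, G b d * Γ d a c) * u c := by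
    rw [Finset.sum_comm, ← Finset.sum_add_distrib]
    refine Finset.sum_congr rfl fun c _ => ?_
    rw [Finset.mul_sum, Finset.sum_mul, ← Finset.sum_add_distrib]
    refine Finset.sum_congr rfl fun d _ => ?_
    rw [hs d a, hs d b, hΓ d c a, hΓ d c b]
    ring
  simp only [Finset.sum_sub_distrib]
  rw [e1, e2, r5, r3, r4, Finset.sum_add_distrib, r1, r2]
  ring

end Algebra

/-! ### Conformal change of the Christoffel symbols and of the Ricci tensor -/

section ConformalChange

variable {M : Type*} [TopologicalSpace M] [ChartedSpace (EuclideanHalfSpace 4) M]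
  {k : ℕ∞} {e : OpenPartialHomeomorph M (EuclideanHalfSpace 4)} {x : E4}
  {gt g : Tensor2 M} {Ω : M → ℝ}

/-- The components `-∂_a log Ω`. -/
def logGrad (Ω : M → ℝ) (e : OpenPartialHomeomorph M (EuclideanHalfSpace 4)) (a : Fin 4)
    (x : E4) : ℝ :=
  -(pd a (Ω ∘ chartPoint e) x * (Ω (chartPoint e x))⁻¹)

/-- The components of the `g`-gradient of `-log Ω`. -/
def logGradUp (g : Tensor2 M) (Ω : M → ℝ) (e : OpenPartialHomeomorph M (EuclideanHalfSpace 4))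
    (c : Fin 4) (x : E4) : ℝ :=
  ∑ d, (comp g e x)⁻¹ c d * logGrad Ω e d x

lemma sum_comp_mul_logGradUp (hdet : (comp g e x).det ≠ 0) (a : Fin 4) :
    ∑ b, comp g e x a b * logGradUp g Ω e b x = logGrad Ω e a x := by
  simp only [logGradUp, Finset.mul_sum]
  rw [Finset.sum_comm]
  have : ∀ d, ∑ b, comp g e x a b * ((comp g e x)⁻¹ b d * logGrad Ω e d x) =
      (if a = d then 1 else 0) * logGrad Ω e d x := by
    intro d
    rw [← sum_comp_mul_inv hdet a d, Finset.sum_mul]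
    exact Finset.sum_congr rfl fun b _ => by ring
  rw [Finset.sum_congr rfl fun d _ => this d]
  simp

/-- With `θ = -d log Ω` one has `∂_c g̃_ab = Ω⁻² (∂_c g_ab + 2 θ_c g_ab)`, and the powers of `Ω`
cancel against the inverse metric. The extra terms assemble into `conformalDiff`. -/
lemma christoffel_conformal (hk : 2 ≤ k) (hM : IsAsymptoticallySimple k gt g Ω)
    (hop : IsOpen (physical M)) (he : e ∈ Charts M k)
    (hx : x ∈ chartTarget e) (hp : chartPoint e x ∈ physical M) (c a b : Fin 4) :
    christoffel gt e c a b x = christoffel g e c a b x +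
      conformalDiff (comp g e x) (fun d => logGrad Ω e d x) (fun d => logGradUp g Ω e d x) c a b := by
  have hx' := chartTarget_subset_halfSpace hx
  have hg := hM.unphysicalMetric
  have hdet := det_comp_ne_zero hg he hx trivial
  have hone : (1 : ℕ∞ω) ≤ k := le_add_self.trans (two_le_cast hk)
  have hk0 : (k : ℕ∞ω) ≠ 0 := (zero_lt_one.trans_le hone).ne'
  set W := Ω (chartPoint e x) with hW
  have hW0 : W ≠ 0 := (hM.pos _ hp).ne'
  have hcomp : ∀ y, chartPoint e y ∈ physical M → ∀ a b,
      comp g e y a b = Ω (chartPoint e y) ^ 2 * comp gt e y a b := by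
    intro y hy a b
    simp only [comp, Matrix.of_apply, hM.conformal _ hy, smul_apply, smul_eq_mul]
  have hmat : comp gt e x = (W ^ 2)⁻¹ • comp g e x := by
    ext a b
    rw [Matrix.smul_apply, hcomp x hp, smul_eq_mul, ← mul_assoc, inv_mul_cancel₀ (pow_ne_zero 2 hW0),
      one_mul]
  have hinv : ∀ c d, (comp gt e x)⁻¹ c d = W ^ 2 * (comp g e x)⁻¹ c d := by
    intro c d
    have h : (comp gt e x)⁻¹ = W ^ 2 • (comp g e x)⁻¹ := by
      refine Matrix.inv_eq_left_inv ?_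
      rw [hmat, smul_mul_smul_comm, Matrix.nonsing_inv_mul _ hdet.isUnit,
        mul_inv_cancel₀ (pow_ne_zero 2 hW0), one_smul]
    rw [h, Matrix.smul_apply, smul_eq_mul]
  have hΩd : DifferentiableWithinAt ℝ (Ω ∘ chartPoint e) halfSpace x :=
    (contDiffWithinAt_factor hM.contMDiff he hx).differentiableWithinAt hk0
  have hΩΩ : DifferentiableWithinAt ℝ
      (fun y => (Ω ∘ chartPoint e) y * (Ω ∘ chartPoint e) y) halfSpace x := hΩd.mul hΩd
  have hpd : ∀ c a b, pd c (fun y => comp gt e y a b) x = (W ^ 2)⁻¹ *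
      (pd c (fun y => comp g e y a b) x + 2 * logGrad Ω e c x * comp g e x a b) := by
    intro c a b
    have hd : DifferentiableWithinAt ℝ (fun y => comp gt e y a b) halfSpace x :=
      (contDiffWithinAt_comp hM.physicalMetric he hop hx hp a b).differentiableWithinAt hk0
    have h1 : pd c (fun y => comp g e y a b) x = pd c (fun y => ((Ω ∘ chartPoint e) y *
        (Ω ∘ chartPoint e) y) * comp gt e y a b) x := by
      refine pd_congr c ?_ hx'
      filter_upwards [eventually_mem hop hx hp] with y hy
      rw [hcomp y hy.2]
      simp only [Function.comp]
      ring
    rw [pd_mul c hx' hΩΩ hd, pd_mul c hx' hΩd hΩd] at h1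
    rw [h1, hcomp x hp]
    simp only [logGrad, Function.comp, ← hW]
    field_simp
    ring
  simp only [christoffel, hinv, hpd]
  have h1 : ∀ d, W ^ 2 * (comp g e x)⁻¹ c d * ((W ^ 2)⁻¹ *
        (pd a (fun y => comp g e y d b) x + 2 * logGrad Ω e a x * comp g e x d b) + (W ^ 2)⁻¹ *
        (pd b (fun y => comp g e y d a) x + 2 * logGrad Ω e b x * comp g e x d a) - (W ^ 2)⁻¹ *
        (pd d (fun y => comp g e y a b) x + 2 * logGrad Ω e d x * comp g e x a b)) =
      (comp g e x)⁻¹ c d * (pd a (fun y => comp g e y d b) x + pd b (fun y => comp g e y d a) x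
        - pd d (fun y => comp g e y a b) x) + 2 * (logGrad Ω e a x *
          ((comp g e x)⁻¹ c d * comp g e x d b) + logGrad Ω e b x *
          ((comp g e x)⁻¹ c d * comp g e x d a) - comp g e x a b *
          ((comp g e x)⁻¹ c d * logGrad Ω e d x)) := by
    intro d
    field_simp
    ring
  simp only [h1, Finset.sum_add_distrib, Finset.sum_sub_distrib, ← Finset.mul_sum,
    sum_inv_mul_comp hdet, conformalDiff]
  simp only [logGradUp]
  split_ifs <;> ring

/-- Conformal change of the Ricci tensor, up to a multiple of the metric. -/
lemma ricci_conformal (hk : 2 ≤ k) (hM : IsAsymptoticallySimple k gt g Ω)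
    (hop : IsOpen (physical M)) (he : e ∈ Charts M k)
    (hx : x ∈ chartTarget e) (hp : chartPoint e x ∈ physical M) :
    ∃ μ : ℝ, ∀ a b, Ω (chartPoint e x) * ricci gt e a b x =
      Ω (chartPoint e x) * ricci g e a b x + 2 * hessian g Ω e a b x + μ * comp g e x a b := by
  have hx' := chartTarget_subset_halfSpace hx
  have hg := hM.unphysicalMetric
  have hdet := det_comp_ne_zero hg he hx trivial
  have hone : (1 : ℕ∞ω) ≤ k := le_add_self.trans (two_le_cast hk)
  have hk0 : (k : ℕ∞ω) ≠ 0 := (zero_lt_one.trans_le hone).ne'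
  have hW0 : Ω (chartPoint e x) ≠ 0 := (hM.pos _ hp).ne'
  have hev := eventually_mem hop hx hp
  have hΩ2 : ContDiffWithinAt ℝ 2 (Ω ∘ chartPoint e) halfSpace x :=
    (contDiffWithinAt_factor hM.contMDiff he hx).of_le (by
      have := two_le_cast hk; rwa [one_add_one_eq_two] at this)
  have hΩd : DifferentiableWithinAt ℝ (Ω ∘ chartPoint e) halfSpace x :=
    hΩ2.differentiableWithinAt two_ne_zero
  have hdΩ : ∀ a, ContDiffWithinAt ℝ 1 (pd a (Ω ∘ chartPoint e)) halfSpace x := fun a =>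
    contDiffWithinAt_pd a (by norm_num) hx' hΩ2
  have hΩinv : ContDiffWithinAt ℝ 1 (fun y => (Ω (chartPoint e y))⁻¹) halfSpace x :=
    (hΩ2.of_le one_le_two).inv hW0
  have hθc : ∀ a, ContDiffWithinAt ℝ 1 (logGrad Ω e a) halfSpace x := fun a =>
    ((hdΩ a).mul hΩinv).neg
  have hθ : ∀ a, DifferentiableWithinAt ℝ (logGrad Ω e a) halfSpace x := fun a =>
    (hθc a).differentiableWithinAt one_ne_zero
  have hu : ∀ c, DifferentiableWithinAt ℝ (logGradUp g Ω e c) halfSpace x := fun c =>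
    (ContDiffWithinAt.sum fun d _ => ((contDiffWithinAt_comp_inv hg he hx c d).of_le hone).mul
      (hθc d)).differentiableWithinAt one_ne_zero
  have hG : ∀ a b, DifferentiableWithinAt ℝ (fun y => comp g e y a b) halfSpace x := fun a b =>
    (contDiffWithinAt_comp hg he isOpen_univ hx trivial a b).differentiableWithinAt hk0
  have hΓ : ∀ c a b, DifferentiableWithinAt ℝ (christoffel g e c a b) halfSpace x :=
    fun c a b => (contDiffWithinAt_christoffel hk hg he hx c a b).differentiableWithinAt one_ne_zero
  -- Obtained by differentiating `Ω θ_b = -∂_b Ω`, which holds near `x`.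
  have hpdθ : ∀ a b, Ω (chartPoint e x) * pd a (logGrad Ω e b) x =
      -pd a (pd b (Ω ∘ chartPoint e)) x
        + Ω (chartPoint e x) * (logGrad Ω e a x * logGrad Ω e b x) := by
    intro a b
    have h1 : pd a (fun y => (Ω ∘ chartPoint e) y * logGrad Ω e b y) x =
        pd a (fun y => -1 * pd b (Ω ∘ chartPoint e) y) x := by
      refine pd_congr a ?_ hx'
      filter_upwards [hev] with y hy
      have : Ω (chartPoint e y) ≠ 0 := (hM.pos _ hy.2).ne'
      simp only [logGrad, Function.comp]
      field_simp
    rw [pd_mul a hx' hΩd (hθ b), pd_const_mul a _ hx'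
      ((hdΩ b).differentiableWithinAt one_ne_zero)] at h1
    have h2 : pd a (Ω ∘ chartPoint e) x = -(Ω (chartPoint e x) * logGrad Ω e a x) := by
      simp only [logGrad]
      field_simp
    rw [h2] at h1
    simp only [Function.comp] at h1 ⊢
    linarith
  have hpdP : ∀ c a b, pd c (fun y => conformalDiff (comp g e y) (fun d => logGrad Ω e d y)
      (fun d => logGradUp g Ω e d y) c a b) x =
      (if c = a then pd c (logGrad Ω e b) x else 0) + (if c = b then pd c (logGrad Ω e a) x else 0)
        - (pd c (fun y => comp g e y a b) x * logGradUp g Ω e c x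
          + comp g e x a b * pd c (logGradUp g Ω e c) x) := by
    intro c a b
    have hd1 : DifferentiableWithinAt ℝ (fun y => if c = a then logGrad Ω e b y else 0)
        halfSpace x := by
      split_ifs
      · exact hθ b
      · exact differentiableWithinAt_const _
    have hd2 : DifferentiableWithinAt ℝ (fun y => if c = b then logGrad Ω e a y else 0)
        halfSpace x := by
      split_ifs
      · exact hθ a
      · exact differentiableWithinAt_const _
    have hd12 : DifferentiableWithinAt ℝ (fun y => (if c = a then logGrad Ω e b y else 0)
        + (if c = b then logGrad Ω e a y else 0)) halfSpace x := hd1.add hd2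
    have hd3 : DifferentiableWithinAt ℝ (fun y => comp g e y a b * logGradUp g Ω e c y)
        halfSpace x := (hG a b).mul (hu c)
    have hd4 : DifferentiableWithinAt ℝ (fun y => -1 * (comp g e y a b * logGradUp g Ω e c y))
        halfSpace x := hd3.const_mul _
    have hz : pd c (fun _ => (0 : ℝ)) x = 0 := by simp [pd]
    have h1 : (fun y => conformalDiff (comp g e y) (fun d => logGrad Ω e d y)
        (fun d => logGradUp g Ω e d y) c a b) = fun y =>
        ((if c = a then logGrad Ω e b y else 0) + (if c = b then logGrad Ω e a y else 0))
          + -1 * (comp g e y a b * logGradUp g Ω e c y) := by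
      funext y
      simp only [conformalDiff]
      ring
    rw [h1, pd_add c hx' hd12 hd4, pd_add c hx' hd1 hd2,
      pd_const_mul c _ hx' hd3, pd_mul c hx' (hG a b) (hu c)]
    split_ifs <;> (try simp only [hz]) <;> ring
  have hdP : ∀ c a b, DifferentiableWithinAt ℝ (fun y => conformalDiff (comp g e y)
      (fun d => logGrad Ω e d y) (fun d => logGradUp g Ω e d y) c a b) halfSpace x := by
    intro c a b
    simp only [conformalDiff]
    refine (DifferentiableWithinAt.add ?_ ?_).sub ((hG a b).mul (hu c))
    · split_ifs
      · exact hθ b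
      · exact differentiableWithinAt_const _
    · split_ifs
      · exact hθ a
      · exact differentiableWithinAt_const _
  -- The relation between the Christoffel symbols holds at all nearby points, so it can be
  -- differentiated.
  have hcong : ∀ c a b d, pd d (christoffel gt e c a b) x = pd d (christoffel g e c a b) x
      + pd d (fun y => conformalDiff (comp g e y) (fun d => logGrad Ω e d y)
        (fun d => logGradUp g Ω e d y) c a b) x := by
    intro c a b d
    rw [← pd_add d hx' (hΓ c a b) (hdP c a b)]
    refine pd_congr d ?_ hx'
    filter_upwards [hev] with y hy
    exact christoffel_conformal hk hM hop he hy.1 hy.2 c a b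
  have htrace : ∀ a b, ∑ c, pd b (fun y => conformalDiff (comp g e y) (fun d => logGrad Ω e d y)
      (fun d => logGradUp g Ω e d y) c a c) x = 4 * pd b (logGrad Ω e a) x := by
    intro a b
    rw [← pd_sum _ b hx' fun c _ => hdP c a c, ← pd_const_mul b 4 hx' (hθ a)]
    refine pd_congr b ?_ hx'
    filter_upwards [hev] with y hy
    exact sum_conformalDiff_trace _ _ _
      (sum_comp_mul_logGradUp (det_comp_ne_zero hg he hy.1 trivial)) a
  -- All the trace terms: `μ = -Ω (div u + 2 θ·u)`, where `u` is the gradient with components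
  -- `logGradUp`. Only the existence of `μ` matters; it may be unbounded near the boundary.
  refine ⟨Ω (chartPoint e x) * -(∑ c, pd c (logGradUp g Ω e c) x
    + (∑ c, ∑ d, christoffel g e c c d x * logGradUp g Ω e d x
      + 2 * ∑ d, logGrad Ω e d x * logGradUp g Ω e d x)), fun a b => ?_⟩
  have hquad := quadratic_conformal (fun c a b => christoffel g e c a b x) (comp g e x)
    (fun d => logGrad Ω e d x) (fun d => logGradUp g Ω e d x)
    (fun c a b => christoffel_symm hg c a b) (comp_symm hg trivial)
    (sum_comp_mul_logGradUp hdet) a b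
  have hric : ricci gt e a b x = ricci g e a b x +
      (pd a (logGrad Ω e b) x + pd b (logGrad Ω e a) x - 4 * pd b (logGrad Ω e a) x
      + 2 * ∑ d, christoffel g e d a b x * logGrad Ω e d x + 2 * logGrad Ω e a x * logGrad Ω e b x)
      - comp g e x a b * (∑ c, pd c (logGradUp g Ω e c) x
    + (∑ c, ∑ d, christoffel g e c c d x * logGradUp g Ω e d x
      + 2 * ∑ d, logGrad Ω e d x * logGradUp g Ω e d x)) := by
    simp only [ricci, christoffel_conformal hk hM hop he hx hp, hcong]
    rw [Finset.sum_add_distrib, hquad]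
    simp only [Finset.sum_add_distrib, Finset.sum_sub_distrib, htrace, hpdP]
    -- Metric compatibility: the derivative of `g_ab` along `u`, produced by differentiating
    -- `conformalDiff`, cancels the `u g Γ` terms of the quadratic part.
    have h2 : ∑ c, pd c (fun y => comp g e y a b) x * logGradUp g Ω e c x =
        ∑ c, logGradUp g Ω e c x * ∑ d, (comp g e x d b * christoffel g e d c a x
          + comp g e x d a * christoffel g e d c b x) := by
      refine Finset.sum_congr rfl fun c _ => ?_
      rw [pd_comp_eq hg he hx]
      ring
    simp only [Finset.sum_add_distrib] at h2
    rw [h2, ← Finset.mul_sum]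
    simp only [Finset.sum_ite_eq', Finset.mem_univ, if_true]
    ring
  have hsym : pd a (pd b (Ω ∘ chartPoint e)) x = pd b (pd a (Ω ∘ chartPoint e)) x :=
    pd_comm a b hx' hΩ2
  have hΓθ : Ω (chartPoint e x) * ∑ d, christoffel g e d a b x * logGrad Ω e d x =
      -∑ d, christoffel g e d a b x * pd d (Ω ∘ chartPoint e) x := by
    rw [Finset.mul_sum, ← Finset.sum_neg_distrib]
    refine Finset.sum_congr rfl fun d _ => ?_
    simp only [logGrad]
    field_simp
  rw [hric, hessian]
  have e1 := hpdθ a b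
  have e2 := hpdθ b a
  rw [← hsym] at e2
  -- The second derivatives of `Ω` occur with coefficient `-1 + 3 = 2`, and the `θ_a θ_b` terms
  -- cancel since `1 - 3 + 2 = 0`.
  linear_combination e1 - 3 * e2 + 2 * hΓθ

end ConformalChange

/-! ### The Hessian of `Ω` on null infinity, and shear-freeness -/

section NullInfinity

variable {M : Type*} [TopologicalSpace M] [ChartedSpace (EuclideanHalfSpace 4) M]
  {k : ℕ∞} {e : OpenPartialHomeomorph M (EuclideanHalfSpace 4)} {x : E4}
  {gt g : Tensor2 M} {Ω : M → ℝ}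

lemma factor_nonneg (hM : IsAsymptoticallySimple k gt g Ω) (p : M) : 0 ≤ Ω p := by
  by_cases hp : p ∈ physical M
  · exact (hM.pos p hp).le
  · refine (hM.zero p ?_).ge
    rw [scri, ← ModelWithCorners.compl_interior]
    exact hp

lemma mfderiv_factor_coordMap (hk : 2 ≤ k) (hΩ : ContMDiff (𝓡∂ 4) 𝓘(ℝ, ℝ) k Ω)
    (he : e ∈ Charts M k) (hx : x ∈ chartTarget e) (v : E4) :
    mfderiv (𝓡∂ 4) 𝓘(ℝ, ℝ) Ω (chartPoint e x) (coordMap e x v) =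
      ∑ a, v a * pd a (Ω ∘ chartPoint e) x := by
  have hk0 : (k : ℕ∞ω) ≠ 0 := (zero_lt_one.trans_le (le_add_self.trans (two_le_cast hk))).ne'
  have h1 := ((hΩ (chartPoint e x)).mdifferentiableAt hk0).hasMFDerivAt
  have h2 := (mdifferentiableWithinAt_chartPoint he hx).hasMFDerivWithinAt
  have h3 := h1.comp_hasMFDerivWithinAt x h2
  rw [← fderivWithin_eq_sum_pd, ← mfderivWithin_eq_fderivWithin,
    h3.mfderivWithin (uniqueDiffOn_halfSpace x
      (chartTarget_subset_halfSpace hx)).uniqueMDiffWithinAt]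
  rfl

/-- For an arbitrary chart of the maximal atlas this is boundary invariance, and `Ω` supplies a
short proof. At a boundary point with `x 0 > 0` the function `Ω ≥ 0` would have an interior minimum
in coordinates, so `dΩ` would vanish there. -/
lemma chartPoint_mem_physical (hk : 2 ≤ k) (hM : IsAsymptoticallySimple k gt g Ω)
    (he : e ∈ Charts M k) (hx : x ∈ chartTarget e) (h0 : 0 < x 0) :
    chartPoint e x ∈ physical M := by
  by_contra hp
  have hp' : chartPoint e x ∈ scri M := by
    rw [scri, ← ModelWithCorners.compl_interior]
    exact hp
  have hnhds : halfSpace ∈ 𝓝 x := by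
    refine mem_of_superset ((isOpen_lt continuous_const
      (EuclideanSpace.proj (𝕜 := ℝ) (0 : Fin 4)).continuous).mem_nhds h0) fun y hy => ?_
    exact mem_halfSpace.2 (le_of_lt hy)
  have hmin : IsLocalMin (Ω ∘ chartPoint e) x := by
    refine Eventually.of_forall fun y => ?_
    simp only [Function.comp, hM.zero _ hp']
    exact factor_nonneg hM _
  refine hM.gradient_ne_zero _ hp' ?_
  ext v
  obtain ⟨v, rfl⟩ := coordMap_surjective he hx v
  rw [mfderiv_factor_coordMap hk hM.contMDiff he hx, ← fderivWithin_eq_sum_pd,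
    fderivWithin_of_mem_nhds hnhds, hmin.fderiv_eq_zero]
  rfl

lemma coord_zero_of_mem_scri (hk : 2 ≤ k) (hM : IsAsymptoticallySimple k gt g Ω)
    (he : e ∈ Charts M k) (hx : x ∈ chartTarget e) (hp : chartPoint e x ∈ scri M) : x 0 = 0 := by
  by_contra h
  have h0 : 0 < x 0 := lt_of_le_of_ne (mem_halfSpace.1 (chartTarget_subset_halfSpace hx)) (Ne.symm h)
  exact disjoint_left.1 ((𝓡∂ 4).disjoint_interior_boundary)
    (chartPoint_mem_physical hk hM he hx h0) hp

/-- A quarter of the trace of the Hessian of `Ω`. -/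
def hessianTrace (g : Tensor2 M) (Ω : M → ℝ) (e : OpenPartialHomeomorph M (EuclideanHalfSpace 4))
    (x : E4) : ℝ :=
  (1 / 4 : ℝ) * ∑ c, ∑ d, (comp g e x)⁻¹ c d * hessian g Ω e d c x

lemma continuousWithinAt_hessianTrace (hk : 2 ≤ k) (hM : IsAsymptoticallySimple k gt g Ω)
    (he : e ∈ Charts M k) (hx : x ∈ chartTarget e) :
    ContinuousWithinAt (hessianTrace g Ω e) halfSpace x :=
  continuousWithinAt_const.mul (tendsto_finsetSum _ fun c _ => tendsto_finsetSum _ fun d _ =>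
    (contDiffWithinAt_comp_inv hM.unphysicalMetric he hx c d).continuousWithinAt.mul
      (continuousWithinAt_hessian hk hM.unphysicalMetric hM.contMDiff he hx d c))

lemma isOpen_physical (M : Type*) [TopologicalSpace M] [ChartedSpace (EuclideanHalfSpace 4) M]
    (k : ℕ∞) [IsManifold (𝓡∂ 4) ((k : ℕ∞ω) + 1) M] : IsOpen (physical M) :=
  (𝓡∂ 4).isOpen_interior (n := (k : ℕ∞ω) + 1) (by simp)

variable [IsManifold (𝓡∂ 4) ((k : ℕ∞ω) + 1) M]

/-- On null infinity the Hessian of `Ω` is pure trace. -/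
lemma hessian_eq_trace_mul_comp (hk : 2 ≤ k) (hM : IsAsymptoticallyEmptyAndSimple k gt g Ω)
    (he : e ∈ Charts M k) (hx : x ∈ chartTarget e) (hp : chartPoint e x ∈ scri M) (a b : Fin 4) :
    hessian g Ω e a b x = hessianTrace g Ω e x * comp g e x a b := by
  have hS := hM.toIsAsymptoticallySimple
  have hg := hS.unphysicalMetric
  have hop := isOpen_physical M k
  obtain ⟨U, hU, hsU, hRic⟩ := hM.empty
  let A : Fin 4 → Fin 4 → E4 → ℝ := fun a b y =>
    Ω (chartPoint e y) * ricci g e a b y + 2 * hessian g Ω e a b y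
  have hx' := chartTarget_subset_halfSpace hx
  have hA : ∀ a b, ContinuousWithinAt (A a b) halfSpace x := fun a b =>
    ((contDiffWithinAt_factor hS.contMDiff he hx).continuousWithinAt.mul
      (continuousWithinAt_ricci hk hg he hx a b)).add
      (continuousWithinAt_const.mul (continuousWithinAt_hessian hk hg hS.contMDiff he hx a b))
  have hG : ∀ a b, ContinuousWithinAt (fun y => comp g e y a b) halfSpace x := fun a b =>
    (contDiffWithinAt_comp hg he isOpen_univ hx trivial a b).continuousWithinAt
  have hne : (𝓝[interior halfSpace] x).NeBot :=
    mem_closure_iff_nhdsWithin_neBot.1 ((𝓡∂ 4).range_subset_closure_interior hx')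
  -- Proportionality to the metric is expressed by vanishing minors. This eliminates the
  -- uncontrolled factor `μ`, so the limit from the interior can be taken.
  have hprop : ∀ a b c d, A a b x * comp g e x c d - A c d x * comp g e x a b = 0 := by
    intro a b c d
    have hlim := (((hA a b).mul (hG c d)).sub ((hA c d).mul (hG a b))).mono_left
      (nhdsWithin_mono x (interior_subset (s := halfSpace)))
    refine tendsto_nhds_unique hlim (tendsto_const_nhds.congr' ?_)
    have hev := (eventually_mem hU hx (hsU hp)).filter_mono
      (nhdsWithin_mono x (interior_subset (s := halfSpace)))
    filter_upwards [hev, self_mem_nhdsWithin] with y hy hy0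
    have hy0' : 0 < y 0 := by
      rw [interior_range_modelWithCornersEuclideanHalfSpace] at hy0
      exact hy0
    have hyp := chartPoint_mem_physical hk hS he hy.1 hy0'
    obtain ⟨μ, hμ⟩ := ricci_conformal hk hS hop he hy.1 hyp
    have h0 : ∀ a b, A a b y = -μ * comp g e y a b := by
      intro a b
      have := hμ a b
      rw [hRic e he y hy.1 ⟨hy.2, hyp⟩ a b] at this
      simp only [A]
      linarith
    change 0 = A a b y * comp g e y c d - A c d y * comp g e y a b
    rw [h0 a b, h0 c d]
    ring
  have hAx : ∀ a b, A a b x = 2 * hessian g Ω e a b x := by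
    intro a b
    simp only [A, hS.zero _ hp]
    ring
  have hdet := det_comp_ne_zero hg he hx trivial
  have htr : ∑ c, ∑ d, (comp g e x)⁻¹ c d * comp g e x d c = 4 := by
    simp [sum_inv_mul_comp hdet]
  -- The vanishing minors are contracted with the inverse metric, which identifies the factor as a
  -- quarter of the trace.
  have hmul : hessian g Ω e a b x * (∑ c, ∑ d, (comp g e x)⁻¹ c d * comp g e x d c) =
      (∑ c, ∑ d, (comp g e x)⁻¹ c d * hessian g Ω e d c x) * comp g e x a b := by
    rw [Finset.mul_sum, Finset.sum_mul]
    refine Finset.sum_congr rfl fun c _ => ?_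
    rw [Finset.mul_sum, Finset.sum_mul]
    refine Finset.sum_congr rfl fun d _ => ?_
    have := hprop a b d c
    rw [hAx, hAx] at this
    linear_combination (1 / 2 : ℝ) * (comp g e x)⁻¹ c d * this
  rw [htr] at hmul
  rw [hessianTrace]
  linarith

/-- The Hessian is a multiple of `g`, and `2 g(m, m) = g(u, u) - g(w, w) + 2i g(u, w) = -1 + 1 + 0 =
0`. -/
theorem isShearFree (hk : 2 ≤ k) (hM : IsAsymptoticallyEmptyAndSimple k gt g Ω) :
    IsShearFree k g Ω := by
  intro e he x hx hp u w hs
  have hg := hM.toIsAsymptoticallySimple.unphysicalMetric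
  simp only [shear, hessian_eq_trace_mul_comp hk hM he hx hp]
  have h2 : ((Real.sqrt 2 : ℝ) : ℂ) * ((Real.sqrt 2 : ℝ) : ℂ) = 2 := by
    rw [← Complex.ofReal_mul, Real.mul_self_sqrt (by norm_num)]
    norm_num
  have hs2 : ((Real.sqrt 2 : ℝ) : ℂ) ≠ 0 := fun h => by simp [h] at h2
  have key : ∀ a b : Fin 4, ((u a : ℂ) + Complex.I * (w a : ℂ)) / (Real.sqrt 2 : ℂ) *
      (((u b : ℂ) + Complex.I * (w b : ℂ)) / (Real.sqrt 2 : ℂ)) *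
      ((hessianTrace g Ω e x * comp g e x a b : ℝ) : ℂ) =
      (hessianTrace g Ω e x / 2 : ℂ) * (((comp g e x a b * u a * u b : ℝ) : ℂ)
        - ((comp g e x a b * w a * w b : ℝ) : ℂ) + Complex.I * (((comp g e x a b * u a * w b : ℝ) : ℂ)
        + ((comp g e x b a * u b * w a : ℝ) : ℂ))) := by
    intro a b
    rw [comp_symm hg trivial b a, div_mul_div_comm, h2]
    push_cast
    linear_combination (hessianTrace g Ω e x / 2 : ℂ) * (comp g e x a b : ℂ) * w a * w b *
      Complex.I_mul_I
  simp only [key, ← Finset.mul_sum, Finset.sum_add_distrib, Finset.sum_sub_distrib,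
    ← Complex.ofReal_sum]
  rw [Finset.sum_comm (f := fun a b => comp g e x b a * u b * w a), hs.unit_left, hs.unit_right,
    hs.orthogonal]
  simp

end NullInfinity

/-- The projection of `ℝ⁴` onto the hyperplane `x₀ = 0`. -/
def boundaryProj : E4 →L[ℝ] E4 :=
  ContinuousLinearMap.id ℝ E4 -
    (EuclideanSpace.proj (𝕜 := ℝ) (0 : Fin 4)).smulRight (EuclideanSpace.single 0 1)

lemma boundaryProj_apply_zero (x : E4) : boundaryProj x 0 = 0 := by
  simp [boundaryProj]

lemma boundaryProj_of_coord_zero {x : E4} (hx : x 0 = 0) : boundaryProj x = x := by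
  simp [boundaryProj, hx]

lemma boundaryProj_mem_halfSpace (x : E4) : boundaryProj x ∈ halfSpace :=
  mem_halfSpace.2 (boundaryProj_apply_zero x).ge

lemma isOpen_preimage_chartTarget {M : Type*} [TopologicalSpace M]
    (e : OpenPartialHomeomorph M (EuclideanHalfSpace 4)) : IsOpen (boundaryProj ⁻¹' chartTarget e) := by
  have : boundaryProj ⁻¹' chartTarget e =
      (fun x => (𝓡∂ 4).symm (boundaryProj x)) ⁻¹' e.target := by
    ext x
    simp only [chartTarget, e.extend_target, mem_preimage, mem_inter_iff, and_iff_left_iff_imp]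
    exact fun _ => boundaryProj_mem_halfSpace x
  rw [this]
  exact e.open_target.preimage ((𝓡∂ 4).continuous_symm.comp boundaryProj.continuous)

/-! ### The normal in coordinates: tangent to and orthogonal to null infinity -/

section NormalField

variable {M : Type*} [TopologicalSpace M] [ChartedSpace (EuclideanHalfSpace 4) M]
  {k : ℕ∞} {e : OpenPartialHomeomorph M (EuclideanHalfSpace 4)} {x : E4}
  {gt g : Tensor2 M} {Ω : M → ℝ}

/-- The components `Nᵃ = gᵃᵇ ∂_b Ω` of the normal in the chart `e`. -/
def normalField (g : Tensor2 M) (Ω : M → ℝ)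
    (e : OpenPartialHomeomorph M (EuclideanHalfSpace 4)) (x : E4) : E4 :=
  WithLp.toLp 2 fun a => ∑ b, (comp g e x)⁻¹ a b * pd b (Ω ∘ chartPoint e) x

lemma normalField_apply (a : Fin 4) :
    normalField g Ω e x a = ∑ b, (comp g e x)⁻¹ a b * pd b (Ω ∘ chartPoint e) x := rfl

lemma contDiffWithinAt_normalField (hk : 2 ≤ k) (hM : IsAsymptoticallySimple k gt g Ω)
    (he : e ∈ Charts M k) (hx : x ∈ chartTarget e) :
    ContDiffWithinAt ℝ 1 (normalField g Ω e) halfSpace x := by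
  rw [contDiffWithinAt_piLp]
  intro a
  simp only [normalField_apply]
  exact ContDiffWithinAt.sum fun b _ =>
    ((contDiffWithinAt_comp_inv hM.unphysicalMetric he hx a b).of_le
      (le_add_self.trans (two_le_cast hk))).mul
    (contDiffWithinAt_pd b (two_le_cast hk) (chartTarget_subset_halfSpace hx)
      (contDiffWithinAt_factor hM.contMDiff he hx))

lemma sum_comp_mul_normalField (hdet : (comp g e x).det ≠ 0) (b : Fin 4) :
    ∑ a, comp g e x b a * normalField g Ω e x a = pd b (Ω ∘ chartPoint e) x := by
  simp only [normalField_apply, Finset.mul_sum]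
  rw [Finset.sum_comm]
  have : ∀ d, ∑ a, comp g e x b a * ((comp g e x)⁻¹ a d * pd d (Ω ∘ chartPoint e) x) =
      (if b = d then 1 else 0) * pd d (Ω ∘ chartPoint e) x := by
    intro d
    rw [← sum_comp_mul_inv hdet b d, Finset.sum_mul]
    exact Finset.sum_congr rfl fun a _ => by ring
  rw [Finset.sum_congr rfl fun d _ => this d]
  simp

lemma sum_comp_mul_normalField_mul (hg : IsLorentzMetricOn k g univ)
    (hdet : (comp g e x).det ≠ 0) (v : E4) :
    ∑ a, ∑ b, comp g e x a b * normalField g Ω e x a * v b =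
      ∑ b, v b * pd b (Ω ∘ chartPoint e) x := by
  rw [Finset.sum_comm]
  refine Finset.sum_congr rfl fun b _ => ?_
  rw [← sum_comp_mul_normalField hdet b, Finset.mul_sum]
  refine Finset.sum_congr rfl fun a _ => ?_
  rw [comp_symm hg trivial a b]
  ring

/-- The coordinate vector satisfies the condition defining `normal`, so the choice in that
definition is not a default value; nondegeneracy then makes it unique. -/
lemma coordMap_normalField (hk : 2 ≤ k) (hM : IsAsymptoticallySimple k gt g Ω)
    (he : e ∈ Charts M k) (hx : x ∈ chartTarget e) :
    coordMap e x (normalField g Ω e x) = normal g Ω (chartPoint e x) := by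
  have hg := hM.unphysicalMetric
  have hdet := det_comp_ne_zero hg he hx trivial
  have h1 : ∀ w, g (chartPoint e x) (coordMap e x (normalField g Ω e x)) w =
      mfderiv (𝓡∂ 4) 𝓘(ℝ, ℝ) Ω (chartPoint e x) w := by
    intro w
    obtain ⟨w, rfl⟩ := coordMap_surjective he hx w
    rw [apply_coordMap, mfderiv_factor_coordMap hk hM.contMDiff he hx,
      sum_comp_mul_normalField_mul hg hdet]
  have h2 : ∀ w, g (chartPoint e x) (normal g Ω (chartPoint e x)) w =
      mfderiv (𝓡∂ 4) 𝓘(ℝ, ℝ) Ω (chartPoint e x) w :=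
    Classical.epsilon_spec (p := fun v : TangentSpace (𝓡∂ 4) (chartPoint e x) =>
      ∀ w : TangentSpace (𝓡∂ 4) (chartPoint e x), g (chartPoint e x) v w =
        mfderiv (𝓡∂ 4) 𝓘(ℝ, ℝ) Ω (chartPoint e x) w) ⟨_, h1⟩
  rw [← sub_eq_zero]
  refine hg.nondegenerate trivial _ fun w => ?_
  rw [hg.symm trivial, map_sub, sub_apply]
  exact sub_eq_zero.2 ((h1 w).trans (h2 w).symm)

/-- The Lie derivative of the metric along the normal is twice its Hessian. -/
lemma lie_derivative_normalField (hk : 2 ≤ k) (hM : IsAsymptoticallySimple k gt g Ω)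
    (he : e ∈ Charts M k) (hx : x ∈ chartTarget e) (a b : Fin 4) :
    ∑ c, normalField g Ω e x c * pd c (fun y => comp g e y a b) x
      + ∑ d, comp g e x d b * pd a (fun y => normalField g Ω e y d) x
      + ∑ d, comp g e x a d * pd b (fun y => normalField g Ω e y d) x =
    hessian g Ω e a b x + hessian g Ω e b a x := by
  have hx' := chartTarget_subset_halfSpace hx
  have hg := hM.unphysicalMetric
  have hk0 : (k : ℕ∞ω) ≠ 0 := (zero_lt_one.trans_le (le_add_self.trans (two_le_cast hk))).ne'
  have hG : ∀ a b, DifferentiableWithinAt ℝ (fun y => comp g e y a b) halfSpace x := fun a b =>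
    (contDiffWithinAt_comp hg he isOpen_univ hx trivial a b).differentiableWithinAt hk0
  have hN : ∀ d, DifferentiableWithinAt ℝ (fun y => normalField g Ω e y d) halfSpace x := fun d =>
    (contDiffWithinAt_piLp (p := 2) |>.1 (contDiffWithinAt_normalField hk hM he hx)
      d).differentiableWithinAt one_ne_zero
  have hsymm : ∀ a b c, pd c (fun y => comp g e y a b) x = pd c (fun y => comp g e y b a) x :=
    fun a b c => congrArg (fun F => pd c F x) (funext fun y => comp_symm hg trivial a b)
  -- Derivative of `∂_b Ω = g_bd Nᵈ`. It trades second derivatives of `Ω` for first derivatives of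
  -- the metric and of the normal.
  have h1 : ∀ c b, pd c (pd b (Ω ∘ chartPoint e)) x = ∑ d, (pd c (fun y => comp g e y b d) x *
      normalField g Ω e x d + comp g e x b d * pd c (fun y => normalField g Ω e y d) x) := by
    intro c b
    have : pd c (pd b (Ω ∘ chartPoint e)) x =
        pd c (fun y => ∑ d, comp g e y b d * normalField g Ω e y d) x := by
      refine pd_congr c ?_ hx'
      filter_upwards [chartTarget_mem_nhdsWithin hx] with y hy
      exact (sum_comp_mul_normalField (det_comp_ne_zero hg he hy trivial) b).symm
    have hGN : ∀ d, DifferentiableWithinAt ℝ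
        (fun y => comp g e y b d * normalField g Ω e y d) halfSpace x := fun d =>
      (hG b d).mul (hN d)
    rw [this, pd_sum _ c hx' fun d _ => hGN d]
    exact Finset.sum_congr rfl fun d _ => pd_mul c hx' (hG b d) (hN d)
  have hinv : ∀ c d, (comp g e x)⁻¹ c d = (comp g e x)⁻¹ d c := by
    intro c d
    have h : (comp g e x).transpose = comp g e x := by
      ext a b
      exact comp_symm hg trivial b a
    conv_lhs => rw [← h, ← Matrix.transpose_nonsing_inv, Matrix.transpose_apply]
  have h2 : ∀ a b, ∑ c, christoffel g e c a b x * pd c (Ω ∘ chartPoint e) x =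
      (1 / 2 : ℝ) * ∑ d, normalField g Ω e x d * (pd a (fun y => comp g e y d b) x
        + pd b (fun y => comp g e y d a) x - pd d (fun y => comp g e y a b) x) := by
    intro a b
    simp only [christoffel, normalField_apply, Finset.mul_sum, Finset.sum_mul]
    rw [Finset.sum_comm]
    refine Finset.sum_congr rfl fun c _ => Finset.sum_congr rfl fun d _ => ?_
    rw [hinv d c]
    ring
  simp only [hessian, h1, h2, Finset.mul_sum]
  simp only [← Finset.sum_add_distrib, ← Finset.sum_sub_distrib]
  refine Finset.sum_congr rfl fun d _ => ?_
  rw [hsymm b d a, hsymm a d b, hsymm b a d, comp_symm hg trivial d b]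
  ring

lemma chartPoint_mem_scri (k : ℕ∞) [IsManifold (𝓡∂ 4) ((k : ℕ∞ω) + 1) M]
    (hea : e ∈ atlas (EuclideanHalfSpace 4) M) (hx : x ∈ chartTarget e)
    (h0 : x 0 = 0) : chartPoint e x ∈ scri M := by
  rw [scri, ← ModelWithCorners.compl_interior]
  intro hp
  have h1 := ((𝓡∂ 4).isInteriorPoint_iff_of_mem_atlas (n := (k : ℕ∞ω) + 1) (by simp) hea
    (chartPoint_mem_source hx)).1 hp
  rw [extend_chartPoint hx] at h1
  have h2 := interior_mono e.extend_target_subset_range h1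
  rw [interior_range_modelWithCornersEuclideanHalfSpace] at h2
  exact h2.ne' h0

variable [IsManifold (𝓡∂ 4) ((k : ℕ∞ω) + 1) M]

/-- Lines in the directions `b ≠ 0` stay in the boundary hyperplane, where `Ω` vanishes identically
near `x`. So `dΩ` has only its component along `dx⁰`. -/
lemma pd_factor_eq_zero (hk : 2 ≤ k) (hM : IsAsymptoticallySimple k gt g Ω)
    (he : e ∈ Charts M k) (hea : e ∈ atlas (EuclideanHalfSpace 4) M) (hx : x ∈ chartTarget e)
    (h0 : x 0 = 0) {b : Fin 4} (hb : b ≠ 0) : pd b (Ω ∘ chartPoint e) x = 0 := by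
  have hk0 : (k : ℕ∞ω) ≠ 0 := (zero_lt_one.trans_le (le_add_self.trans (two_le_cast hk))).ne'
  have hΩd : HasFDerivWithinAt (Ω ∘ chartPoint e)
      (fderivWithin ℝ (Ω ∘ chartPoint e) halfSpace x) halfSpace x :=
    ((contDiffWithinAt_factor hM.contMDiff he hx).differentiableWithinAt hk0).hasFDerivWithinAt
  let ℓ : ℝ → E4 := fun t => x + t • EuclideanSpace.single b 1
  have hℓ0 : ℓ 0 = x := by simp [ℓ]
  have hℓ : HasDerivAt ℓ (EuclideanSpace.single b 1) 0 := by
    have := ((hasDerivAt_id (0 : ℝ)).smul_const (EuclideanSpace.single b (1 : ℝ) : E4)).const_add x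
    rwa [one_smul] at this
  have hℓz : ∀ t, ℓ t 0 = 0 := fun t => by simp [ℓ, h0, hb]
  have hmaps : ∀ t, ℓ t ∈ halfSpace := fun t => mem_halfSpace.2 (hℓz t).ge
  have h1 : HasDerivAt ((Ω ∘ chartPoint e) ∘ ℓ) (pd b (Ω ∘ chartPoint e) x) 0 := by
    rw [← hℓ0] at hΩd
    have := hΩd.comp_hasDerivAt (0 : ℝ) hℓ (Eventually.of_forall hmaps)
    rwa [hℓ0] at this
  have h2 : (Ω ∘ chartPoint e) ∘ ℓ =ᶠ[𝓝 0] fun _ => 0 := by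
    have hV : boundaryProj ⁻¹' chartTarget e ∈ 𝓝 (ℓ 0) := by
      rw [hℓ0]
      refine (isOpen_preimage_chartTarget e).mem_nhds ?_
      rwa [mem_preimage, boundaryProj_of_coord_zero h0]
    filter_upwards [hℓ.continuousAt.eventually hV] with t ht
    rw [boundaryProj_of_coord_zero (hℓz t)] at ht
    exact hM.zero _ (chartPoint_mem_scri k hea ht (hℓz t))
  exact h1.unique ((hasDerivAt_const (0 : ℝ) (0 : ℝ)).congr_of_eventuallyEq h2)

lemma pd_zero_factor_ne_zero (hk : 2 ≤ k) (hM : IsAsymptoticallySimple k gt g Ω)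
    (he : e ∈ Charts M k) (hea : e ∈ atlas (EuclideanHalfSpace 4) M) (hx : x ∈ chartTarget e)
    (h0 : x 0 = 0) : pd 0 (Ω ∘ chartPoint e) x ≠ 0 := by
  intro h
  refine hM.gradient_ne_zero _ (chartPoint_mem_scri k hea hx h0) ?_
  ext v
  obtain ⟨v, rfl⟩ := coordMap_surjective he hx v
  rw [mfderiv_factor_coordMap hk hM.contMDiff he hx]
  refine Finset.sum_eq_zero fun a _ => ?_
  by_cases ha : a = 0
  · rw [ha, h, mul_zero]; rfl
  · rw [pd_factor_eq_zero hk hM he hea hx h0 ha, mul_zero]; rfl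

/-- The normal is orthogonal to the boundary hyperplane. -/
lemma sum_normalField_tangent (hk : 2 ≤ k) (hM : IsAsymptoticallySimple k gt g Ω)
    (he : e ∈ Charts M k) (hea : e ∈ atlas (EuclideanHalfSpace 4) M) (hx : x ∈ chartTarget e)
    (h0 : x 0 = 0) {v : E4} (hv : v 0 = 0) :
    ∑ a, ∑ b, comp g e x a b * normalField g Ω e x a * v b = 0 := by
  have hg := hM.unphysicalMetric
  rw [sum_comp_mul_normalField_mul hg (det_comp_ne_zero hg he hx trivial)]
  refine Finset.sum_eq_zero fun b _ => ?_
  by_cases hb : b = 0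
  · rw [hb, hv, zero_mul]
  · rw [pd_factor_eq_zero hk hM he hea hx h0 hb, mul_zero]

/-- The normal of a null hypersurface is tangent to it. -/
lemma normalField_apply_zero (hk : 2 ≤ k) (hM : IsAsymptoticallySimple k gt g Ω)
    (hnull : IsNullHypersurface g Ω)
    (he : e ∈ Charts M k) (hea : e ∈ atlas (EuclideanHalfSpace 4) M) (hx : x ∈ chartTarget e)
    (h0 : x 0 = 0) : normalField g Ω e x 0 = 0 := by
  have hg := hM.unphysicalMetric
  have h1 := hnull _ (chartPoint_mem_scri k hea hx h0)
  rw [← coordMap_normalField hk hM he hx, apply_coordMap,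
    sum_comp_mul_normalField_mul hg (det_comp_ne_zero hg he hx trivial),
    Finset.sum_eq_single 0] at h1
  · exact (mul_eq_zero.1 h1).resolve_right (pd_zero_factor_ne_zero hk hM he hea hx h0)
  · intro b _ hb
    rw [pd_factor_eq_zero hk hM he hea hx h0 hb, mul_zero]
  · simp

lemma normalField_ne_zero (hk : 2 ≤ k) (hM : IsAsymptoticallySimple k gt g Ω)
    (he : e ∈ Charts M k) (hea : e ∈ atlas (EuclideanHalfSpace 4) M) (hx : x ∈ chartTarget e)
    (h0 : x 0 = 0) : normalField g Ω e x ≠ 0 := by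
  intro h
  refine pd_zero_factor_ne_zero hk hM he hea hx h0 ?_
  rw [← sum_comp_mul_normalField (det_comp_ne_zero hM.unphysicalMetric he hx trivial), h]
  simp

end NormalField

lemma eq_of_hasDerivWithinAt_zero {E : Type*} [NormedAddCommGroup E] [NormedSpace ℝ E] {F : ℝ → E}
    (hF : ∀ r ∈ Icc (0 : ℝ) 1, HasDerivWithinAt F 0 (Icc 0 1) r) {r : ℝ}
    (hr : r ∈ Icc (0 : ℝ) 1) : F r = F 0 :=
  constant_of_has_deriv_right_zero (fun r hr => (hF r hr).continuousWithinAt)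
    (fun r hr => (hF r (Ico_subset_Icc_self hr)).mono_of_mem_nhdsWithin
      (mem_of_superset (Ico_mem_nhdsGE_of_mem hr) Ico_subset_Icc_self)) r hr

/-- Solutions of `φ' = Λ φ` on `[0, 1]`. -/
lemma exists_pos_factor {Λ : ℝ → ℝ} (hΛ : ContinuousOn Λ (Icc 0 1)) :
    ∃ K > 0, ∀ φ : ℝ → ℝ,
      (∀ r ∈ Icc (0 : ℝ) 1, HasDerivWithinAt φ (Λ r * φ r) (Icc 0 1) r) → φ 1 = K * φ 0 := by
  -- The factor is `exp ∫ Λ`. It does not depend on the solution, which is why one conformal factor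
  -- will serve all pairs of vectors.
  let L : ℝ → ℝ := fun r => ∫ s in (0 : ℝ)..r, IccExtend zero_le_one ((Icc 0 1).domRestrict Λ) s
  have hc : Continuous (IccExtend zero_le_one ((Icc (0 : ℝ) 1).domRestrict Λ)) :=
    (continuousOn_iff_continuous_domRestrict.1 hΛ).Icc_extend'
  have hL : ∀ r ∈ Icc (0 : ℝ) 1, HasDerivAt L (Λ r) r := by
    intro r hr
    have h := intervalIntegral.integral_hasDerivAt_right (hc.intervalIntegrable 0 r)
      (hc.stronglyMeasurableAtFilter _ _) hc.continuousAt
    rwa [IccExtend_of_mem _ _ hr] at h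
  refine ⟨Real.exp (L 1), Real.exp_pos _, fun φ hφ => ?_⟩
  have h1 : ∀ r ∈ Icc (0 : ℝ) 1,
      HasDerivWithinAt (fun r => φ r * Real.exp (-L r)) 0 (Icc 0 1) r := by
    intro r hr
    have h2 := (hφ r hr).mul ((hL r hr).neg.exp.hasDerivWithinAt (s := Icc 0 1))
    refine h2.congr_deriv ?_
    ring
  have h2 := eq_of_hasDerivWithinAt_zero h1 (right_mem_Icc.2 zero_le_one)
  have hL0 : L 0 = 0 := by simp [L]
  simp only [hL0, neg_zero, Real.exp_zero, mul_one] at h2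
  rw [← h2, mul_comm, mul_assoc, ← Real.exp_add, neg_add_cancel, Real.exp_zero, mul_one]

/-- The product rule for `G(V, W)` along the flow: if the Lie derivative of `G` along `N` is `μ G`,
and `V`, `W` satisfy the variational equation with time factor `T`, then the derivative of `G(V, W)`
is `T μ G(V, W)`. -/
lemma sum_lie_derivative (G : Fin 4 → Fin 4 → ℝ) (dG : Fin 4 → Fin 4 → Fin 4 → ℝ)
    (dN : Fin 4 → Fin 4 → ℝ) (N V W : Fin 4 → ℝ) (T μ : ℝ)
    (h : ∀ a b, ∑ c, N c * dG c a b + ∑ d, G d b * dN a d + ∑ d, G a d * dN b d = μ * G a b) :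
    ∑ a, ∑ b, ((T * ∑ d, N d * dG d a b) * V a + G a b * (T * ∑ d, V d * dN d a)) * W b
      + ∑ a, ∑ b, G a b * V a * (T * ∑ d, W d * dN d b) =
    T * μ * ∑ a, ∑ b, G a b * V a * W b := by
  have h2 : ∑ a, ∑ b, G a b * (∑ d, V d * dN d a) * W b =
      ∑ a, ∑ b, (∑ d, G d b * dN a d) * V a * W b := by
    rw [Finset.sum_comm]
    conv_rhs => rw [Finset.sum_comm]
    refine Finset.sum_congr rfl fun b _ => ?_
    simp only [Finset.mul_sum, Finset.sum_mul]
    rw [Finset.sum_comm]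
    exact Finset.sum_congr rfl fun a _ => Finset.sum_congr rfl fun d _ => by ring
  have h3 : ∑ a, ∑ b, G a b * V a * (∑ d, W d * dN d b) =
      ∑ a, ∑ b, (∑ d, G a d * dN b d) * V a * W b := by
    refine Finset.sum_congr rfl fun a _ => ?_
    simp only [Finset.mul_sum, Finset.sum_mul]
    rw [Finset.sum_comm]
    exact Finset.sum_congr rfl fun b _ => Finset.sum_congr rfl fun d _ => by ring
  have h4 : T * μ * ∑ a, ∑ b, G a b * V a * W b =
      T * (∑ a, ∑ b, (∑ c, N c * dG c a b) * V a * W b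
        + ∑ a, ∑ b, (∑ d, G d b * dN a d) * V a * W b
        + ∑ a, ∑ b, (∑ d, G a d * dN b d) * V a * W b) := by
    rw [mul_assoc, Finset.mul_sum]
    simp only [← Finset.sum_add_distrib]
    congr 1
    refine Finset.sum_congr rfl fun a _ => ?_
    rw [Finset.mul_sum]
    refine Finset.sum_congr rfl fun b _ => ?_
    linear_combination -(V a * W b) * h a b
  rw [h4, ← h2, ← h3, mul_add, mul_add]
  simp only [Finset.mul_sum, Finset.sum_mul, ← Finset.sum_add_distrib]
  refine Finset.sum_congr rfl fun a _ => Finset.sum_congr rfl fun b _ => ?_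
  simp only [add_mul]
  refine Finset.sum_congr rfl fun d _ => ?_
  ring

/-! ### Flows tangent to the boundary hyperplane -/

section HyperplaneFlow

variable {f : E4 → E4} {V : Set E4} {c : E4 × ℝ → ℝ → E4} {p : E4 × ℝ}

lemma IsFlowAt.coord_zero (h : IsFlowAt f V c p) (hf0 : ∀ y ∈ V, f y 0 = 0) (h0 : p.1 0 = 0)
    {r : ℝ} (hr : r ∈ Icc (0 : ℝ) 1) : c p r 0 = 0 := by
  have h1 : ∀ r ∈ Icc (0 : ℝ) 1, HasDerivWithinAt (fun r => c p r 0) 0 (Icc 0 1) r := by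
    intro r hr
    have h2 := (EuclideanSpace.proj (𝕜 := ℝ) (0 : Fin 4)).hasFDerivAt.comp_hasDerivWithinAt r
      (h.hasDeriv r hr)
    refine h2.congr_deriv ?_
    simp [hf0 _ (h.mem r hr)]
  rw [eq_of_hasDerivWithinAt_zero h1 hr, h.zero, h0]

lemma IsFlowAt.variation_coord_zero (h : IsFlowAt f V c p) (hV : IsOpen V)
    (hf : ContDiffOn ℝ 1 f V) (hf0 : ∀ y ∈ V, f y 0 = 0) {v : E4 × ℝ} (hv : v.1 0 = 0)
    {r : ℝ} (hr : r ∈ Icc (0 : ℝ) 1) : fderiv ℝ (fun q => c q r) p v 0 = 0 := by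
  have hD : ∀ y ∈ V, ∀ w, fderiv ℝ f y w 0 = 0 := by
    intro y hy w
    have h1 := (EuclideanSpace.proj (𝕜 := ℝ) (0 : Fin 4)).hasFDerivAt.comp y
      ((hf.contDiffAt (hV.mem_nhds hy)).differentiableAt one_ne_zero).hasFDerivAt
    have h2 : HasFDerivAt (EuclideanSpace.proj (𝕜 := ℝ) (0 : Fin 4) ∘ f) (0 : E4 →L[ℝ] ℝ) y :=
      (hasFDerivAt_const (0 : ℝ) y).congr_of_eventuallyEq
        (eventually_of_mem (hV.mem_nhds hy) fun z hz => hf0 z hz)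
    exact congrArg (fun L : E4 →L[ℝ] ℝ => L w) (h1.unique h2)
  have h1 : ∀ r ∈ Icc (0 : ℝ) 1,
      HasDerivWithinAt (fun r => fderiv ℝ (fun q => c q r) p v 0) 0 (Icc 0 1) r := by
    intro r hr
    have h2 := (EuclideanSpace.proj (𝕜 := ℝ) (0 : Fin 4)).hasFDerivAt.comp_hasDerivWithinAt r
      (h.variation v r hr)
    refine h2.congr_deriv ?_
    simp [hf0 _ (h.mem r hr), hD _ (h.mem r hr)]
  rw [eq_of_hasDerivWithinAt_zero h1 hr, h.variation_zero, hv]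

end HyperplaneFlow

/-! ### The flow of the normal acts conformally on null infinity -/

section BoundaryFlow

variable {M : Type*} [TopologicalSpace M] [ChartedSpace (EuclideanHalfSpace 4) M]
  {k : ℕ∞} {e : OpenPartialHomeomorph M (EuclideanHalfSpace 4)} {x : E4}
  {gt g : Tensor2 M} {Ω : M → ℝ}

/-- The normal in the chart `e`, extended from the boundary hyperplane to `ℝ⁴` independently of
the coordinate `x₀`. -/
def boundaryField (g : Tensor2 M) (Ω : M → ℝ)
    (e : OpenPartialHomeomorph M (EuclideanHalfSpace 4)) (x : E4) : E4 :=
  normalField g Ω e (boundaryProj x)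

lemma boundaryField_of_coord_zero (h0 : x 0 = 0) : boundaryField g Ω e x = normalField g Ω e x := by
  rw [boundaryField, boundaryProj_of_coord_zero h0]

lemma contDiffOn_boundaryField (hk : 2 ≤ k) (hM : IsAsymptoticallySimple k gt g Ω)
    (he : e ∈ Charts M k) :
    ContDiffOn ℝ 1 (boundaryField g Ω e) (boundaryProj ⁻¹' chartTarget e) := by
  intro x hx
  exact (contDiffWithinAt_normalField hk hM he hx).comp x
    boundaryProj.contDiff.contDiffAt.contDiffWithinAt fun y _ => boundaryProj_mem_halfSpace y

/-- The extension constant in `x₀` has a two-sided derivative on an open subset of `ℝ⁴`, so ordinary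
flow theory applies. In tangential directions this derivative is the one-sided derivative of the
actual normal. -/
lemma fderiv_boundaryField_apply (hk : 2 ≤ k) (hM : IsAsymptoticallySimple k gt g Ω)
    (he : e ∈ Charts M k) (hx : x ∈ chartTarget e) (h0 : x 0 = 0) {v : E4} (hv : v 0 = 0)
    (a : Fin 4) :
    fderiv ℝ (boundaryField g Ω e) x v a =
      ∑ c, v c * pd c (fun y => normalField g Ω e y a) x := by
  have hN := ((contDiffWithinAt_normalField hk hM he hx).differentiableWithinAt
    one_ne_zero).hasFDerivWithinAt
  have hx' := chartTarget_subset_halfSpace hx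
  have h1 : HasFDerivAt (boundaryField g Ω e)
      ((fderivWithin ℝ (normalField g Ω e) halfSpace x).comp boundaryProj) x := by
    rw [← boundaryProj_of_coord_zero h0] at hN
    have := hN.comp_hasFDerivAt x boundaryProj.hasFDerivAt
      (Eventually.of_forall fun y => boundaryProj_mem_halfSpace y)
    rwa [boundaryProj_of_coord_zero h0] at this
  rw [h1.fderiv, ← fderivWithin_eq_sum_pd]
  have h2 := (EuclideanSpace.proj (𝕜 := ℝ) a).hasFDerivAt.comp_hasFDerivWithinAt x hN
  have h3 := h2.fderivWithin (uniqueDiffOn_halfSpace x hx')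
  have h4 := congrArg (fun L : E4 →L[ℝ] ℝ => L v) h3
  simp only [ContinuousLinearMap.comp_apply, boundaryProj_of_coord_zero hv] at h4 ⊢
  exact h4.symm

variable [IsManifold (𝓡∂ 4) ((k : ℕ∞ω) + 1) M]

lemma boundaryField_apply_zero (hk : 2 ≤ k) (hM : IsAsymptoticallySimple k gt g Ω)
    (hnull : IsNullHypersurface g Ω) (he : e ∈ Charts M k)
    (hea : e ∈ atlas (EuclideanHalfSpace 4) M) (hx : x ∈ boundaryProj ⁻¹' chartTarget e) :
    boundaryField g Ω e x 0 = 0 :=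
  normalField_apply_zero hk hM hnull he hea hx (boundaryProj_apply_zero x)

/-- The flow along null infinity is conformal for vectors tangent to null infinity. -/
lemma IsFlowAt.conformal (hk : 2 ≤ k) (hM : IsAsymptoticallyEmptyAndSimple k gt g Ω)
    (hnull : IsNullHypersurface g Ω) (he : e ∈ Charts M k)
    (hea : e ∈ atlas (EuclideanHalfSpace 4) M) {c : E4 × ℝ → ℝ → E4} {p : E4 × ℝ}
    (h : IsFlowAt (boundaryField g Ω e) (boundaryProj ⁻¹' chartTarget e) c p)
    (h0 : p.1 0 = 0) :
    ∃ K > 0, ∀ v w : E4, v 0 = 0 → w 0 = 0 →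
      g (chartPoint e (c p 1)) (coordMap e (c p 1) (fderiv ℝ (fun q => c q 1) p (v, 0)))
        (coordMap e (c p 1) (fderiv ℝ (fun q => c q 1) p (w, 0))) =
      K * g (chartPoint e p.1) (coordMap e p.1 v) (coordMap e p.1 w) := by
  have hS := hM.toIsAsymptoticallySimple
  have hg := hS.unphysicalMetric
  have hk0 : (k : ℕ∞ω) ≠ 0 := (zero_lt_one.trans_le (le_add_self.trans (two_le_cast hk))).ne'
  have hf0 : ∀ y ∈ boundaryProj ⁻¹' chartTarget e, boundaryField g Ω e y 0 = 0 :=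
    fun y hy => boundaryField_apply_zero hk hS hnull he hea hy
  have hc0 : ∀ r ∈ Icc (0 : ℝ) 1, c p r 0 = 0 := fun r hr => h.coord_zero hf0 h0 hr
  have hct : ∀ r ∈ Icc (0 : ℝ) 1, c p r ∈ chartTarget e := fun r hr => by
    have := h.mem r hr
    rwa [mem_preimage, boundaryProj_of_coord_zero (hc0 r hr)] at this
  have hmaps : MapsTo (c p) (Icc 0 1) halfSpace := fun r hr => chartTarget_subset_halfSpace (hct r hr)
  have hcont : ContinuousOn (c p) (Icc 0 1) := fun r hr => (h.hasDeriv r hr).continuousWithinAt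
  have hΛ : ContinuousOn (fun r => p.2 * (2 * hessianTrace g Ω e (c p r))) (Icc 0 1) := by
    intro r hr
    refine continuousWithinAt_const.mul (continuousWithinAt_const.mul ?_)
    exact (continuousWithinAt_hessianTrace hk hS he (hct r hr)).comp (hcont r hr) hmaps
  obtain ⟨K, hK, hφ⟩ := exists_pos_factor hΛ
  refine ⟨K, hK, fun v w hv hw => ?_⟩
  simp only [apply_coordMap]
  let Y : E4 → ℝ → E4 := fun v r => fderiv ℝ (fun q => c q r) p (v, 0)
  have hY0 : ∀ v, Y v 0 = v := fun v => h.variation_zero (v, 0)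
  have hYz : ∀ v : E4, v 0 = 0 → ∀ r ∈ Icc (0 : ℝ) 1, Y v r 0 = 0 := fun v hv r hr =>
    h.variation_coord_zero (isOpen_preimage_chartTarget e) (contDiffOn_boundaryField hk hS he) hf0
      hv hr
  have hYd : ∀ v : E4, v 0 = 0 → ∀ a, ∀ r ∈ Icc (0 : ℝ) 1,
      HasDerivWithinAt (fun r => Y v r a)
        (p.2 * ∑ d, Y v r d * pd d (fun y => normalField g Ω e y a) (c p r)) (Icc 0 1) r := by
    intro v hv a r hr
    have h1 := (EuclideanSpace.proj (𝕜 := ℝ) a).hasFDerivAt.comp_hasDerivWithinAt r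
      (h.variation (v, 0) r hr)
    refine h1.congr_deriv ?_
    rw [← fderiv_boundaryField_apply hk hS he (hct r hr) (hc0 r hr) (hYz v hv r hr)]
    simp [Y]
  have hGd : ∀ a b, ∀ r ∈ Icc (0 : ℝ) 1, HasDerivWithinAt (fun r => comp g e (c p r) a b)
      (p.2 * ∑ d, normalField g Ω e (c p r) d * pd d (fun y => comp g e y a b) (c p r))
      (Icc 0 1) r := by
    intro a b r hr
    have hG := ((contDiffWithinAt_comp hg he isOpen_univ (hct r hr) trivial
      a b).differentiableWithinAt hk0).hasFDerivWithinAt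
    have h1 := hG.comp_hasDerivWithinAt r (h.hasDeriv r hr) hmaps
    refine h1.congr_deriv ?_
    rw [map_smul, smul_eq_mul, boundaryField_of_coord_zero (hc0 r hr), fderivWithin_eq_sum_pd]
  -- The product of the two transported vectors solves `φ' = Λ φ`, because the Lie derivative of the
  -- metric along the normal is twice the Hessian, which is pure trace on null infinity.
  have key := hφ (fun r => ∑ a, ∑ b, comp g e (c p r) a b * Y v r a * Y w r b) ?_
  · simp only [hY0, h.zero] at key
    exact key
  · intro r hr
    have h1 := HasDerivWithinAt.fun_sum (u := Finset.univ) fun a _ =>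
      HasDerivWithinAt.fun_sum (u := Finset.univ) fun b _ =>
        ((hGd a b r hr).fun_mul (hYd v hv a r hr)).fun_mul (hYd w hw b r hr)
    refine h1.congr_deriv ?_
    simp only [Finset.sum_add_distrib]
    refine Eq.trans ?_ (sum_lie_derivative (fun a b => comp g e (c p r) a b) (fun d a b => pd d (fun y => comp g e y a b) (c p r))
      (fun d a => pd d (fun y => normalField g Ω e y a) (c p r)) (normalField g Ω e (c p r))
      (Y v r) (Y w r) p.2 (2 * hessianTrace g Ω e (c p r)) fun a b => ?_)
    · simp only [← Finset.sum_add_distrib]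
    rw [lie_derivative_normalField hk hS he (hct r hr) a b,
      hessian_eq_trace_mul_comp hk hM he (hct r hr) (chartPoint_mem_scri k hea (hct r hr) (hc0 r hr)),
      hessian_eq_trace_mul_comp hk hM he (hct r hr) (chartPoint_mem_scri k hea (hct r hr) (hc0 r hr)),
      comp_symm hg trivial b a]
    ring

end BoundaryFlow

/-! ### Segments of generators -/

section Generators

variable {M : Type*} [TopologicalSpace M] [ChartedSpace (EuclideanHalfSpace 4) M]
  {k : ℕ∞} {e : OpenPartialHomeomorph M (EuclideanHalfSpace 4)} {x : E4}
  {gt g : Tensor2 M} {Ω : M → ℝ} {p q r : M}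

lemma _root_.IsMIntegralCurveOn.congr {X : ∀ p : M, TangentSpace (𝓡∂ 4) p} {γ₁ γ₂ : ℝ → M}
    {s : Set ℝ} (h₁ : IsMIntegralCurveOn γ₁ X s) (h : EqOn γ₂ γ₁ s) :
    IsMIntegralCurveOn γ₂ X s := by
  intro t ht
  refine ((h₁ t ht).congr_of_eventuallyEq (eventually_of_mem self_mem_nhdsWithin h)
    (h ht)).congr_mfderiv ?_
  have : ∀ p q : M, p = q → (X p : E4) = X q := fun p q hpq => by rw [hpq]
  exact congrArg (fun v : E4 => (1 : ℝ →L[ℝ] ℝ).smulRight v) (this _ _ (h ht).symm)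

lemma _root_.IsMIntegralCurveOn.piecewise {X : ∀ p : M, TangentSpace (𝓡∂ 4) p} {γ₁ γ₂ : ℝ → M}
    {a b c : ℝ} (h₁ : IsMIntegralCurveOn γ₁ X (Icc a b)) (h₂ : IsMIntegralCurveOn γ₂ X (Icc b c))
    (hab : a ≤ b) (hbc : b ≤ c) (h : γ₁ b = γ₂ b) :
    IsMIntegralCurveOn (fun t => if t ≤ b then γ₁ t else γ₂ t) X (Icc a c) := by
  have e₁ : ∀ t ≤ b, (if t ≤ b then γ₁ t else γ₂ t) = γ₁ t := fun t ht => if_pos ht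
  have e₂ : ∀ t, b ≤ t → (if t ≤ b then γ₁ t else γ₂ t) = γ₂ t := by
    intro t ht
    split_ifs with h'
    · rw [le_antisymm h' ht, h]
    · rfl
  have d₁ : IsMIntegralCurveOn (fun t => if t ≤ b then γ₁ t else γ₂ t) X (Icc a b) := by
    exact h₁.congr fun t ht => e₁ t ht.2
  have d₂ : IsMIntegralCurveOn (fun t => if t ≤ b then γ₁ t else γ₂ t) X (Icc b c) := by
    exact h₂.congr fun t ht => e₂ t ht.1
  intro t ht
  rcases lt_trichotomy t b with hb | hb | hb
  · refine (d₁ t ⟨ht.1, hb.le⟩).mono_of_mem_nhdsWithin ?_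
    filter_upwards [self_mem_nhdsWithin, nhdsWithin_le_nhds (Iio_mem_nhds hb)] with s hs hs'
    exact ⟨hs.1, hs'.le⟩
  · rw [← Icc_union_Icc_eq_Icc hab hbc]
    exact (d₁ t ⟨ht.1, hb.le⟩).union (d₂ t ⟨hb.ge, ht.2⟩)
  · refine (d₂ t ⟨hb.le, ht.2⟩).mono_of_mem_nhdsWithin ?_
    filter_upwards [self_mem_nhdsWithin, nhdsWithin_le_nhds (Ioi_mem_nhds hb)] with s hs hs'
    exact ⟨hs'.le, hs.2⟩

/-- A segment of an integral curve of the normal, lying in null infinity, leads from `p` to `q`. -/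
def Flows (g : Tensor2 M) (Ω : M → ℝ) (p q : M) : Prop :=
  ∃ (γ : ℝ → M) (a b : ℝ), a ≤ b ∧ MapsTo γ (Icc a b) (scri M) ∧
    IsMIntegralCurveOn (I := 𝓡∂ 4) γ (normal g Ω) (Icc a b) ∧ γ a = p ∧ γ b = q

lemma sameGenerator_iff : SameGenerator g Ω p q ↔ Flows g Ω p q ∨ Flows g Ω q p := by
  constructor
  · rintro ⟨γ, a, b, hab, hm, hγ, h | h⟩
    · exact Or.inl ⟨γ, a, b, hab, hm, hγ, h⟩
    · exact Or.inr ⟨γ, a, b, hab, hm, hγ, h⟩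
  · rintro (⟨γ, a, b, hab, hm, hγ, h⟩ | ⟨γ, a, b, hab, hm, hγ, h⟩)
    · exact ⟨γ, a, b, hab, hm, hγ, Or.inl h⟩
    · exact ⟨γ, a, b, hab, hm, hγ, Or.inr h⟩

lemma SameGenerator.symm (h : SameGenerator g Ω p q) : SameGenerator g Ω q p :=
  sameGenerator_iff.2 (sameGenerator_iff.1 h).symm

lemma Flows.refl (hp : p ∈ scri M) : Flows g Ω p p := by
  refine ⟨fun _ => p, 0, 0, le_rfl, fun _ _ => hp, fun t ht => ?_, rfl, rfl⟩
  rw [Icc_self, mem_singleton_iff] at ht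
  subst ht
  rw [Icc_self]
  -- Within a single point every linear map is a derivative, so a one-point segment is an integral
  -- curve.
  exact ⟨continuousWithinAt_const, HasFDerivWithinAt.of_subsingleton (𝕜 := ℝ) (E := ℝ) (F := E4)
    (subsingleton_singleton.anti inter_subset_left)⟩

lemma Flows.trans (h₁ : Flows g Ω p q) (h₂ : Flows g Ω q r) : Flows g Ω p r := by
  obtain ⟨γ₁, a, b, hab, hm₁, hγ₁, rfl, rfl⟩ := h₁
  obtain ⟨γ₂, a', b', hab', hm₂, hγ₂, h, rfl⟩ := h₂
  have hs : {t | t + (a' - b) ∈ Icc a' b'} = Icc b (b' - a' + b) := by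
    ext t
    simp only [mem_ofPred_eq, mem_Icc]
    constructor <;> rintro ⟨h1, h2⟩ <;> constructor <;> linarith
  have hγ₂' := hγ₂.comp_add (a' - b)
  have hm₂' : MapsTo (γ₂ ∘ (· + (a' - b))) (Icc b (b' - a' + b)) (scri M) := fun t ht =>
    hm₂ (show t ∈ {t | t + (a' - b) ∈ Icc a' b'} by rwa [hs])
  rw [hs] at hγ₂'
  have hb : γ₁ b = (γ₂ ∘ (· + (a' - b))) b := by simp [h]
  refine ⟨_, a, b' - a' + b, by linarith, ?_, hγ₁.piecewise hγ₂' hab (by linarith) hb, if_pos hab, ?_⟩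
  · intro t ht
    dsimp only
    split_ifs with h'
    · exact hm₁ ⟨ht.1, h'⟩
    · exact hm₂' ⟨(not_le.1 h').le, ht.2⟩
  · split_ifs with h'
    · have : b' = a' := by linarith
      rw [show b' - a' + b = b by linarith, this, h]
    · simp

lemma hasDerivWithinAt_extend (hk : 2 ≤ k) (hM : IsAsymptoticallySimple k gt g Ω)
    (he : e ∈ Charts M k) {γ : ℝ → M} {s : Set ℝ}
    (hγ : IsMIntegralCurveOn γ (normal g Ω) s) {t : ℝ} (ht : t ∈ s) (hs : γ t ∈ e.source) :
    HasDerivWithinAt (fun t => e.extend (𝓡∂ 4) (γ t))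
      (normalField g Ω e (e.extend (𝓡∂ 4) (γ t))) s t := by
  have h1 := (mdifferentiableAt_extend he hs).hasMFDerivAt.comp_hasMFDerivWithinAt t (hγ t ht)
  have h2 : ∀ p ∈ e.source, mfderiv (𝓡∂ 4) 𝓘(ℝ, E4) (e.extend (𝓡∂ 4)) p (normal g Ω p) =
      normalField g Ω e (e.extend (𝓡∂ 4) p) := by
    intro p hp
    obtain ⟨x, hx, rfl⟩ : ∃ x ∈ chartTarget e, chartPoint e x = p :=
      ⟨_, extend_mem_chartTarget hp, chartPoint_extend hp⟩
    rw [extend_chartPoint hx, ← coordMap_normalField hk hM he hx]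
    exact mfderiv_extend_coordMap he hx _
  have h3 : HasFDerivWithinAt (fun t => e.extend (𝓡∂ 4) (γ t))
      ((1 : ℝ →L[ℝ] ℝ).smulRight (normalField g Ω e (e.extend (𝓡∂ 4) (γ t)))) s t := by
    refine (hasMFDerivWithinAt_iff_hasFDerivWithinAt.1 h1).congr_fderiv ?_
    ext1
    change (mfderiv (𝓡∂ 4) 𝓘(ℝ, E4) (e.extend (𝓡∂ 4)) (γ t)) ((1 : ℝ) • normal g Ω (γ t)) =
      (1 : ℝ) • normalField g Ω e (e.extend (𝓡∂ 4) (γ t))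
    rw [one_smul, one_smul, ← h2 _ hs]
  simpa using h3.hasDerivWithinAt

variable [IsManifold (𝓡∂ 4) ((k : ℕ∞ω) + 1) M]

lemma flows_of_hasDerivWithinAt (hk : 2 ≤ k) (hM : IsAsymptoticallySimple k gt g Ω)
    (he : e ∈ Charts M k) (hea : e ∈ atlas (EuclideanHalfSpace 4) M) {y : ℝ → E4} {T : ℝ}
    (hT : 0 ≤ T) (hy : ∀ r ∈ Icc (0 : ℝ) 1, y r ∈ chartTarget e ∧ y r 0 = 0 ∧
      HasDerivWithinAt y (T • normalField g Ω e (y r)) (Icc 0 1) r) :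
    Flows g Ω (chartPoint e (y 0)) (chartPoint e (y 1)) := by
  have hmem : ∀ r ∈ Icc (0 : ℝ) 1, chartPoint e (y r) ∈ scri M := fun r hr =>
    chartPoint_mem_scri k hea (hy r hr).1 (hy r hr).2.1
  rcases hT.eq_or_lt with rfl | hT
  · have : y 1 = y 0 := eq_of_hasDerivWithinAt_zero (fun r hr => by simpa using (hy r hr).2.2)
      (right_mem_Icc.2 zero_le_one)
    rw [this]
    exact Flows.refl (hmem 0 (left_mem_Icc.2 zero_le_one))
  have hmaps : MapsTo (fun t => t / T) (Icc 0 T) (Icc 0 1) := fun t ht =>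
    ⟨div_nonneg ht.1 hT.le, (div_le_one hT).2 ht.2⟩
  refine ⟨fun t => chartPoint e (y (t / T)), 0, T, hT.le, fun t ht => hmem _ (hmaps ht), ?_, by simp,
    by simp [hT.ne']⟩
  intro t ht
  obtain ⟨hyt, h0, hd⟩ := hy _ (hmaps ht)
  have h1 : HasDerivWithinAt (fun t => y (t / T)) (normalField g Ω e (y (t / T))) (Icc 0 T) t := by
    have h2 := hd.scomp t ((hasDerivWithinAt_id t (Icc 0 T)).div_const T) hmaps
    refine h2.congr_deriv ?_
    rw [smul_smul, one_div_mul_cancel hT.ne', one_smul]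
  have h2 := (mdifferentiableWithinAt_chartPoint he hyt).hasMFDerivWithinAt
  have h3 := HasMFDerivWithinAt.comp (u := halfSpace) t h2
    h1.hasFDerivWithinAt.hasMFDerivWithinAt
    (fun s hs => show y (s / T) ∈ halfSpace from chartTarget_subset_halfSpace (hy _ (hmaps hs)).1)
  refine h3.congr_mfderiv ?_
  ext
  change coordMap e (y (t / T)) ((1 : ℝ) • normalField g Ω e (y (t / T))) = (1 : ℝ) • _
  rw [one_smul, one_smul, coordMap_normalField hk hM he hyt]

/-- Translates the coordinate flow into segments of generators; for negative time the curve `r ↦ c p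
(1 - r)` is used, so that every segment runs in the direction of the normal. -/
lemma IsFlowAt.flows (hk : 2 ≤ k) (hM : IsAsymptoticallySimple k gt g Ω)
    (hnull : IsNullHypersurface g Ω) (he : e ∈ Charts M k)
    (hea : e ∈ atlas (EuclideanHalfSpace 4) M) {c : E4 × ℝ → ℝ → E4} {p : E4 × ℝ}
    (h : IsFlowAt (boundaryField g Ω e) (boundaryProj ⁻¹' chartTarget e) c p)
    (h0 : p.1 0 = 0) :
    c p 1 ∈ chartTarget e ∧ c p 1 0 = 0 ∧
      (0 ≤ p.2 → Flows g Ω (chartPoint e p.1) (chartPoint e (c p 1))) ∧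
      (p.2 ≤ 0 → Flows g Ω (chartPoint e (c p 1)) (chartPoint e p.1)) := by
  have hf0 : ∀ y ∈ boundaryProj ⁻¹' chartTarget e, boundaryField g Ω e y 0 = 0 :=
    fun y hy => boundaryField_apply_zero hk hM hnull he hea hy
  have hc0 : ∀ r ∈ Icc (0 : ℝ) 1, c p r 0 = 0 := fun r hr => h.coord_zero hf0 h0 hr
  have hct : ∀ r ∈ Icc (0 : ℝ) 1, c p r ∈ chartTarget e := fun r hr => by
    have := h.mem r hr
    rwa [mem_preimage, boundaryProj_of_coord_zero (hc0 r hr)] at this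
  have hd : ∀ r ∈ Icc (0 : ℝ) 1,
      HasDerivWithinAt (c p) (p.2 • normalField g Ω e (c p r)) (Icc 0 1) r := fun r hr => by
    rw [← boundaryField_of_coord_zero (hc0 r hr)]
    exact h.hasDeriv r hr
  have h1 : (1 : ℝ) ∈ Icc (0 : ℝ) 1 := right_mem_Icc.2 zero_le_one
  refine ⟨hct 1 h1, hc0 1 h1, fun hT => ?_, fun hT => ?_⟩
  · have := flows_of_hasDerivWithinAt hk hM he hea hT fun r hr => ⟨hct r hr, hc0 r hr, hd r hr⟩
    rwa [h.zero] at this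
  · have hmaps : MapsTo (fun r : ℝ => 1 - r) (Icc 0 1) (Icc 0 1) := fun r hr =>
      ⟨sub_nonneg.2 hr.2, sub_le_self _ hr.1⟩
    have := flows_of_hasDerivWithinAt (y := fun r => c p (1 - r)) hk hM he hea (neg_nonneg.2 hT)
      fun r hr => ⟨hct _ (hmaps hr), hc0 _ (hmaps hr), by
        have h2 := (hd _ (hmaps hr)).scomp r ((hasDerivWithinAt_id r (Icc 0 1)).const_sub 1) hmaps
        refine h2.congr_deriv ?_
        rw [smul_smul, neg_one_mul]⟩
    simpa [h.zero] using this

end Generators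

/-- A property that propagates locally to the right along `[a, b]` propagates globally. -/
lemma propagate_right {a b : ℝ} (hab : a ≤ b) {P : ℝ → Prop}
    (hP : ∀ t₀ ∈ Icc a b, ∃ U ∈ 𝓝 t₀, ∀ t ∈ U ∩ Icc a b, ∀ t' ∈ U ∩ Icc a b, t ≤ t' → P t → P t')
    (ha : P a) : P b := by
  choose! U hU hUP using hP
  obtain ⟨t, ht0, hmono, ⟨m, hm⟩, ht⟩ := exists_monotone_Icc_subset_open_cover_Icc hab
    (c := fun i : Icc a b => Subtype.val ⁻¹' interior (U i))
    (fun i => isOpen_interior.preimage continuous_subtype_val)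
    fun s _ => mem_iUnion.2 ⟨s, mem_interior_iff_mem_nhds.2 (hU s s.2)⟩
  have key : ∀ n, P (t n) := by
    intro n
    induction n with
    | zero => rwa [ht0]
    | succ n ih =>
      obtain ⟨i, hi⟩ := ht n
      have hle := hmono n.le_succ
      exact hUP i i.2 _ ⟨interior_subset (hi (left_mem_Icc.2 hle)), (t n).2⟩ _
        ⟨interior_subset (hi (right_mem_Icc.2 hle)), (t (n + 1)).2⟩ hle ih
  rw [← hm m le_rfl]
  exact key m

lemma exists_local_right_inverse {X Y : Type*} [NormedAddCommGroup X] [NormedSpace ℝ X]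
    [NormedAddCommGroup Y] [NormedSpace ℝ Y] [FiniteDimensional ℝ X] [FiniteDimensional ℝ Y]
    {f : X → Y} {a : X} (hf : ContDiffAt ℝ 1 f a) (hinj : ∀ v, fderiv ℝ f a v = 0 → v = 0)
    (hrank : Module.finrank ℝ X = Module.finrank ℝ Y) :
    ∃ h : Y → X, ContDiffAt ℝ 1 h (f a) ∧ h (f a) = a ∧ ∀ᶠ y in 𝓝 (f a), f (h y) = y := by
  have : CompleteSpace X := FiniteDimensional.complete ℝ X
  let L : X ≃L[ℝ] Y := (LinearEquiv.ofInjectiveOfFinrankEq (fderiv ℝ f a : X →ₗ[ℝ] Y)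
    ((injective_iff_map_eq_zero _).2 hinj) hrank).toContinuousLinearEquiv
  have hL : HasFDerivAt f (L : X →L[ℝ] Y) a := by
    refine (hf.differentiableAt one_ne_zero).hasFDerivAt.congr_fderiv ?_
    ext v
    rfl
  exact ⟨hf.localInverse hL one_ne_zero, hf.to_localInverse hL one_ne_zero,
    hf.localInverse_apply_image hL one_ne_zero,
    (hf.hasStrictFDerivAt' hL one_ne_zero).eventually_right_inverse⟩

/-! ### Flow time and a spacelike surface as coordinates of null infinity -/

section

variable {M : Type*} [TopologicalSpace M] [ChartedSpace (EuclideanHalfSpace 4) M]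
  {k : ℕ∞} {e : OpenPartialHomeomorph M (EuclideanHalfSpace 4)} {x : E4}
  {gt g : Tensor2 M} {Ω : M → ℝ} {p q r : M}

/-- `q` is reached from `p` by following the normal for a time of the same sign as `T`. -/
def FlowsDir (g : Tensor2 M) (Ω : M → ℝ) (T : ℝ) (p q : M) : Prop :=
  (0 ≤ T → Flows g Ω p q) ∧ (T ≤ 0 → Flows g Ω q p)

lemma FlowsDir.symm {T : ℝ} (h : FlowsDir g Ω T p q) : FlowsDir g Ω (-T) q p :=
  ⟨fun hT => h.2 (neg_nonneg.1 hT), fun hT => h.1 (neg_nonpos.1 hT)⟩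

/-- `SameGenerator` asks for a single segment, and segments can be concatenated only when they run
in the same direction. Recording the sign of the time makes this possible without discussing curves
that go forth and back. -/
lemma FlowsDir.trans {T T' : ℝ} (h : FlowsDir g Ω T p q) (h' : FlowsDir g Ω T' q r)
    (hT : 0 ≤ T * T') : FlowsDir g Ω (T + T') p r := by
  constructor <;> intro hs
  · have h1 : 0 ≤ T := by
      by_contra hneg
      nlinarith
    have h2 : 0 ≤ T' := by
      by_contra hneg
      nlinarith
    exact (h.1 h1).trans (h'.1 h2)
  · have h1 : T ≤ 0 := by
      by_contra hneg
      nlinarith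
    have h2 : T' ≤ 0 := by
      by_contra hneg
      nlinarith
    exact (h'.2 h2).trans (h.2 h1)

lemma FlowsDir.sameGenerator {T : ℝ} (h : FlowsDir g Ω T p q) : SameGenerator g Ω p q :=
  sameGenerator_iff.2 ((le_total 0 T).imp h.1 h.2)

lemma FlowsDir.mem_scri {T : ℝ} (h : FlowsDir g Ω T p q) : q ∈ scri M := by
  rcases (le_total 0 T).imp h.1 h.2 with ⟨γ, a, b, hab, hm, -, -, rfl⟩ | ⟨γ, a, b, hab, hm, -, rfl, -⟩
  · exact hm (right_mem_Icc.2 hab)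
  · exact hm (left_mem_Icc.2 hab)

variable [IsManifold (𝓡∂ 4) ((k : ℕ∞ω) + 1) M]

/-- Adding multiples of the normal does not change the metric on null infinity. -/
lemma metric_add_smul_normalField (hk : 2 ≤ k) (hM : IsAsymptoticallySimple k gt g Ω)
    (hnull : IsNullHypersurface g Ω) (he : e ∈ Charts M k)
    (hea : e ∈ atlas (EuclideanHalfSpace 4) M) (hx : x ∈ chartTarget e) (h0 : x 0 = 0)
    {v w : E4} (hv : v 0 = 0) (hw : w 0 = 0) (α β : ℝ) :
    g (chartPoint e x) (coordMap e x (v + α • normalField g Ω e x))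
      (coordMap e x (w + β • normalField g Ω e x)) =
    g (chartPoint e x) (coordMap e x v) (coordMap e x w) := by
  have hg := hM.unphysicalMetric
  have h1 : ∀ u : E4, u 0 = 0 →
      g (chartPoint e x) (coordMap e x (normalField g Ω e x)) (coordMap e x u) = 0 := fun u hu => by
    rw [apply_coordMap]
    exact sum_normalField_tangent hk hM he hea hx h0 hu
  have h2 : ∀ u : E4, u 0 = 0 →
      g (chartPoint e x) (coordMap e x u) (coordMap e x (normalField g Ω e x)) = 0 := fun u hu => by
    rw [hg.symm trivial, h1 u hu]
  simp only [map_add, map_smul, add_apply, smul_apply, smul_eq_mul, h1 w hw, h2 v hv,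
    h1 _ (normalField_apply_zero hk hM hnull he hea hx h0), mul_zero, add_zero]

/-- The flow time and the points of a spacelike surface in null infinity serve as coordinates of
null infinity. -/
lemma exists_flow_coordinates (hk : 2 ≤ k) (hM : IsAsymptoticallyEmptyAndSimple k gt g Ω)
    (hnull : IsNullHypersurface g Ω) (he : e ∈ Charts M k)
    (hea : e ∈ atlas (EuclideanHalfSpace 4) M) {c : E4 × ℝ → ℝ → E4}
    {j : EuclideanSpace ℝ (Fin 2) → E4} {z₀ : EuclideanSpace ℝ (Fin 2)} {T : ℝ}
    (hj : ContDiffAt ℝ 1 j z₀) (hj0 : ∀ᶠ z in 𝓝 z₀, j z 0 = 0)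
    (hsp : ∀ v, v ≠ 0 → g (chartPoint e (j z₀)) (coordMap e (j z₀) (fderiv ℝ j z₀ v))
      (coordMap e (j z₀) (fderiv ℝ j z₀ v)) < 0)
    (hc : ∀ᶠ p in 𝓝 (j z₀, T),
      IsFlowAt (boundaryField g Ω e) (boundaryProj ⁻¹' chartTarget e) c p) :
    ∃ (z : E4 → EuclideanSpace ℝ (Fin 2)) (τ : E4 → ℝ),
      ContDiffAt ℝ 1 z (c (j z₀, T) 1) ∧ ContDiffAt ℝ 1 τ (c (j z₀, T) 1) ∧
      z (c (j z₀, T) 1) = z₀ ∧ τ (c (j z₀, T) 1) = T ∧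
      ∀ᶠ x in 𝓝 (c (j z₀, T) 1), x 0 = 0 → c (j (z x), τ x) 1 = x := by
  have hS := hM.toIsAsymptoticallySimple
  have hflow := hc.self_of_nhds
  have hj00 : j z₀ 0 = 0 := hj0.self_of_nhds
  obtain ⟨hx₁, hx₁0, -, -⟩ := hflow.flows hk hS hnull he hea hj00
  set x₁ := c (j z₀, T) 1 with hx₁def
  have hf0 : ∀ y ∈ boundaryProj ⁻¹' chartTarget e, boundaryField g Ω e y 0 = 0 :=
    fun y hy => boundaryField_apply_zero hk hS hnull he hea hy
  obtain ⟨K, hK, hconf⟩ := hflow.conformal hk hM hnull he hea hj00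
  let D := fderiv ℝ j z₀
  have hjd : HasFDerivAt j D z₀ := (hj.differentiableAt one_ne_zero).hasFDerivAt
  have hD0 : ∀ v, D v 0 = 0 := by
    intro v
    have h1 := (EuclideanSpace.proj (𝕜 := ℝ) (0 : Fin 4)).hasFDerivAt.comp z₀ hjd
    have h2 : HasFDerivAt (EuclideanSpace.proj (𝕜 := ℝ) (0 : Fin 4) ∘ j)
        (0 : EuclideanSpace ℝ (Fin 2) →L[ℝ] ℝ) z₀ :=
      (hasFDerivAt_const (0 : ℝ) z₀).congr_of_eventuallyEq hj0
    exact congrArg (fun L : EuclideanSpace ℝ (Fin 2) →L[ℝ] ℝ => L v) (h1.unique h2)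
  let C := fderiv ℝ (fun q => c q 1) (j z₀, T)
  have hCd : HasFDerivAt (fun q => c q 1) C (j z₀, T) :=
    ((hflow.contDiffAt 1).differentiableAt one_ne_zero).hasFDerivAt
  have hCt : C (0, 1) = normalField g Ω e x₁ := by
    rw [← boundaryField_of_coord_zero hx₁0]
    exact hflow.fderiv_time (isOpen_preimage_chartTarget e) (contDiffOn_boundaryField hk hS he)
  have hC0 : ∀ v : E4, v 0 = 0 → C (v, 0) 0 = 0 := fun v hv =>
    hflow.variation_coord_zero (isOpen_preimage_chartTarget e) (contDiffOn_boundaryField hk hS he)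
      hf0 hv (right_mem_Icc.2 zero_le_one)
  -- A third variable along `x₀` raises the three coordinates of null infinity to four, so that the
  -- inverse function theorem applies in `ℝ⁴`.
  let G : EuclideanSpace ℝ (Fin 2) × ℝ × ℝ → E4 := fun q =>
    c (j q.1, q.2.1) 1 + q.2.2 • EuclideanSpace.single 0 1
  have hGa : G (z₀, T, 0) = x₁ := by simp [G, hx₁def]
  have hG : ContDiffAt ℝ 1 G (z₀, T, 0) := by
    have h1 : ContDiffAt ℝ 1 (fun q : EuclideanSpace ℝ (Fin 2) × ℝ × ℝ => (j q.1, q.2.1))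
        (z₀, T, 0) :=
      (hj.comp (z₀, T, (0 : ℝ)) contDiffAt_fst).prodMk contDiffAt_snd.fst
    exact ((hflow.contDiffAt 1).comp (z₀, T, (0 : ℝ)) h1).add
      (contDiffAt_snd.snd.smul contDiffAt_const)
  have hGd : ∀ q, fderiv ℝ G (z₀, T, 0) q =
      C (D q.1, 0) + q.2.1 • normalField g Ω e x₁ + q.2.2 • EuclideanSpace.single 0 1 := by
    intro q
    have h1 : HasFDerivAt (fun q : EuclideanSpace ℝ (Fin 2) × ℝ × ℝ => (j q.1, q.2.1))
        ((D.comp (ContinuousLinearMap.fst ℝ _ _)).prod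
          ((ContinuousLinearMap.fst ℝ ℝ ℝ).comp (ContinuousLinearMap.snd ℝ _ _))) (z₀, T, 0) :=
      (HasFDerivAt.comp (z₀, T, (0 : ℝ)) hjd hasFDerivAt_fst).prodMk
        (HasFDerivAt.comp (z₀, T, (0 : ℝ)) hasFDerivAt_fst hasFDerivAt_snd)
    have h2 : HasFDerivAt (fun q : EuclideanSpace ℝ (Fin 2) × ℝ × ℝ =>
        q.2.2 • (EuclideanSpace.single 0 1 : E4))
        (((ContinuousLinearMap.snd ℝ ℝ ℝ).comp
          (ContinuousLinearMap.snd ℝ (EuclideanSpace ℝ (Fin 2)) _)).smulRight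
          (EuclideanSpace.single 0 1 : E4)) (z₀, T, 0) :=
      (HasFDerivAt.comp (z₀, T, (0 : ℝ)) hasFDerivAt_snd hasFDerivAt_snd).smul_const _
    have h3 := ((HasFDerivAt.comp (z₀, T, (0 : ℝ)) hCd h1).add h2).fderiv
    have h4 : fderiv ℝ G (z₀, T, 0) q =
        C (D q.1, q.2.1) + q.2.2 • EuclideanSpace.single 0 1 :=
      congrArg (fun L : EuclideanSpace ℝ (Fin 2) × ℝ × ℝ →L[ℝ] E4 => L q) h3
    rw [h4, ← hCt, ← map_smul, ← map_add]
    simp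
  have hinj : ∀ q, fderiv ℝ G (z₀, T, 0) q = 0 → q = 0 := by
    rintro ⟨v, τ, h⟩ hq
    rw [hGd] at hq
    have hN0 := normalField_apply_zero hk hS hnull he hea hx₁ hx₁0
    have hh : h = 0 := by
      have := congrArg (fun y : E4 => y 0) hq
      simpa [hC0 _ (hD0 v), hN0] using this
    subst hh
    have hq' : C (D v, 0) + τ • normalField g Ω e x₁ = 0 := by simpa using hq
    -- If the transported surface vector were a multiple of the normal its square would be zero,
    -- whereas conformality of the flow makes it negative.
    have hv : v = 0 := by
      by_contra hv
      have h1 := metric_add_smul_normalField hk hS hnull he hea hx₁ hx₁0 (hC0 _ (hD0 v))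
        (hC0 _ (hD0 v)) τ τ
      rw [hq', map_zero, map_zero] at h1
      exact (mul_neg_of_pos_of_neg hK (hsp v hv)).ne' (h1.trans (hconf _ _ (hD0 v) (hD0 v)))
    subst hv
    have hτ : τ = 0 := by
      have h1 : τ • normalField g Ω e x₁ = 0 := by
        have h2 : C ((0 : E4), (0 : ℝ)) = 0 := map_zero C
        simpa [h2] using hq'
      exact (smul_eq_zero.1 h1).resolve_right (normalField_ne_zero hk hS he hea hx₁ hx₁0)
    subst hτ
    rfl
  obtain ⟨H, hHd, hHa, hHr⟩ := exists_local_right_inverse hG hinj (by simp)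
  rw [hGa] at hHd hHa hHr
  refine ⟨fun x => (H x).1, fun x => (H x).2.1, hHd.fst, hHd.snd.fst, congrArg _ hHa, congrArg (fun q => q.2.1) hHa, ?_⟩
  have ht : Tendsto (fun x => (j (H x).1, (H x).2.1)) (𝓝 x₁) (𝓝 (j z₀, T)) := by
    have h1 : ContinuousAt H x₁ := hHd.continuousAt
    have h2 : ContinuousAt (fun x => j (H x).1) x₁ := by
      refine ContinuousAt.comp (g := j) (f := fun x => (H x).1) ?_ h1.fst
      rw [hHa]
      exact hj.continuousAt
    have h3 := (h2.prodMk h1.snd.fst).tendsto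
    simpa only [hHa] using h3
  have ht' : Tendsto (fun x => (H x).1) (𝓝 x₁) (𝓝 z₀) := by
    have := hHd.continuousAt.fst.tendsto
    rwa [hHa] at this
  filter_upwards [hHr, ht.eventually hc, ht'.eventually hj0] with x hx hxc hxj hx0
  obtain ⟨-, h1, -, -⟩ := hxc.flows hk hS hnull he hea hxj
  have h2 : (H x).2.2 = 0 := by
    have := congrArg (fun y : E4 => y 0) hx
    simpa [G, h1, hx0] using this
  simpa [G, h2] using hx

end

/-! ### Surfaces and their induced metrics in a chart -/

section ChartRepresentation

variable {M : Type*} [TopologicalSpace M] [ChartedSpace (EuclideanHalfSpace 4) M]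
  {k : ℕ∞} {e : OpenPartialHomeomorph M (EuclideanHalfSpace 4)}
  {g : Tensor2 M}
  {S : Type*} [TopologicalSpace S] [ChartedSpace (EuclideanSpace ℝ (Fin 2)) S]
  {F : S → M} {f : S → E4} {s : S}

lemma _root_.ContMDiffAt.extend_comp (hF : ContMDiffAt (𝓡 2) (𝓡∂ 4) 1 F s) (he : e ∈ Charts M k)
    (hs : F s ∈ e.source) :
    ContMDiffAt (𝓡 2) 𝓘(ℝ, E4) 1 (fun s => e.extend (𝓡∂ 4) (F s)) s :=
  ((e.contMDiffAt_extend he hs).of_le le_add_self).comp s hF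

lemma _root_.ContMDiffAt.chartPoint_comp (hf : ContMDiffAt (𝓡 2) 𝓘(ℝ, E4) 1 f s)
    (he : e ∈ Charts M k) (hs : ∀ᶠ s in 𝓝 s, f s ∈ chartTarget e) :
    ContMDiffAt (𝓡 2) (𝓡∂ 4) 1 (fun s => chartPoint e (f s)) s := by
  have h := (contMDiffWithinAt_chartPoint he hs.self_of_nhds).of_le (m := 1) le_add_self
  refine (h.comp' s (hf.contMDiffWithinAt (s := univ))).contMDiffAt ?_
  filter_upwards [hs] with s hs
  exact ⟨trivial, chartTarget_subset_halfSpace hs⟩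

lemma mfderiv_coord_zero {L : TangentSpace (𝓡 2) s →L[ℝ] E4}
    (hL : HasMFDerivAt (𝓡 2) 𝓘(ℝ, E4) f s L) (h0 : ∀ᶠ s in 𝓝 s, f s 0 = 0)
    (v : TangentSpace (𝓡 2) s) : L v 0 = 0 := by
  have h1 := (EuclideanSpace.proj (𝕜 := ℝ) (0 : Fin 4)).hasFDerivAt (x := f s)
    |>.hasMFDerivAt.comp s hL
  have h2 : HasMFDerivAt (𝓡 2) 𝓘(ℝ, ℝ) (EuclideanSpace.proj (𝕜 := ℝ) (0 : Fin 4) ∘ f) s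
      (0 : TangentSpace (𝓡 2) s →L[ℝ] ℝ) :=
    (hasMFDerivAt_const (0 : ℝ) s).congr_of_eventuallyEq h0
  exact congrArg (fun L : TangentSpace (𝓡 2) s →L[ℝ] ℝ => L v) (hasMFDerivAt_unique h1 h2)

lemma metric_mfderiv (he : e ∈ Charts M k) (hF : MDifferentiableAt (𝓡 2) (𝓡∂ 4) F s)
    (hs : F s ∈ e.source) {x : E4} (hx : e.extend (𝓡∂ 4) (F s) = x)
    {L : TangentSpace (𝓡 2) s →L[ℝ] E4}
    (hL : HasMFDerivAt (𝓡 2) 𝓘(ℝ, E4) (fun s => e.extend (𝓡∂ 4) (F s)) s L)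
    (v w : TangentSpace (𝓡 2) s) :
    g (F s) (mfderiv (𝓡 2) (𝓡∂ 4) F s v) (mfderiv (𝓡 2) (𝓡∂ 4) F s w) =
      g (chartPoint e x) (coordMap e x (L v)) (coordMap e x (L w)) := by
  have h1 := hasMFDerivAt_unique hL ((mdifferentiableAt_extend he hs).hasMFDerivAt.comp s hF.hasMFDerivAt)
  have h2 : ∀ v, L v = mfderiv (𝓡∂ 4) 𝓘(ℝ, E4) (e.extend (𝓡∂ 4)) (F s)
      (mfderiv (𝓡 2) (𝓡∂ 4) F s v) := fun v =>
    congrArg (fun L : TangentSpace (𝓡 2) s →L[ℝ] E4 => L v) h1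
  -- Stated for a variable base point so that `p` can be replaced by `chartPoint e x`; the tangent
  -- spaces depend on the point.
  have h3 : ∀ p ∈ e.source, e.extend (𝓡∂ 4) p = x → ∀ v w : TangentSpace (𝓡∂ 4) p,
      g p v w = g (chartPoint e x)
        (coordMap e x (mfderiv (𝓡∂ 4) 𝓘(ℝ, E4) (e.extend (𝓡∂ 4)) p v))
        (coordMap e x (mfderiv (𝓡∂ 4) 𝓘(ℝ, E4) (e.extend (𝓡∂ 4)) p w)) := by
    intro p hp hpx v w
    have hxt : x ∈ chartTarget e := hpx ▸ extend_mem_chartTarget hp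
    obtain rfl : chartPoint e x = p := by rw [← hpx, chartPoint_extend hp]
    rw [coordMap_mfderiv_extend he hxt, coordMap_mfderiv_extend he hxt]
  rw [h2, h2]
  exact h3 _ hs hx _ _

end ChartRepresentation

/-! ### Carrying a surface along the generators -/

section Transport

variable {M : Type*} [TopologicalSpace M] [ChartedSpace (EuclideanHalfSpace 4) M]
  {k : ℕ∞} {e : OpenPartialHomeomorph M (EuclideanHalfSpace 4)}
  {gt g : Tensor2 M} {Ω : M → ℝ}

lemma eventually_extend_mem_scri (hk : 2 ≤ k) (hM : IsAsymptoticallySimple k gt g Ω)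
    (he : e ∈ Charts M k)
    {S : Type*} [TopologicalSpace S] {F : S → M} {s₀ : S} (hF : ContinuousAt F s₀) (hmem : ∀ᶠ s in 𝓝 s₀, F s ∈ scri M)
    (hs : F s₀ ∈ e.source) :
    ∀ᶠ s in 𝓝 s₀, F s ∈ e.source ∧ e.extend (𝓡∂ 4) (F s) 0 = 0 := by
  filter_upwards [hmem, hF.eventually (e.open_source.mem_nhds hs)] with s h1 h2
  refine ⟨h2, coord_zero_of_mem_scri hk hM he (extend_mem_chartTarget h2) ?_⟩
  rwa [chartPoint_extend h2]

variable {S : Type*} [TopologicalSpace S] [ChartedSpace (EuclideanSpace ℝ (Fin 2)) S]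
  {ι F : S → M} {s₀ : S} {T : ℝ}

/-- Near `s₀`, the map `F` arises from `ι` by moving along the generators, in the direction given
by the sign of `T`, and it is conformal to `ι` at `s₀`. -/
structure IsTransportAt (g : Tensor2 M) (Ω : M → ℝ) (ι : S → M) (s₀ : S) (T : ℝ) (F : S → M) :
    Prop where
  flowsDir : ∀ᶠ s in 𝓝 s₀, FlowsDir g Ω T (ι s) (F s)
  contMDiffAt : ContMDiffAt (𝓡 2) (𝓡∂ 4) 1 F s₀
  conformal : ∃ K > 0, ∀ v w : TangentSpace (𝓡 2) s₀,
    g (F s₀) (mfderiv (𝓡 2) (𝓡∂ 4) F s₀ v) (mfderiv (𝓡 2) (𝓡∂ 4) F s₀ w) =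
      K * g (ι s₀) (mfderiv (𝓡 2) (𝓡∂ 4) ι s₀ v) (mfderiv (𝓡 2) (𝓡∂ 4) ι s₀ w)

lemma IsTransportAt.refl (hι : ContMDiffAt (𝓡 2) (𝓡∂ 4) 1 ι s₀) (hmem : ∀ s, ι s ∈ scri M) :
    IsTransportAt g Ω ι s₀ 0 ι where
  flowsDir := Eventually.of_forall fun s => ⟨fun _ => Flows.refl (hmem s), fun _ => Flows.refl (hmem s)⟩
  contMDiffAt := hι
  conformal := ⟨1, one_pos, fun _ _ => (one_mul _).symm⟩

variable [IsManifold (𝓡∂ 4) ((k : ℕ∞ω) + 1) M]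

lemma IsTransportAt.flow (hk : 2 ≤ k) (hM : IsAsymptoticallyEmptyAndSimple k gt g Ω)
    (hnull : IsNullHypersurface g Ω) (he : e ∈ Charts M k)
    (hea : e ∈ atlas (EuclideanHalfSpace 4) M) (hF : IsTransportAt g Ω ι s₀ T F)
    (hs : F s₀ ∈ e.source) {c : E4 × ℝ → ℝ → E4} {T' : ℝ}
    (hc : ∀ᶠ p in 𝓝 (e.extend (𝓡∂ 4) (F s₀), T'),
      IsFlowAt (boundaryField g Ω e) (boundaryProj ⁻¹' chartTarget e) c p)
    (hT : 0 ≤ T * T') :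
    IsTransportAt g Ω ι s₀ (T + T') fun s => chartPoint e (c (e.extend (𝓡∂ 4) (F s), T') 1) := by
  have hS := hM.toIsAsymptoticallySimple
  have hFs := eventually_extend_mem_scri hk hS he hF.contMDiffAt.continuousAt
    (hF.flowsDir.mono fun s hs => hs.mem_scri) hs
  have hF' := hF.contMDiffAt.extend_comp he hs
  have hflow := hc.self_of_nhds
  have hc' : ContDiffAt ℝ 1 (fun x => c (x, T') 1) (e.extend (𝓡∂ 4) (F s₀)) :=
    ContDiffAt.comp (e.extend (𝓡∂ 4) (F s₀)) (hflow.contDiffAt 1)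
      (contDiffAt_id.prodMk contDiffAt_const)
  have hcF : ContMDiffAt (𝓡 2) 𝓘(ℝ, E4) 1 (fun s => c (e.extend (𝓡∂ 4) (F s), T') 1) s₀ :=
    hc'.contMDiffAt.comp s₀ hF'
  have hcs : ∀ᶠ s in 𝓝 s₀, IsFlowAt (boundaryField g Ω e) (boundaryProj ⁻¹' chartTarget e) c
      (e.extend (𝓡∂ 4) (F s), T') :=
    (hF'.continuousAt.prodMk continuousAt_const).eventually hc
  have hct : ∀ᶠ s in 𝓝 s₀, c (e.extend (𝓡∂ 4) (F s), T') 1 ∈ chartTarget e := by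
    filter_upwards [hFs, hcs] with s h1 h2
    exact (h2.flows hk hS hnull he hea h1.2).1
  have hcF' := hcF.chartPoint_comp he hct
  refine ⟨?_, hcF', ?_⟩
  · filter_upwards [hF.flowsDir, hFs, hcs] with s h1 h2 h3
    refine h1.trans ?_ hT
    have := (h3.flows hk hS hnull he hea h2.2).2.2
    rwa [chartPoint_extend h2.1] at this
  · obtain ⟨K, hK, hconf⟩ := hF.conformal
    obtain ⟨K', hK', hconf'⟩ := hflow.conformal hk hM hnull he hea hFs.self_of_nhds.2
    refine ⟨K' * K, mul_pos hK' hK, fun v w => ?_⟩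
    have hL := (hF'.mdifferentiableAt one_ne_zero).hasMFDerivAt
    have hd : HasFDerivAt (fun x => c (x, T') 1)
        ((fderiv ℝ (fun q => c q 1) (e.extend (𝓡∂ 4) (F s₀), T')).comp
          (ContinuousLinearMap.inl ℝ E4 ℝ)) (e.extend (𝓡∂ 4) (F s₀)) :=
      HasFDerivAt.comp (f := fun x => (x, T')) (e.extend (𝓡∂ 4) (F s₀))
        ((hflow.contDiffAt 1).differentiableAt one_ne_zero).hasFDerivAt
        (hasFDerivAt_prodMk_left _ _)
    have hL' := hd.hasMFDerivAt.comp s₀ hL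
    have hL'' : HasMFDerivAt (𝓡 2) 𝓘(ℝ, E4) (fun s => e.extend (𝓡∂ 4)
        (chartPoint e (c (e.extend (𝓡∂ 4) (F s), T') 1))) s₀ _ :=
      hL'.congr_of_eventuallyEq (hct.mono fun s hs => extend_chartPoint hs)
    rw [metric_mfderiv he (hcF'.mdifferentiableAt one_ne_zero)
      (chartPoint_mem_source hct.self_of_nhds) (extend_chartPoint hct.self_of_nhds) hL'' v w,
      mul_assoc, ← hconf, metric_mfderiv he (hF.contMDiffAt.mdifferentiableAt one_ne_zero) hs rfl hL]
    have h0 := mfderiv_coord_zero hL (hFs.mono fun s hs => hs.2)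
    exact hconf' _ _ (h0 v) (h0 w)

end Transport

/-! ### Transport along a compact segment of a generator -/

section AlongGenerator

variable {M : Type*} [TopologicalSpace M] [ChartedSpace (EuclideanHalfSpace 4) M]
  {k : ℕ∞} {gt g : Tensor2 M} {Ω : M → ℝ} {γ : ℝ → M} {a b : ℝ}

/-- One flow box works near `γ t₀`: local uniqueness identifies the given generator with the flow.
It moves `γ t` to `γ t'` for all nearby parameters in either order, as transport in both directions
requires. -/
lemma exists_flow_along (hk : 2 ≤ k) (hM : IsAsymptoticallySimple k gt g Ω)
    {e : OpenPartialHomeomorph M (EuclideanHalfSpace 4)} (he : e ∈ Charts M k)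
    (hm : MapsTo γ (Icc a b) (scri M)) (hγ : IsMIntegralCurveOn γ (normal g Ω) (Icc a b))
    {t₀ : ℝ} (ht₀ : t₀ ∈ Icc a b) (hs : γ t₀ ∈ e.source) :
    ∃ c : E4 × ℝ → ℝ → E4, ∃ U ∈ 𝓝 t₀, ∀ t ∈ U ∩ Icc a b, ∀ t' ∈ U ∩ Icc a b,
      γ t ∈ e.source ∧ c (e.extend (𝓡∂ 4) (γ t), t' - t) 1 = e.extend (𝓡∂ 4) (γ t') ∧
      ∀ᶠ p in 𝓝 (e.extend (𝓡∂ 4) (γ t), t' - t),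
        IsFlowAt (boundaryField g Ω e) (boundaryProj ⁻¹' chartTarget e) c p := by
  let y : ℝ → E4 := fun t => e.extend (𝓡∂ 4) (γ t)
  have hy0 : ∀ t ∈ Icc a b, γ t ∈ e.source → y t 0 = 0 := fun t ht hts =>
    coord_zero_of_mem_scri hk hM he (extend_mem_chartTarget hts)
      (by rw [chartPoint_extend hts]; exact hm ht)
  have hyd : ∀ t ∈ Icc a b, γ t ∈ e.source →
      HasDerivWithinAt y (boundaryField g Ω e (y t)) (Icc a b) t := fun t ht hts => by
    rw [boundaryField_of_coord_zero (hy0 t ht hts)]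
    exact hasDerivWithinAt_extend hk hM he hγ ht hts
  have hx₀ : y t₀ ∈ boundaryProj ⁻¹' chartTarget e := by
    rw [mem_preimage, boundaryProj_of_coord_zero (hy0 t₀ ht₀ hs)]
    exact extend_mem_chartTarget hs
  obtain ⟨c, hc, δ, hδ, huniq⟩ := exists_flow (isOpen_preimage_chartTarget e)
    (contDiffOn_boundaryField hk hM he) hx₀
  obtain ⟨δ', hδ', hc'⟩ := Metric.eventually_nhds_iff.1 hc.eventually_nhds
  have h1 : ∀ᶠ t in 𝓝[Icc a b] t₀, γ t ∈ e.source ∧ y t ∈ Metric.ball (y t₀) (min δ δ') :=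
    ((hγ.continuousWithinAt ht₀).eventually (e.open_source.mem_nhds hs)).and
      ((hyd t₀ ht₀ hs).continuousWithinAt.eventually
        (Metric.ball_mem_nhds _ (lt_min hδ hδ')))
  obtain ⟨ε, hε, h2⟩ := Metric.mem_nhdsWithin_iff.1 h1
  -- The bound by `ε` keeps `γ` in the chart and near `γ t₀`; the factor one half bounds the flow
  -- time `t' - t` by `min δ δ'`.
  let ρ := min ε (min δ δ' / 2)
  have hρ : 0 < ρ := lt_min hε (half_pos (lt_min hδ hδ'))
  refine ⟨c, Metric.ball t₀ ρ, Metric.ball_mem_nhds _ hρ, ?_⟩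
  have hgood : ∀ t ∈ Metric.ball t₀ ρ ∩ Icc a b,
      γ t ∈ e.source ∧ y t ∈ Metric.ball (y t₀) (min δ δ') := fun t ht =>
    h2 ⟨Metric.ball_subset_ball (min_le_left _ _) ht.1, ht.2⟩
  rintro t ht t' ht'
  have hTabs : |t' - t| < min δ δ' := by
    have h3 : dist t t₀ < min δ δ' / 2 := (Metric.mem_ball.1 ht.1).trans_le (min_le_right _ _)
    have h4 : dist t' t₀ < min δ δ' / 2 := (Metric.mem_ball.1 ht'.1).trans_le (min_le_right _ _)
    have h5 := dist_triangle_right t' t t₀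
    rw [Real.dist_eq] at h5
    linarith
  have hseg : MapsTo (fun r : ℝ => t + r * (t' - t)) (Icc 0 1) (Metric.ball t₀ ρ ∩ Icc a b) := by
    intro r hr
    have := ((convex_ball t₀ ρ).inter (convex_Icc a b)).add_smul_sub_mem ht ht' hr
    simpa using this
  refine ⟨(hgood t ht).1, ?_, ?_⟩
  · have h3 := huniq (fun r => y (t + r * (t' - t))) (t' - t) (hTabs.trans_le (min_le_left _ _))
      fun r hr => ⟨Metric.ball_subset_ball (min_le_left _ _) (hgood _ (hseg hr)).2, ?_⟩
    · simpa [y] using h3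
    · have h4 : HasDerivWithinAt (fun r : ℝ => t + r * (t' - t)) (t' - t) (Icc 0 1) r := by
        simpa using ((hasDerivWithinAt_id r (Icc 0 1)).mul_const (t' - t)).const_add t
      exact (hyd _ (hseg hr).2 (hgood _ (hseg hr)).1).scomp r h4 fun r hr => (hseg hr).2
  · refine hc' ?_
    rw [Prod.dist_eq, max_lt_iff]
    refine ⟨(hgood t ht).2.trans_le (min_le_right _ _), ?_⟩
    rw [Real.dist_eq, sub_zero]
    exact hTabs.trans_le (min_le_right _ _)

variable [IsManifold (𝓡∂ 4) ((k : ℕ∞ω) + 1) M]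
  {S : Type*} [TopologicalSpace S] [ChartedSpace (EuclideanSpace ℝ (Fin 2)) S]
  {ι : S → M} {s₀ : S}

lemma exists_transport_local (hk : 2 ≤ k) (hM : IsAsymptoticallyEmptyAndSimple k gt g Ω)
    (hnull : IsNullHypersurface g Ω)
    (hm : MapsTo γ (Icc a b) (scri M)) (hγ : IsMIntegralCurveOn γ (normal g Ω) (Icc a b))
    {t₀ : ℝ} (ht₀ : t₀ ∈ Icc a b) :
    ∃ U ∈ 𝓝 t₀, ∀ t ∈ U ∩ Icc a b, ∀ t' ∈ U ∩ Icc a b, ∀ α, 0 ≤ (t - α) * (t' - t) →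
      (∃ F, IsTransportAt g Ω ι s₀ (t - α) F ∧ F s₀ = γ t) →
      ∃ F, IsTransportAt g Ω ι s₀ (t' - α) F ∧ F s₀ = γ t' := by
  obtain ⟨c, U, hU, h⟩ := exists_flow_along hk hM.toIsAsymptoticallySimple
    (IsManifold.chart_mem_maximalAtlas (γ t₀)) hm hγ ht₀ (mem_chart_source _ _)
  refine ⟨U, hU, ?_⟩
  rintro t ht t' ht' α hα ⟨F, hF, hFt⟩
  obtain ⟨hs, hct, hc⟩ := h t ht t' ht'
  rw [← hFt] at hs hct hc
  refine ⟨_, sub_add_sub_cancel' t α t' ▸ hF.flow hk hM hnull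
    (IsManifold.chart_mem_maximalAtlas (γ t₀)) (chart_mem_atlas _ _) hs hc hα, ?_⟩
  rw [hct, chartPoint_extend (h t' ht' t' ht').1]

lemma exists_transport_right (hk : 2 ≤ k) (hM : IsAsymptoticallyEmptyAndSimple k gt g Ω)
    (hnull : IsNullHypersurface g Ω) (hι : ContMDiffAt (𝓡 2) (𝓡∂ 4) 1 ι s₀)
    (hmem : ∀ s, ι s ∈ scri M)
    (hm : MapsTo γ (Icc a b) (scri M)) (hγ : IsMIntegralCurveOn γ (normal g Ω) (Icc a b))
    (hab : a ≤ b) (ha : ι s₀ = γ a) :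
    ∃ F, IsTransportAt g Ω ι s₀ (b - a) F ∧ F s₀ = γ b := by
  refine propagate_right hab (P := fun t => ∃ F, IsTransportAt g Ω ι s₀ (t - a) F ∧ F s₀ = γ t)
    (fun t₀ ht₀ => ?_) ⟨ι, by rw [sub_self]; exact .refl hι hmem, ha⟩
  obtain ⟨U, hU, h⟩ := exists_transport_local (ι := ι) (s₀ := s₀) hk hM hnull hm hγ ht₀
  exact ⟨U, hU, fun t ht t' ht' hle =>
    h t ht t' ht' a (mul_nonneg (sub_nonneg.2 ht.2.1) (sub_nonneg.2 hle))⟩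

lemma exists_transport_left (hk : 2 ≤ k) (hM : IsAsymptoticallyEmptyAndSimple k gt g Ω)
    (hnull : IsNullHypersurface g Ω) (hι : ContMDiffAt (𝓡 2) (𝓡∂ 4) 1 ι s₀)
    (hmem : ∀ s, ι s ∈ scri M)
    (hm : MapsTo γ (Icc a b) (scri M)) (hγ : IsMIntegralCurveOn γ (normal g Ω) (Icc a b))
    (hab : a ≤ b) (hb : ι s₀ = γ b) :
    ∃ F, IsTransportAt g Ω ι s₀ (a - b) F ∧ F s₀ = γ a := by
  by_contra hneg
  -- Transport to the left is obtained by contraposition: failure of transport would propagate to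
  -- the right up to `b`, where the surface itself is a transport.
  refine propagate_right hab (P := fun t => ¬∃ F, IsTransportAt g Ω ι s₀ (t - b) F ∧ F s₀ = γ t)
    (fun t₀ ht₀ => ?_) hneg ⟨ι, by rw [sub_self]; exact .refl hι hmem, hb⟩
  obtain ⟨U, hU, h⟩ := exists_transport_local (ι := ι) (s₀ := s₀) hk hM hnull hm hγ ht₀
  exact ⟨U, hU, fun t ht t' ht' hle => mt (h t' ht' t ht b
    (mul_nonneg_of_nonpos_of_nonpos (sub_nonpos.2 ht'.2.2) (sub_nonpos.2 hle)))⟩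

end AlongGenerator

/-! ### Projecting a nearby surface to a spacelike surface along the generators -/

section Hit

variable {M : Type*} [TopologicalSpace M] [ChartedSpace (EuclideanHalfSpace 4) M]
  {k : ℕ∞} {e : OpenPartialHomeomorph M (EuclideanHalfSpace 4)}
  {gt g : Tensor2 M} {Ω : M → ℝ}
  {S S' : Type*} [TopologicalSpace S] [ChartedSpace (EuclideanSpace ℝ (Fin 2)) S]
  [TopologicalSpace S'] [ChartedSpace (EuclideanSpace ℝ (Fin 2)) S'] [IsManifold (𝓡 2) 1 S']
  {F : S → M} {s₀ : S} {ι : S' → M} {s₁ : S'} {T : ℝ}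

lemma fderiv_extend_comp_spacelike (he : e ∈ Charts M k) (hι : ContMDiff (𝓡 2) (𝓡∂ 4) 1 ι)
    (hsp : ∀ (s : S') (v : TangentSpace (𝓡 2) s), v ≠ 0 →
      g (ι s) (mfderiv (𝓡 2) (𝓡∂ 4) ι s v) (mfderiv (𝓡 2) (𝓡∂ 4) ι s v) < 0)
    {z : EuclideanSpace ℝ (Fin 2)} (hz : z ∈ (extChartAt (𝓡 2) s₁).target)
    (hs : ι ((extChartAt (𝓡 2) s₁).symm z) ∈ e.source) :
    ContDiffAt ℝ 1 (fun z => e.extend (𝓡∂ 4) (ι ((extChartAt (𝓡 2) s₁).symm z))) z ∧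
    ∀ v, v ≠ 0 →
      g (chartPoint e (e.extend (𝓡∂ 4) (ι ((extChartAt (𝓡 2) s₁).symm z))))
        (coordMap e _ (fderiv ℝ
          (fun z => e.extend (𝓡∂ 4) (ι ((extChartAt (𝓡 2) s₁).symm z))) z v))
        (coordMap e _ (fderiv ℝ
          (fun z => e.extend (𝓡∂ 4) (ι ((extChartAt (𝓡 2) s₁).symm z))) z v)) < 0 := by
  have hψ : ContMDiffAt 𝓘(ℝ, EuclideanSpace ℝ (Fin 2)) (𝓡 2) 1 (extChartAt (𝓡 2) s₁).symm z :=
    (contMDiffOn_extChartAt_symm s₁).contMDiffAt ((isOpen_extChartAt_target s₁).mem_nhds hz)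
  have hP : ContMDiffAt (𝓡 2) (𝓡∂ 4) 1 (fun z => ι ((extChartAt (𝓡 2) s₁).symm z)) z :=
    (hι _).comp z hψ
  have hj : ContDiffAt ℝ 1 (fun z => e.extend (𝓡∂ 4) (ι ((extChartAt (𝓡 2) s₁).symm z))) z :=
    contMDiffAt_iff_contDiffAt.1 (hP.extend_comp he hs)
  refine ⟨hj, fun v hv => ?_⟩
  have hL := (hj.differentiableAt one_ne_zero).hasFDerivAt.hasMFDerivAt
  refine (metric_mfderiv he (hP.mdifferentiableAt one_ne_zero) hs rfl hL v v).symm.trans_lt ?_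
  have h1 := mfderiv_comp z ((hι ((extChartAt (𝓡 2) s₁).symm z)).mdifferentiableAt one_ne_zero)
    (hψ.mdifferentiableAt one_ne_zero)
  have h2 : mfderiv (𝓡 2) (𝓡∂ 4) (fun z => ι ((extChartAt (𝓡 2) s₁).symm z)) z v =
      mfderiv (𝓡 2) (𝓡∂ 4) ι ((extChartAt (𝓡 2) s₁).symm z)
        (mfderiv (𝓡 2) (𝓡 2) (extChartAt (𝓡 2) s₁).symm z v) :=
    congrArg (fun L : EuclideanSpace ℝ (Fin 2) →L[ℝ] E4 => L v) h1
  rw [h2]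
  refine hsp _ _ fun h0 => hv ?_
  have h3 := isInvertible_mfderivWithin_extChartAt_symm hz
  rw [ModelWithCorners.range_eq_univ, mfderivWithin_univ] at h3
  exact h3.injective (h0.trans (map_zero _).symm)

variable [IsManifold (𝓡∂ 4) ((k : ℕ∞ω) + 1) M]

/-- A surface near a point of a spacelike surface can be moved along the generators to the latter. -/
lemma exists_hit (hk : 2 ≤ k) (hM : IsAsymptoticallyEmptyAndSimple k gt g Ω)
    (hnull : IsNullHypersurface g Ω) (he : e ∈ Charts M k)
    (hea : e ∈ atlas (EuclideanHalfSpace 4) M)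
    (hF : ContMDiffAt (𝓡 2) (𝓡∂ 4) 1 F s₀) (hFm : ∀ᶠ s in 𝓝 s₀, F s ∈ scri M)
    (hs : F s₀ ∈ e.source) (hι : ContMDiff (𝓡 2) (𝓡∂ 4) 1 ι) (hιm : ∀ s, ι s ∈ scri M)
    (hsp : ∀ (s : S') (v : TangentSpace (𝓡 2) s), v ≠ 0 →
      g (ι s) (mfderiv (𝓡 2) (𝓡∂ 4) ι s v) (mfderiv (𝓡 2) (𝓡∂ 4) ι s v) < 0)
    (hs' : ι s₁ ∈ e.source) {c : E4 × ℝ → ℝ → E4}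
    (hcT : c (e.extend (𝓡∂ 4) (ι s₁), T) 1 = e.extend (𝓡∂ 4) (F s₀))
    (hc : ∀ᶠ p in 𝓝 (e.extend (𝓡∂ 4) (ι s₁), T),
      IsFlowAt (boundaryField g Ω e) (boundaryProj ⁻¹' chartTarget e) c p) :
    ∃ (H : S → S') (τ : S → ℝ), H s₀ = s₁ ∧ ContMDiffAt (𝓡 2) (𝓡 2) 1 H s₀ ∧
      ContinuousAt τ s₀ ∧ τ s₀ = T ∧ (∀ᶠ s in 𝓝 s₀, FlowsDir g Ω (τ s) (ι (H s)) (F s)) ∧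
      ∃ K > 0, ∀ v w : TangentSpace (𝓡 2) s₀,
        g (F s₀) (mfderiv (𝓡 2) (𝓡∂ 4) F s₀ v) (mfderiv (𝓡 2) (𝓡∂ 4) F s₀ w) =
          K * g (ι (H s₀)) (mfderiv (𝓡 2) (𝓡∂ 4) (fun s => ι (H s)) s₀ v)
            (mfderiv (𝓡 2) (𝓡∂ 4) (fun s => ι (H s)) s₀ w) := by
  have hS := hM.toIsAsymptoticallySimple
  let ψ := extChartAt (𝓡 2) s₁
  let z₀ := ψ s₁
  let j : EuclideanSpace ℝ (Fin 2) → E4 := fun z => e.extend (𝓡∂ 4) (ι (ψ.symm z))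
  have hψz : ψ.symm z₀ = s₁ := extChartAt_to_inv s₁
  have hz₀ : z₀ ∈ ψ.target := mem_extChartAt_target s₁
  have hψ : ContMDiffAt 𝓘(ℝ, EuclideanSpace ℝ (Fin 2)) (𝓡 2) 1 ψ.symm z₀ :=
    (contMDiffOn_extChartAt_symm s₁).contMDiffAt ((isOpen_extChartAt_target s₁).mem_nhds hz₀)
  have hjz : j z₀ = e.extend (𝓡∂ 4) (ι s₁) := by simp only [j, hψz]
  obtain ⟨hj, hjsp⟩ := fderiv_extend_comp_spacelike he hι hsp hz₀ (by rwa [hψz])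
  change ContDiffAt ℝ 1 j z₀ at hj
  have hjs : ∀ᶠ z in 𝓝 z₀, ι (ψ.symm z) ∈ e.source ∧ j z 0 = 0 :=
    eventually_extend_mem_scri hk hS he (F := fun z => ι (ψ.symm z))
      (ContinuousAt.comp (hι _).continuousAt hψ.continuousAt)
      (Eventually.of_forall fun z => hιm _) (by rwa [hψz])
  rw [← hjz] at hc hcT
  obtain ⟨z, τ, hz, hτ, hz1, hτ1, hzτ⟩ := exists_flow_coordinates hk hM hnull he hea hj
    (hjs.mono fun z hz => hz.2) hjsp hc
  rw [hcT] at hz hτ hz1 hτ1 hzτ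
  have hflow := hc.self_of_nhds
  obtain ⟨hx₁, hx₁0, -, -⟩ := hflow.flows hk hS hnull he hea hjs.self_of_nhds.2
  obtain ⟨K, hK, hconf⟩ := hflow.conformal hk hM hnull he hea hjs.self_of_nhds.2
  let Fh : S → E4 := fun s => e.extend (𝓡∂ 4) (F s)
  have hFh : ContMDiffAt (𝓡 2) 𝓘(ℝ, E4) 1 Fh s₀ := hF.extend_comp he hs
  have hFs := eventually_extend_mem_scri hk hS he hF.continuousAt hFm hs
  have hzF : ContMDiffAt (𝓡 2) 𝓘(ℝ, EuclideanSpace ℝ (Fin 2)) 1 (fun s => z (Fh s)) s₀ :=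
    hz.contMDiffAt.comp s₀ hFh
  have hτF : ContinuousAt (fun s => τ (Fh s)) s₀ :=
    ContinuousAt.comp (f := Fh) hτ.continuousAt hFh.continuousAt
  have hH : ContMDiffAt (𝓡 2) (𝓡 2) 1 (fun s => ψ.symm (z (Fh s))) s₀ :=
    hψ.comp_of_eq hzF hz1
  have hzt : Tendsto (fun s => z (Fh s)) (𝓝 s₀) (𝓝 z₀) := by
    have := hzF.continuousAt.tendsto
    rwa [hz1] at this
  have hjτ : Tendsto (fun s => (j (z (Fh s)), τ (Fh s))) (𝓝 s₀) (𝓝 (j z₀, T)) := by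
    have := (hj.continuousAt.tendsto.comp hzt).prodMk_nhds hτF.tendsto
    rwa [hτ1] at this
  have hcF : ∀ᶠ s in 𝓝 s₀, c (j (z (Fh s)), τ (Fh s)) 1 = Fh s := by
    filter_upwards [hFs, hFh.continuousAt.eventually hzτ] with s h1 h2
    exact h2 h1.2
  refine ⟨fun s => ψ.symm (z (Fh s)), fun s => τ (Fh s), ?_, hH, hτF, hτ1, ?_, K, hK,
    fun v w => ?_⟩
  · dsimp only
    rw [hz1, hψz]
  · filter_upwards [hFs, hzt.eventually hjs, hjτ.eventually hc, hcF] with s h1 h2 h3 h4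
    have := (h3.flows hk hS hnull he hea h2.2).2.2
    rwa [h4, chartPoint_extend h2.1, chartPoint_extend h1.1] at this
  · have hL := (hFh.mdifferentiableAt one_ne_zero).hasMFDerivAt
    have hzd := (hz.differentiableAt one_ne_zero).hasFDerivAt
    have hτd := (hτ.differentiableAt one_ne_zero).hasFDerivAt
    have hjd : HasFDerivAt j (fderiv ℝ j z₀) (z (Fh s₀)) := by
      rw [hz1]
      exact (hj.differentiableAt one_ne_zero).hasFDerivAt
    have hCd : HasFDerivAt (fun q => c q 1) (fderiv ℝ (fun q => c q 1) (j z₀, T))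
        (j (z (Fh s₀)), τ (Fh s₀)) := by
      rw [hz1, hτ1]
      exact ((hflow.contDiffAt 1).differentiableAt one_ne_zero).hasFDerivAt
    have hΘ := HasFDerivAt.comp (f := fun x => (j (z x), τ x)) (Fh s₀) hCd
      ((HasFDerivAt.comp (f := z) (Fh s₀) hjd hzd).prodMk hτd)
    have hLΘ := hasMFDerivAt_unique hL ((hΘ.hasMFDerivAt.comp s₀ hL).congr_of_eventuallyEq
      (hcF.mono fun s hs => hs.symm))
    have hjL := (HasFDerivAt.comp (f := z) (Fh s₀) hjd hzd).hasMFDerivAt.comp s₀ hL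
    have hj0 := mfderiv_coord_zero hjL ((hzt.eventually hjs).mono fun s hs => hs.2)
    have hN : fderiv ℝ (fun q => c q 1) (j z₀, T) (0, 1) = normalField g Ω e (Fh s₀) := by
      rw [hflow.fderiv_time (isOpen_preimage_chartTarget e) (contDiffOn_boundaryField hk hS he),
        boundaryField_of_coord_zero hx₁0, hcT]
    -- Chain rule for `F = Φ_τ(j ∘ z)`: the derivative is the transported derivative of the
    -- projected point plus `dτ(v)` times the normal. The latter term does not affect the metric.
    have hsplit : ∀ v : TangentSpace (𝓡 2) s₀, (mfderiv (𝓡 2) 𝓘(ℝ, E4) Fh s₀ v : E4) =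
        fderiv ℝ (fun q => c q 1) (j z₀, T)
          (fderiv ℝ j z₀ (fderiv ℝ z (Fh s₀) (mfderiv (𝓡 2) 𝓘(ℝ, E4) Fh s₀ v)), 0) +
        (fderiv ℝ τ (Fh s₀) (mfderiv (𝓡 2) 𝓘(ℝ, E4) Fh s₀ v)) • normalField g Ω e (Fh s₀) := by
      intro v
      rw [← hN, ← map_smul, ← map_add]
      have h1 := congrArg (fun L : TangentSpace (𝓡 2) s₀ →L[ℝ] E4 => L v) hLΘ
      refine h1.trans (congrArg (fderiv ℝ (fun q => c q 1) (j z₀, T)) ?_)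
      have h2 : ∀ (A : E4) (t : ℝ), (A, t) = (A, 0) + t • ((0 : E4), (1 : ℝ)) := by simp
      exact h2 _ _
    have hsrc := hzt.eventually hjs
    have hA := metric_mfderiv (g := g) he (hF.mdifferentiableAt one_ne_zero) hs rfl hL v w
    have hB := metric_mfderiv (g := g) he (((hι _).comp s₀ hH).mdifferentiableAt one_ne_zero)
      hsrc.self_of_nhds.1 (congrArg j hz1) hjL v w
    refine hA.trans (Eq.trans ?_ (congrArg (K * ·) hB).symm)
    refine Eq.trans ?_ (hconf _ _ (hj0 v) (hj0 w))
    rw [hcT]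
    have hC0 : ∀ v : TangentSpace (𝓡 2) s₀, fderiv ℝ (fun q => c q 1) (j z₀, T)
        (fderiv ℝ j z₀ (fderiv ℝ z (Fh s₀) (mfderiv (𝓡 2) 𝓘(ℝ, E4) Fh s₀ v)), 0) 0 = 0 := fun v =>
      hflow.variation_coord_zero (isOpen_preimage_chartTarget e) (contDiffOn_boundaryField hk hS he)
        (fun y hy => boundaryField_apply_zero hk hS hnull he hea hy) (hj0 v)
        (right_mem_Icc.2 zero_le_one)
    have hadd := metric_add_smul_normalField hk hS hnull he hea (extend_mem_chartTarget hs)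
      hFs.self_of_nhds.2 (hC0 v) (hC0 w) (fderiv ℝ τ (Fh s₀) (mfderiv (𝓡 2) 𝓘(ℝ, E4) Fh s₀ v))
      (fderiv ℝ τ (Fh s₀) (mfderiv (𝓡 2) 𝓘(ℝ, E4) Fh s₀ w))
    rw [← hsplit v, ← hsplit w] at hadd
    exact hadd

end Hit

/-! ### The correspondence between two cross-sections -/

section Correspondence

variable {M : Type*} [TopologicalSpace M] [ChartedSpace (EuclideanHalfSpace 4) M]
  {k : ℕ∞} {gt g : Tensor2 M} {Ω : M → ℝ}
  [IsManifold (𝓡∂ 4) ((k : ℕ∞ω) + 1) M]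
  {S S' : Type*} [TopologicalSpace S] [ChartedSpace (EuclideanSpace ℝ (Fin 2)) S]
  [TopologicalSpace S'] [ChartedSpace (EuclideanSpace ℝ (Fin 2)) S'] [IsManifold (𝓡 2) 1 S']
  {ι : S → M} {ι' : S' → M} {s₀ : S} {s₁ : S'}

/-- Near `s₀`, the map `H` is a correspondence along the generators between the surfaces `ι` and
`ι'`, and it is conformal at `s₀`. -/
structure IsCorrespondenceAt (g : Tensor2 M) (Ω : M → ℝ) (ι : S → M) (ι' : S' → M) (s₀ : S)
    (H : S → S') : Prop where
  contMDiffAt : ContMDiffAt (𝓡 2) (𝓡 2) 1 H s₀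
  sameGenerator : ∀ᶠ s in 𝓝 s₀, SameGenerator g Ω (ι s) (ι' (H s))
  conformal : ∃ K > 0, ∀ v w : TangentSpace (𝓡 2) s₀,
    g (ι' (H s₀)) (mfderiv (𝓡 2) (𝓡∂ 4) (fun s => ι' (H s)) s₀ v)
        (mfderiv (𝓡 2) (𝓡∂ 4) (fun s => ι' (H s)) s₀ w) =
      K * g (ι s₀) (mfderiv (𝓡 2) (𝓡∂ 4) ι s₀ v) (mfderiv (𝓡 2) (𝓡∂ 4) ι s₀ w)

/-- The transport stops at a parameter `t` close to `β`. If `t ≠ β`, the remaining time `β - t` has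
a strict sign, which persists for the hitting times of nearby points, so the last segment runs in
the direction of the previous ones. If `T = 0` there is no direction to respect. -/
lemma exists_correspondence_of_transport (hk : 2 ≤ k)
    (hM : IsAsymptoticallyEmptyAndSimple k gt g Ω) (hnull : IsNullHypersurface g Ω)
    (hι' : ContMDiff (𝓡 2) (𝓡∂ 4) 1 ι') (hιm' : ∀ s, ι' s ∈ scri M)
    (hsp : ∀ (s : S') (v : TangentSpace (𝓡 2) s), v ≠ 0 →
      g (ι' s) (mfderiv (𝓡 2) (𝓡∂ 4) ι' s v) (mfderiv (𝓡 2) (𝓡∂ 4) ι' s v) < 0)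
    {γ : ℝ → M} {a b β : ℝ} (hm : MapsTo γ (Icc a b) (scri M))
    (hγ : IsMIntegralCurveOn γ (normal g Ω) (Icc a b)) (hβ : β ∈ Icc a b) (hβs : ι' s₁ = γ β)
    (hF : ∃ᶠ t in 𝓝 β, t ∈ Icc a b ∧ ∃ T F, IsTransportAt g Ω ι s₀ T F ∧ F s₀ = γ t ∧
      (T = 0 ∨ 0 < T * (β - t))) :
    ∃ H : S → S', H s₀ = s₁ ∧ IsCorrespondenceAt g Ω ι ι' s₀ H := by
  obtain ⟨e, he, hea, hes⟩ : ∃ e ∈ Charts M k, e ∈ atlas (EuclideanHalfSpace 4) M ∧ γ β ∈ e.source :=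
    ⟨_, IsManifold.chart_mem_maximalAtlas (γ β), chart_mem_atlas _ _, mem_chart_source _ _⟩
  obtain ⟨c, U, hU, hc⟩ := exists_flow_along hk hM.toIsAsymptoticallySimple he hm hγ hβ hes
  obtain ⟨t, ⟨ht, T, F, hF, hFt, hT⟩, htU⟩ := (hF.and_eventually hU).exists
  obtain ⟨-, hcT, hcf⟩ := hc β ⟨mem_of_mem_nhds hU, hβ⟩ t ⟨htU, ht⟩
  obtain ⟨hs, -, -⟩ := hc t ⟨htU, ht⟩ t ⟨htU, ht⟩
  rw [← hFt] at hs hcT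
  rw [← hβs] at hcT hcf hes
  obtain ⟨H, τ, hHs, hH, hτ, hτs, hHF, K, hK, hconf⟩ := exists_hit hk hM hnull he hea
    hF.contMDiffAt (hF.flowsDir.mono fun s hs => hs.mem_scri) hs hι' hιm' hsp hes hcT hcf
  refine ⟨H, hHs, hH, ?_, ?_⟩
  · have hτT : ∀ᶠ s in 𝓝 s₀, 0 ≤ T * -τ s := by
      rcases hT with rfl | hT
      · simp
      · refine ((continuousAt_const.mul hτ.neg).eventually (lt_mem_nhds ?_)).mono fun s hs => hs.le
        change 0 < T * -τ s₀
        rwa [hτs, neg_sub]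
    filter_upwards [hF.flowsDir, hHF, hτT] with s h1 h2 h3
    exact (h1.trans h2.symm h3).sameGenerator
  · obtain ⟨K', hK', hconf'⟩ := hF.conformal
    refine ⟨K⁻¹ * K', mul_pos (inv_pos.2 hK) hK', fun v w => ?_⟩
    rw [mul_assoc, ← hconf', hconf, inv_mul_cancel_left₀ hK.ne']

lemma exists_correspondence (hk : 2 ≤ k)
    (hM : IsAsymptoticallyEmptyAndSimple k gt g Ω) (hnull : IsNullHypersurface g Ω)
    (hι : ContMDiff (𝓡 2) (𝓡∂ 4) 1 ι) (hιm : ∀ s, ι s ∈ scri M)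
    (hι' : ContMDiff (𝓡 2) (𝓡∂ 4) 1 ι') (hιm' : ∀ s, ι' s ∈ scri M)
    (hsp : ∀ (s : S') (v : TangentSpace (𝓡 2) s), v ≠ 0 →
      g (ι' s) (mfderiv (𝓡 2) (𝓡∂ 4) ι' s v) (mfderiv (𝓡 2) (𝓡∂ 4) ι' s v) < 0)
    (h : SameGenerator g Ω (ι s₀) (ι' s₁)) :
    ∃ H : S → S', H s₀ = s₁ ∧ IsCorrespondenceAt g Ω ι ι' s₀ H := by
  obtain ⟨γ, a, b, hab, hm, hγ, h⟩ := h
  rcases hab.eq_or_lt with rfl | hlt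
  · have ha : ι s₀ = γ a ∧ ι' s₁ = γ a := by
      rcases h with h | h
      · exact ⟨h.1.symm, h.2.symm⟩
      · exact ⟨h.2.symm, h.1.symm⟩
    refine exists_correspondence_of_transport hk hM hnull hι' hιm' hsp hm hγ
      (left_mem_Icc.2 le_rfl) ha.2
      fun hneg => hneg.self_of_nhds ?_
    exact ⟨left_mem_Icc.2 le_rfl, 0, ι, .refl (hι s₀) hιm, ha.1, Or.inl rfl⟩
  rcases h with ⟨ha, hb⟩ | ⟨ha, hb⟩
  · refine exists_correspondence_of_transport hk hM hnull hι' hιm' hsp hm hγ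
      (right_mem_Icc.2 hab) hb.symm ?_
    refine (Eventually.frequently (f := 𝓝[<] b) ?_).filter_mono nhdsWithin_le_nhds
    filter_upwards [Ioo_mem_nhdsLT hlt] with t ht
    have hsub : Icc a t ⊆ Icc a b := Icc_subset_Icc_right ht.2.le
    obtain ⟨F, hF, hFt⟩ := exists_transport_right hk hM hnull (hι s₀) hιm (hm.mono_left hsub)
      (hγ.mono hsub) ht.1.le ha.symm
    exact ⟨⟨ht.1.le, ht.2.le⟩, _, F, hF, hFt, Or.inr (mul_pos (sub_pos.2 ht.1) (sub_pos.2 ht.2))⟩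
  · refine exists_correspondence_of_transport hk hM hnull hι' hιm' hsp hm hγ
      (left_mem_Icc.2 hab) ha.symm ?_
    refine (Eventually.frequently (f := 𝓝[>] a) ?_).filter_mono nhdsWithin_le_nhds
    filter_upwards [Ioo_mem_nhdsGT hlt] with t ht
    have hsub : Icc t b ⊆ Icc a b := Icc_subset_Icc_left ht.1.le
    obtain ⟨F, hF, hFt⟩ := exists_transport_left hk hM hnull (hι s₀) hιm (hm.mono_left hsub)
      (hγ.mono hsub) ht.2.le hb.symm
    exact ⟨⟨ht.1.le, ht.2.le⟩, _, F, hF, hFt,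
      Or.inr (mul_pos_of_neg_of_neg (sub_neg.2 ht.2) (sub_neg.2 ht.1))⟩

lemma IsCrossSection.exists_contMDiff {C : Set M} (hk : 2 ≤ k)
    (hM : IsAsymptoticallyEmptyAndSimple k gt g Ω) (hnull : IsNullHypersurface g Ω)
    (hC : C ⊆ scri M) (h₁ : IsCrossSection g Ω C ι) (h₂ : IsCrossSection g Ω C ι') :
    ∃ h : S → S', ContMDiff (𝓡 2) (𝓡 2) 1 h ∧ (∀ s, SameGenerator g Ω (ι s) (ι' (h s))) ∧
      ∃ K : S → ℝ, (∀ s, 0 < K s) ∧ ∀ (s : S) (v w : TangentSpace (𝓡 2) s),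
        g (ι' (h s)) (mfderiv (𝓡 2) (𝓡∂ 4) ι' (h s) (mfderiv (𝓡 2) (𝓡 2) h s v))
            (mfderiv (𝓡 2) (𝓡∂ 4) ι' (h s) (mfderiv (𝓡 2) (𝓡 2) h s w)) =
          K s * g (ι s) (mfderiv (𝓡 2) (𝓡∂ 4) ι s v) (mfderiv (𝓡 2) (𝓡∂ 4) ι s w) := by
  choose h hh huniq using fun s => h₂.existsUnique (ι s) (h₁.mem s)
  have hloc : ∀ s₀, IsCorrespondenceAt g Ω ι ι' s₀ h := by
    intro s₀
    obtain ⟨H, hHs, hH⟩ := exists_correspondence hk hM hnull h₁.contMDiff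
      (fun s => hC (h₁.mem s)) h₂.contMDiff (fun s => hC (h₂.mem s)) h₂.spacelike (hh s₀)
    -- A generator meets the second cross-section only once, so the globally chosen `h` inherits
    -- regularity and conformality from the local correspondence.
    have heq : h =ᶠ[𝓝 s₀] H := hH.sameGenerator.mono fun s hs => (huniq s _ hs).symm
    refine ⟨hH.contMDiffAt.congr_of_eventuallyEq heq, Eventually.of_forall hh, ?_⟩
    obtain ⟨K, hK, hconf⟩ := hH.conformal
    have h1 : ∀ v, (mfderiv (𝓡 2) (𝓡∂ 4) (fun s => ι' (h s)) s₀ v : E4) =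
        mfderiv (𝓡 2) (𝓡∂ 4) (fun s => ι' (H s)) s₀ v := fun v =>
      congrArg (fun L : TangentSpace (𝓡 2) s₀ →L[ℝ] E4 => L v) (heq.fun_comp ι').mfderiv_eq
    have h2 : ∀ p q : M, p = q → ∀ v w : E4, g p v w = g q v w := by
      rintro p _ rfl v w
      rfl
    refine ⟨K, hK, fun v w => (h2 _ _ (congrArg ι' heq.self_of_nhds) _ _).trans ?_⟩
    rw [← hconf]
    exact congrArg₂ (fun v w : E4 => g (ι' (H s₀)) v w) (h1 v) (h1 w)
  choose K hK hconf using fun s => (hloc s).conformal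
  refine ⟨h, fun s => (hloc s).contMDiffAt, hh, K, hK, fun s v w => ?_⟩
  have h1 : mfderiv (𝓡 2) (𝓡∂ 4) (fun s => ι' (h s)) s =
      (mfderiv (𝓡 2) (𝓡∂ 4) ι' (h s)).comp (mfderiv (𝓡 2) (𝓡 2) h s) :=
    mfderiv_comp s ((h₂.contMDiff (h s)).mdifferentiableAt one_ne_zero)
      ((hloc s).contMDiffAt.mdifferentiableAt one_ne_zero)
  have h2 := hconf s v w
  rw [h1] at h2
  exact h2

end Correspondence

end ConformalInfinity

end

theorem mainTheorem10 (k : ℕ∞) (hk : 2 ≤ k)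
    {M : Type*} [TopologicalSpace M] [T2Space M] [SecondCountableTopology M]
    [ChartedSpace (EuclideanHalfSpace 4) M] [IsManifold (𝓡∂ 4) ((k : ℕ∞ω) + 1) M]
    (gt g : ConformalInfinity.Tensor2 M) (Ω : M → ℝ)
    (hM : ConformalInfinity.IsAsymptoticallyEmptyAndSimple k gt g Ω)
    (hnull : ConformalInfinity.IsNullHypersurface g Ω) :
    ConformalInfinity.IsShearFree k g Ω ∧
    ∀ p₀ ∈ ConformalInfinity.scri M,
      ∀ (S₁ : Type*) [TopologicalSpace S₁] [ChartedSpace (EuclideanSpace ℝ (Fin 2)) S₁]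
        [IsManifold (𝓡 2) 1 S₁]
        (S₂ : Type*) [TopologicalSpace S₂] [ChartedSpace (EuclideanSpace ℝ (Fin 2)) S₂]
        [IsManifold (𝓡 2) 1 S₂]
        (ι₁ : S₁ → M) (ι₂ : S₂ → M),
        ConformalInfinity.IsCrossSection g Ω
          (connectedComponentIn (ConformalInfinity.scri M) p₀) ι₁ →
        ConformalInfinity.IsCrossSection g Ω
          (connectedComponentIn (ConformalInfinity.scri M) p₀) ι₂ →
        ∃ h : Diffeomorph (𝓡 2) (𝓡 2) S₁ S₂ 1,
          (∀ s, ConformalInfinity.SameGenerator g Ω (ι₁ s) (ι₂ (h s))) ∧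
          ConformalInfinity.IsConformalMap g ι₁ ι₂ h := by
  refine ⟨ConformalInfinity.isShearFree hk hM, ?_⟩
  intro p₀ _ S₁ _ _ _ S₂ _ _ _ ι₁ ι₂ h₁ h₂
  have hC := connectedComponentIn_subset (ConformalInfinity.scri M) p₀
  obtain ⟨h, hd, hs, hconf⟩ := h₁.exists_contMDiff hk hM hnull hC h₂
  obtain ⟨h', hd', hs', -⟩ := h₂.exists_contMDiff hk hM hnull hC h₁
  refine ⟨⟨⟨h, h', fun s => ?_, fun s => ?_⟩, hd, hd'⟩, hs, hconf⟩
  -- Both `s` and `h' (h s)` are points of `S₁` on the generator of `ι₂ (h s)`, so they coincide;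
  -- this needs only symmetry, not transitivity, of `SameGenerator`.
  · exact (h₁.existsUnique _ (h₂.mem (h s))).unique (hs' (h s)) (hs s).symm
  · exact (h₂.existsUnique _ (h₁.mem (h' s))).unique (hs (h' s)) (hs' s).symm
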